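/- **Lemma 6.6.** Let $\mathbb F$ be a finite field, $g\in\mathbb N$, and equip $\mathbb F^{2g}=\mathbb F^g\times\mathbb F^g$ with the symplectic form $\langle (x,y),(z,w)\rangle = x\cdot w-y\cdot z$. The symplectic spherical building $C_g$ over $\mathbb F$ is the simplicial complex whose vertices are the non-zero isotropic subspaces of $\mathbb F^{2g}$ and whose faces are the flags of such subspaces; the color of a vertex is its dimension, and for a set $I\subseteq\{1,\dots,g\}$ of colors $C_g^I$ denotes the subcomplex induced on the vertices with color in $I$. For a finite pure $d$-dimensional complex $X$ ($d\ge 2$) and a group $\Gamma$, let $C^1(X,\Gamma)$ be the set of functions $f$ from the oriented edges to $\Gamma$ with $f(u,v)=f(v,u)^{-1}$; put $\delta f(u,v,w)=f(u,v)f(v,w)f(w,u)$ on oriented triangles, $Z^1(X,\Gamma)=\{f\in C^1(X,\Gamma):\delta f\equiv 1\}$, and $B^1(X,\Gamma)=\{(u,v)\mapsto h(u)h(v)^{-1} : h:X(0)\to\Gamma\}$. Random oriented edges and triangles are sampled by choosing a uniformly random $d$-face and then a uniformly random ordered tuple of distinct vertices in it. For $\beta>0$, write $h^1(X)\ge\beta$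 ("$X$ is a $\beta$-coboundary expander") if for every group $\Gamma$ one has $Z^1(X,\Gamma)=B^1(X,\Gamma)$, and for every $f\in C^1(X,\Gamma)$ there is $f'\in Z^1(X,\Gamma)$ with $\beta\cdot\Pr_{uv}[f(u,v)\ne f'(u,v)]\le \Pr_{uvw}[\delta f(u,v,w)\neq 1]$. There are absolute constants $c,K>0$ such that for every finite field $\mathbb F$, every $g$, and all integers $1\le i_0<i_1<i_2<i_3\le g$ with $i_0<i_1-79$, the complex $C_g^I$ over $\mathbb F$ with $I=\{i_0,i_1,i_2,i_3\}$ satisfies $$h^1(C_g^I)\ \ge\ c\cdot\exp\left(K\cdot\log\left(\frac{i_3}{i_1-i_0}\right)\cdot\min\left\{\log\left(\frac{i_1-i_0}{i_3-i_0}\right),\ \log\left(\frac{i_1-i_0}{i_0}\right)\right\}\right).$$ -/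

import Mathlib

universe w u

/-! ## Finite simplicial complexes and non-abelian coboundary expansion -/

namespace SimplicialExpansion

/-- The probability of the event `P` on the oriented `k`-faces of a finite pure `d`-dimensional
complex `X`. A random oriented `k`-face is sampled by choosing a top-dimensional face (one with
`d + 1` vertices) uniformly at random, and then choosing uniformly at random an ordered tuple of
`k + 1` distinct vertices of it. (All top-dimensional faces have the same number of such tuples,
so this is the uniform distribution on the pairs (top-dimensional face, tuple).) -/
noncomputable def faceProb {V : Type*} [Finite V] (X : PreAbstractSimplicialComplex V) (d k : ℕ)
    (P : (Fin (k + 1) → V) → Prop) : ℝ :=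
  ({q : Finset V × (Fin (k + 1) → V) | (q.1 ∈ X.faces ∧ q.1.card = d + 1) ∧
      (Function.Injective q.2 ∧ ∀ j, q.2 j ∈ q.1) ∧ P q.2}.ncard : ℝ) /
  ({q : Finset V × (Fin (k + 1) → V) | (q.1 ∈ X.faces ∧ q.1.card = d + 1) ∧
      (Function.Injective q.2 ∧ ∀ j, q.2 j ∈ q.1)}.ncard : ℝ)

/-- `(u, v)` is an oriented edge of `X`. -/
def IsOrientedEdge {V : Type*} (X : PreAbstractSimplicialComplex V) (u v : V) : Prop :=
  u ≠ v ∧ ∃ s ∈ X.faces, u ∈ s ∧ v ∈ s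

/-- `(u, v, w)` is an oriented triangle of `X`. -/
def IsOrientedTriangle {V : Type*} (X : PreAbstractSimplicialComplex V) (u v w : V) : Prop :=
  u ≠ v ∧ v ≠ w ∧ u ≠ w ∧ ∃ s ∈ X.faces, u ∈ s ∧ v ∈ s ∧ w ∈ s

/-- `C¹(X, Γ)`: antisymmetric functions on the oriented edges. A cochain is represented by a function
on all pairs of vertices; its values outside the oriented edges are irrelevant everywhere below. -/
def IsCochain {V Γ : Type*} [Group Γ] (X : PreAbstractSimplicialComplex V) (f : V → V → Γ) : Prop :=
  ∀ u v, IsOrientedEdge X u v → f u v = (f v u)⁻¹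

/-- The coboundary of a `0`-cochain: `δ₀ h (u, v) = h u * (h v)⁻¹`. -/
def coboundaryZero {V Γ : Type*} [Group Γ] (h : V → Γ) (u v : V) : Γ :=
  h u * (h v)⁻¹

/-- The coboundary of a `1`-cochain: `δ₁ f (u, v, w) = f (u, v) * f (v, w) * f (w, u)`. -/
def coboundaryOne {V Γ : Type*} [Group Γ] (f : V → V → Γ) (u v w : V) : Γ :=
  f u v * f v w * f w u

/-- `Z¹(X, Γ)`: the `1`-cochains whose coboundary is trivial on every oriented triangle. -/
def IsCocycle {V Γ : Type*} [Group Γ] (X : PreAbstractSimplicialComplex V) (f : V → V → Γ) : Prop :=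
  IsCochain X f ∧ ∀ u v w, IsOrientedTriangle X u v w → coboundaryOne f u v w = 1

/-- `B¹(X, Γ)`: the `1`-cochains that are coboundaries of `0`-cochains. -/
def IsCoboundary {V Γ : Type*} [Group Γ] (X : PreAbstractSimplicialComplex V)
    (f : V → V → Γ) : Prop :=
  ∃ h : V → Γ, ∀ u v, IsOrientedEdge X u v → f u v = coboundaryZero h u v

/-- The distance of two `1`-cochains: the probability that they differ on a random oriented edge. -/
noncomputable def cochainDist {V Γ : Type*} [Finite V] (X : PreAbstractSimplicialComplex V) (d : ℕ)
    (f f' : V → V → Γ) : ℝ :=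
  faceProb X d 1 fun v => f (v 0) (v 1) ≠ f' (v 0) (v 1)

/-- The weight of `δ₁ f`: the probability that it is non-trivial on a random oriented triangle. -/
noncomputable def coboundaryWeight {V Γ : Type*} [Finite V] [Group Γ]
    (X : PreAbstractSimplicialComplex V) (d : ℕ) (f : V → V → Γ) : ℝ :=
  faceProb X d 2 fun v => coboundaryOne f (v 0) (v 1) (v 2) ≠ 1

/-- The pure `d`-dimensional finite complex `X` is a `β`-cocycle expander for `1`-cochains with
coefficients in an arbitrary group. -/
def IsCocycleExpander {V : Type u} [Finite V] (X : PreAbstractSimplicialComplex V) (d : ℕ)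
    (β : ℝ) : Prop :=
  0 < β ∧ ∀ (Γ : Type w) [Group Γ] (f : V → V → Γ), IsCochain X f →
    ∃ f' : V → V → Γ, IsCocycle X f' ∧ β * cochainDist X d f f' ≤ coboundaryWeight X d f

/-- The pure `d`-dimensional finite complex `X` is a `β`-coboundary expander for `1`-cochains, which
is what `h¹(X) ≥ β` means: it is a `β`-cocycle expander and `Z¹(X, Γ) = B¹(X, Γ)` for all groups. -/
def IsCoboundaryExpander {V : Type u} [Finite V] (X : PreAbstractSimplicialComplex V) (d : ℕ)
    (β : ℝ) : Prop :=
  IsCocycleExpander.{w} X d β ∧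
    ∀ (Γ : Type w) [Group Γ] (f : V → V → Γ), IsCocycle X f ↔ IsCoboundary X f

/-- The subcomplex of `X` induced on a set `A` of vertices. -/
def induced {V : Type*} (X : PreAbstractSimplicialComplex V) (A : Set V) :
    PreAbstractSimplicialComplex V where
  faces := {s | s ∈ X.faces ∧ ∀ v ∈ s, v ∈ A}
  isRelLowerSet_faces := by
    rintro s ⟨hs, hA⟩
    refine ⟨(X.isRelLowerSet_faces hs).1, fun t hts ht => ?_⟩
    exact ⟨(X.isRelLowerSet_faces hs).2 hts ht, fun v hv => hA v (hts hv)⟩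

end SimplicialExpansion

/-! ## The symplectic spherical building -/

namespace SymplecticBuilding

/-- The space `F^{2g}`, written as pairs `(x, y)` with `x, y ∈ F^g`. -/
abbrev Space (F : Type*) (g : ℕ) : Type _ := (Fin g → F) × (Fin g → F)

/-- The standard symplectic form `⟨(x, y), (z, w)⟩ = x ⬝ w - y ⬝ z`. -/
def form {F : Type*} [Field F] {g : ℕ} (a b : Space F g) : F :=
  a.1 ⬝ᵥ b.2 - a.2 ⬝ᵥ b.1

/-- A subspace on which the symplectic form vanishes identically. -/
def IsIsotropic {F : Type*} [Field F] {g : ℕ} (W : Submodule F (Space F g)) : Prop :=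
  ∀ a ∈ W, ∀ b ∈ W, form a b = 0

/-- The symplectic spherical building `C_g` over `F`: the vertices are the non-trivial isotropic
subspaces of `F^{2g}` and the faces are the (non-empty) flags of such subspaces. -/
def building (F : Type*) [Field F] (g : ℕ) :
    PreAbstractSimplicialComplex (Submodule F (Space F g)) where
  faces := {s | s.Nonempty ∧ (∀ W ∈ s, W ≠ ⊥ ∧ IsIsotropic W) ∧
    IsChain (· ≤ ·) (s : Set (Submodule F (Space F g)))}
  isRelLowerSet_faces := by
    rintro s ⟨hs, hW, hc⟩
    refine ⟨hs, fun t hts ht => ?_⟩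
    exact ⟨ht, fun W hWt => hW W (hts hWt), hc.mono (Finset.coe_subset.mpr hts)⟩

/-- The color restriction `C_g^I`: the complex induced on the subspaces whose color, that is, whose
dimension, lies in `I`. -/
def colorRestriction (F : Type*) [Field F] (g : ℕ) (I : Finset ℕ) :
    PreAbstractSimplicialComplex (Submodule F (Space F g)) :=
  SimplicialExpansion.induced (building F g) {W | Module.finrank F W ∈ I}

end SymplecticBuilding

/-! The average defect is first turned into a worst-case one. Let `G` be the symplectic group and
let `translates` send a pair of subspaces to the values of `f` on all its translates, a function
from `G` to `Γ`. By Witt's theorem `G` is transitive on flags of a given type, so every flag that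
starts in dimension `k = i₀` fails to close on at most a fraction 64·Pr[δf ≠ 1] of `G`. It therefore
suffices to find a primitive of this function-valued cochain with a uniform error: reading it off at
a suitable group element gives a 0-cochain whose coboundary is as close to `f`.

Put m = i₁ - i₀. For x, y of dimension k inside an isotropic t of dimension k + m, the holonomy
f(x,t) f(y,t)⁻¹ hardly depends on t. For neighbouring t this follows from a common larger subspace.
For distant t it follows on average from a Poincaré inequality whose constant is independent of the
field and the rank (`IsSymplectic.poincare`), and then for every t because the stabilizer of x and y
is transitive on such t (`FlagDefect.disagree_of_le`). The Poincaré inequality is a local-to-global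
argument: orthogonality of the points of a symplectic space is a strongly regular relation, and its
eigenvalue propagates a spectral gap one dimension upwards (`IsSymplectic.hasGap_succ`).

The holonomies form a near-cocycle on the isotropic k-spaces, with triangles spanning an isotropic
space of dimension at most k + m. This complex is contracted by pushing all subspaces into ones that
contain a growing isotropic B (`IsSymplectic.exists_push`, `RipsDefect.square`). About n = 40k/m
steps suffice and the error is linear in n. Joining two k-spaces under a common w takes up to n
small moves, so the total error is O(n²) = O((i₃/m)²) times the defect. As one of i₀, i₃ - i₀ is at
least i₃/2, the exponential in the bound is at most e²(m/i₃)², which absorbs this loss. For a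
cocycle the defect is zero and the primitive is exact. -/

open Module

set_option linter.unusedSectionVars false

namespace SymplecticGeometry

/-! ### Dimension counts for subspaces -/

section Dimension

variable {F V : Type*} [Field F] [AddCommGroup V] [Module F V] [FiniteDimensional F V]

theorem exists_finrank_eq_between {A C : Submodule F V} (hAC : A ≤ C) {n : ℕ}
    (h₁ : finrank F A ≤ n) (h₂ : n ≤ finrank F C) :
    ∃ B, A ≤ B ∧ B ≤ C ∧ finrank F B = n := by
  induction n, h₁ using Nat.le_induction with
  | base => exact ⟨A, le_rfl, hAC, rfl⟩
  | succ n hn ih =>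
    obtain ⟨B, hAB, hBC, hB⟩ := ih (by omega)
    have hlt : B < C := lt_of_le_of_ne hBC (by rintro rfl; omega)
    obtain ⟨v, hvC, hvB⟩ := SetLike.exists_of_lt hlt
    refine ⟨B ⊔ F ∙ v, hAB.trans le_sup_left, sup_le hBC ?_, ?_⟩
    · simpa using hvC
    · rw [Submodule.finrank_sup_span_singleton hvB, hB]

theorem finrank_sup_add_finrank_inf (A B : Submodule F V) :
    finrank F ↥(A ⊔ B) + finrank F ↥(A ⊓ B) = finrank F A + finrank F B :=
  Submodule.finrank_sup_add_finrank_inf_eq A B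

/-- Two subspaces of a third one meet in the expected dimension. -/
theorem finrank_add_le_inf {A B C : Submodule F V} (hA : A ≤ C) (hB : B ≤ C) :
    finrank F A + finrank F B ≤ finrank F C + finrank F ↥(A ⊓ B) := by
  have h := finrank_sup_add_finrank_inf A B
  have h' := Submodule.finrank_mono (sup_le hA hB)
  omega

theorem finrank_sup_le_of_le {A B C : Submodule F V} (hA : C ≤ A) (hB : C ≤ B) :
    finrank F ↥(A ⊔ B) + finrank F C ≤ finrank F A + finrank F B := by
  have h := finrank_sup_add_finrank_inf A B
  have h' := Submodule.finrank_mono (le_inf hA hB)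
  omega

end Dimension

/-! ### Isotropic subspaces, transvections and Witt's theorem -/

variable {F V : Type*} [Field F] [AddCommGroup V] [Module F V]

/-- A nondegenerate alternating form on a space of dimension `2 * g`. -/
structure IsSymplectic (ω : LinearMap.BilinForm F V) (g : ℕ) : Prop where
  alt : ω.IsAlt
  nondegenerate : ω.Nondegenerate
  finrank_eq : finrank F V = 2 * g

/-- A subspace contained in its orthogonal. -/
def Isotropic (ω : LinearMap.BilinForm F V) (W : Submodule F V) : Prop :=
  W ≤ ω.orthogonal W

variable {ω : LinearMap.BilinForm F V} {g : ℕ}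

theorem orthogonal_sup (A B : Submodule F V) :
    ω.orthogonal (A ⊔ B) = ω.orthogonal A ⊓ ω.orthogonal B := by
  refine le_antisymm (le_inf (LinearMap.BilinForm.orthogonal_le le_sup_left)
    (LinearMap.BilinForm.orthogonal_le le_sup_right)) ?_
  rintro x ⟨hA, hB⟩ y hy
  obtain ⟨a, ha, b, hb, rfl⟩ := Submodule.mem_sup.1 hy
  have h1 : ω a x = 0 := hA a ha
  have h2 : ω b x = 0 := hB b hb
  change ω (a + b) x = 0
  rw [map_add, LinearMap.add_apply, h1, h2, add_zero]

namespace IsSymplectic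

variable (hω : IsSymplectic ω g)
include hω

theorem isRefl : ω.IsRefl := hω.alt.isRefl

theorem le_orthogonal_comm {A B : Submodule F V} :
    A ≤ ω.orthogonal B ↔ B ≤ ω.orthogonal A := by
  constructor <;> intro h x hx y hy
  · exact hω.isRefl _ _ (h hy x hx)
  · exact hω.isRefl _ _ (h hy x hx)

theorem isotropic_sup {A B : Submodule F V} :
    Isotropic ω (A ⊔ B) ↔ Isotropic ω A ∧ Isotropic ω B ∧ A ≤ ω.orthogonal B := by
  unfold Isotropic
  rw [orthogonal_sup, sup_le_iff, le_inf_iff, le_inf_iff, hω.le_orthogonal_comm (A := B) (B := A)]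
  tauto

theorem isotropic_span_singleton (x : V) : Isotropic ω (F ∙ x) := by
  intro y hy z hz
  obtain ⟨a, rfl⟩ := Submodule.mem_span_singleton.1 hy
  obtain ⟨b, rfl⟩ := Submodule.mem_span_singleton.1 hz
  change ω (b • x) (a • x) = 0
  simp [hω.alt x]

end IsSymplectic

theorem Isotropic.mono {A B : Submodule F V} (h : Isotropic ω B) (hAB : A ≤ B) : Isotropic ω A :=
  hAB.trans (h.trans (LinearMap.BilinForm.orthogonal_le hAB))

theorem isotropic_bot : Isotropic ω ⊥ := bot_le

/-! ### The symplectic group -/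

/-- The group of isometries of a bilinear form. -/
def isometryGroup (ω : LinearMap.BilinForm F V) : Subgroup (V ≃ₗ[F] V) where
  carrier := {h | ∀ a b, ω (h a) (h b) = ω a b}
  mul_mem' {h h'} H H' a b := by
    change ω (h (h' a)) (h (h' b)) = _
    rw [H, H']
  one_mem' _ _ := rfl
  inv_mem' {h} H a b := by
    have := H (h.symm a) (h.symm b)
    simp only [LinearEquiv.apply_symm_apply] at this
    exact this.symm

/-- The symplectic transvection in direction `a` that maps `x` to `x + c * ω x a • a`. -/
theorem IsSymplectic.exists_transvection (hω : IsSymplectic ω g) (a : V) (c : F) :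
    ∃ h ∈ isometryGroup ω, ∀ x, h x = x + (c * ω x a) • a := by
  have ha : (c • LinearMap.flip ω a) a = 0 := by simp [hω.alt a]
  have key : ∀ x, LinearEquiv.transvection ha x = x + (c * ω x a) • a := fun x => rfl
  refine ⟨LinearEquiv.transvection ha, ?_, key⟩
  intro x y
  have hx : ω a y = - ω y a := (hω.alt.neg_eq y a).symm
  simp only [key, map_add, map_smul, LinearMap.add_apply, LinearMap.smul_apply, smul_eq_mul,
    hω.alt a, hx]
  ring

/-- The transvection in direction y - x works: since ω x (y - x) = ω x y, the coefficient (ω x y)⁻¹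
makes it add exactly y - x to x, and its direction is orthogonal to E. -/
theorem IsSymplectic.exists_isometry_of_ne (hω : IsSymplectic ω g) {E : Submodule F V} {x y : V}
    (hx : x ∈ ω.orthogonal E) (hy : y ∈ ω.orthogonal E) (hxy : ω x y ≠ 0) :
    ∃ h ∈ isometryGroup ω, (∀ e ∈ E, h e = e) ∧ h x = y := by
  obtain ⟨h, hh, hc⟩ := hω.exists_transvection (y - x) (ω x y)⁻¹
  refine ⟨h, hh, fun e he => ?_, ?_⟩
  · have h1 : ω e y = 0 := hy e he
    have h2 : ω e x = 0 := hx e he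
    simp [hc, h1, h2]
  · simp [hc, hω.alt x, hxy]

open scoped Pointwise

theorem smul_finrank (h : isometryGroup ω) (W : Submodule F V) :
    finrank F ↥(h • W) = finrank F W :=
  LinearEquiv.finrank_map_eq (h : V ≃ₗ[F] V) W

theorem smul_le_smul_iff (h : isometryGroup ω) {A B : Submodule F V} : h • A ≤ h • B ↔ A ≤ B :=
  Submodule.map_le_map_iff_of_injective (h : V ≃ₗ[F] V).injective A B

theorem Isotropic.smul {W : Submodule F V} (hW : Isotropic ω W) (h : isometryGroup ω) :
    Isotropic ω (h • W) := by
  rintro _ ⟨x, hx, rfl⟩ _ ⟨y, hy, rfl⟩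
  exact (h.2 y x).trans (hW hx y hy)

theorem isotropic_smul_iff {W : Submodule F V} (h : isometryGroup ω) :
    Isotropic ω (h • W) ↔ Isotropic ω W :=
  ⟨fun H => by simpa using H.smul h⁻¹, fun H => H.smul h⟩

theorem smul_eq_of_fixes {h : isometryGroup ω} {A : Submodule F V} (hA : ∀ e ∈ A, h • e = e) :
    h • A = A := by
  ext x
  constructor
  · rintro ⟨y, hy, rfl⟩
    have : h • y ∈ A := (hA y hy).symm ▸ hy
    exact this
  · exact fun hx => ⟨x, hx, hA x hx⟩

variable [FiniteDimensional F V]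

theorem IsSymplectic.finrank_orthogonal (hω : IsSymplectic ω g) (W : Submodule F V) :
    finrank F (ω.orthogonal W) + finrank F W = 2 * g := by
  have h := LinearMap.BilinForm.finrank_orthogonal hω.nondegenerate W
  have h' := Submodule.finrank_le W
  have := hω.finrank_eq
  omega

theorem IsSymplectic.orthogonal_orthogonal (hω : IsSymplectic ω g) (W : Submodule F V) :
    ω.orthogonal (ω.orthogonal W) = W :=
  LinearMap.BilinForm.orthogonal_orthogonal hω.nondegenerate hω.isRefl W

/-- An isotropic subspace of the radical of `S` extends inside `Sᗮ` to isotropic subspaces of all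
dimensions up to `g - (dim S - dim u) / 2`. -/
theorem IsSymplectic.exists_isotropic_extension (hω : IsSymplectic ω g) {u S : Submodule F V}
    (huS : u ≤ S) (hSu : S ≤ ω.orthogonal u) {k : ℕ} (h₁ : finrank F u ≤ k)
    (h₂ : 2 * k + finrank F S ≤ 2 * g + finrank F u) :
    ∃ Z, u ≤ Z ∧ Z ≤ ω.orthogonal S ∧ Isotropic ω Z ∧ finrank F Z = k := by
  induction k, h₁ using Nat.le_induction with
  | base =>
    exact ⟨u, le_rfl, hω.le_orthogonal_comm.1 hSu, huS.trans hSu, rfl⟩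
  | succ n hn ih =>
    obtain ⟨Z, huZ, hZS, hZ, hZn⟩ := ih (by omega)
    -- The orthogonal of Z + S has dimension at least n + 2, so it cannot lie in Z, which has
    -- dimension n.
    have hlt : ¬ ω.orthogonal (Z ⊔ S) ≤ Z := by
      intro hle
      have h1 := Submodule.finrank_mono hle
      have h2 := hω.finrank_orthogonal (Z ⊔ S)
      have h3 := finrank_sup_le_of_le huZ huS
      omega
    obtain ⟨v, hv, hvZ⟩ := SetLike.not_le_iff_exists.1 hlt
    rw [orthogonal_sup] at hv
    refine ⟨Z ⊔ F ∙ v, huZ.trans le_sup_left, sup_le hZS (by simpa using hv.2), ?_, ?_⟩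
    · refine hω.isotropic_sup.2 ⟨hZ, hω.isotropic_span_singleton v, ?_⟩
      exact hω.le_orthogonal_comm.1 (by simpa using hv.1)
    · rw [Submodule.finrank_sup_span_singleton hvZ, hZn]

/-- Isotropic subspaces extend to isotropic subspaces of every dimension up to `g`. -/
theorem IsSymplectic.exists_isotropic_ge (hω : IsSymplectic ω g) {u : Submodule F V}
    (hu : Isotropic ω u) {k : ℕ} (h₁ : finrank F u ≤ k) (h₂ : k ≤ g) :
    ∃ Z, u ≤ Z ∧ Isotropic ω Z ∧ finrank F Z = k := by
  obtain ⟨Z, h, -, h', h''⟩ := hω.exists_isotropic_extension le_rfl hu h₁ (by omega)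
  exact ⟨Z, h, h', h''⟩

/-- Two transvections, x ↦ z ↦ y, through some z orthogonal to E but to neither x nor y. Such a z
exists because x and y lie outside E, the double orthogonal of E, and a space is not the union of
two proper subspaces. -/
theorem IsSymplectic.exists_isometry_fixing (hω : IsSymplectic ω g) {E : Submodule F V} {x y : V}
    (hx : x ∈ ω.orthogonal E) (hy : y ∈ ω.orthogonal E) (hxE : x ∉ E) (hyE : y ∉ E) :
    ∃ h ∈ isometryGroup ω, (∀ e ∈ E, h e = e) ∧ h x = y := by
  have key : ∀ x, x ∉ E → ∃ z ∈ ω.orthogonal E, ω x z ≠ 0 := by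
    intro x hxE
    by_contra! H
    apply hxE
    rw [← hω.orthogonal_orthogonal E]
    intro z hz
    exact hω.isRefl _ _ (H z hz)
  obtain ⟨z, hz, hxz, hyz⟩ : ∃ z ∈ ω.orthogonal E, ω x z ≠ 0 ∧ ω y z ≠ 0 := by
    obtain ⟨z₁, hz₁, h₁⟩ := key x hxE
    obtain ⟨z₂, hz₂, h₂⟩ := key y hyE
    by_cases h₃ : ω y z₁ = 0
    · by_cases h₄ : ω x z₂ = 0
      · refine ⟨z₁ + z₂, add_mem hz₁ hz₂, ?_, ?_⟩
        · simpa [h₄] using h₁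
        · simpa [h₃] using h₂
      · exact ⟨z₂, hz₂, h₄, h₂⟩
    · exact ⟨z₁, hz₁, h₁, h₃⟩
  obtain ⟨h, hh, hE, hx'⟩ := hω.exists_isometry_of_ne hx hz hxz
  obtain ⟨h', hh', hE', hy'⟩ := hω.exists_isometry_of_ne hz hy
    (fun H => hyz (hω.isRefl _ _ H))
  refine ⟨h' * h, mul_mem hh' hh, fun e he => ?_, ?_⟩
  · rw [LinearEquiv.mul_apply, hE e he, hE' e he]
  · rw [LinearEquiv.mul_apply, hx', hy']

/-- **Witt's theorem**: the pointwise stabilizer of `σ` acts transitively on the isotropic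
subspaces of given dimension that contain `σ`. -/
theorem IsSymplectic.exists_smul_eq (hω : IsSymplectic ω g) {σ t t' : Submodule F V}
    (ht : Isotropic ω t) (ht' : Isotropic ω t') (hσt : σ ≤ t) (hσt' : σ ≤ t')
    (hd : finrank F t = finrank F t') :
    ∃ h : isometryGroup ω, (∀ e ∈ σ, h • e = e) ∧ h • t = t' := by
  induction n : finrank F t - finrank F σ generalizing σ t with
  | zero =>
    have h1 := Submodule.finrank_mono hσt
    have e1 := Submodule.eq_of_le_of_finrank_le hσt (by omega)
    have e2 := Submodule.eq_of_le_of_finrank_le hσt' (by omega)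
    exact ⟨1, fun e _ => one_smul _ e, by rw [one_smul, ← e1, ← e2]⟩
  | succ n ih =>
    have hlt : σ < t := lt_of_le_of_ne hσt (by rintro rfl; omega)
    have hlt' : σ < t' := lt_of_le_of_ne hσt' (by rintro rfl; omega)
    obtain ⟨x, hxt, hxσ⟩ := SetLike.exists_of_lt hlt
    obtain ⟨y, hyt, hyσ⟩ := SetLike.exists_of_lt hlt'
    -- Move one new vector of t to one of t' while fixing σ, then continue with σ enlarged by that
    -- vector.
    obtain ⟨h, hh, hfix, hxy⟩ := hω.exists_isometry_fixing
      (LinearMap.BilinForm.orthogonal_le hσt (ht hxt))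
      (LinearMap.BilinForm.orthogonal_le hσt' (ht' hyt)) hxσ hyσ
    let h₁ : isometryGroup ω := ⟨h, hh⟩
    have hsup : σ ⊔ F ∙ y ≤ h₁ • t := by
      refine sup_le (fun e he => ?_) ?_
      · exact ⟨e, hσt he, hfix e he⟩
      · rw [Submodule.span_singleton_le_iff_mem]
        exact ⟨x, hxt, hxy⟩
    obtain ⟨h₂, hfix₂, h₂t⟩ := ih (ht.smul h₁) hsup
      (sup_le hσt' (by simpa using hyt)) (by rw [smul_finrank, hd])
      (by rw [smul_finrank, Submodule.finrank_sup_span_singleton hyσ]; omega)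
    refine ⟨h₂ * h₁, fun e he => ?_, ?_⟩
    · rw [mul_smul]
      have : h₁ • e = e := hfix e he
      rw [this]
      exact hfix₂ e (Submodule.mem_sup_left he)
    · rw [mul_smul, h₂t]

end SymplecticGeometry

namespace SymplecticGeometry

open Finset

/-! ### Spectral estimate for strongly regular kernels -/

section QuadraticForm

variable {ι : Type*} [DecidableEq ι] {C : Finset ι} {w : ι → ι → ℝ} {k b θ : ℝ}

/-- For the symmetric matrix W, ‖W e‖² is the quadratic form of W² = θ² I + b J at e. -/
theorem sum_sq_apply (hsymm : ∀ x y, w x y = w y x)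
    (hsq : ∀ x ∈ C, ∀ y ∈ C, ∑ z ∈ C, w x z * w z y = if x = y then b + θ ^ 2 else b) (e : ι → ℝ) :
    ∑ x ∈ C, (∑ y ∈ C, w x y * e y) ^ 2 = b * (∑ x ∈ C, e x) ^ 2 + θ ^ 2 * ∑ x ∈ C, e x ^ 2 := by
  have h1 : ∀ x, (∑ y ∈ C, w x y * e y) ^ 2 =
      ∑ y ∈ C, ∑ z ∈ C, e y * e z * (w y x * w x z) := by
    intro x
    rw [sq, sum_mul_sum]
    refine sum_congr rfl fun y _ => sum_congr rfl fun z _ => ?_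
    rw [hsymm y x]
    ring
  simp_rw [h1]
  rw [sum_comm]
  have h2 : ∀ y ∈ C, ∑ x ∈ C, ∑ z ∈ C, e y * e z * (w y x * w x z) =
      b * (e y * ∑ z ∈ C, e z) + θ ^ 2 * e y ^ 2 := by
    intro y hy
    rw [sum_comm]
    simp_rw [← mul_sum]
    have h3 : ∀ z ∈ C, e y * e z * ∑ x ∈ C, w y x * w x z =
        b * (e y * e z) + if y = z then θ ^ 2 * e y ^ 2 else 0 := by
      intro z hz
      rw [hsq y hy z hz]
      split_ifs with h
      · subst h; ring
      · ring
    rw [sum_congr rfl h3, sum_add_distrib, ← mul_sum, ← mul_sum, sum_ite_eq, if_pos hy]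
  rw [sum_congr rfl h2, sum_add_distrib, ← mul_sum, ← mul_sum, ← sum_mul, ← sq]

/-- A symmetric kernel with constant row sums whose square is `θ² I + b J` acts with norm `θ` on
the functions of mean zero. -/
theorem quadratic_form_le (hsymm : ∀ x y, w x y = w y x) (hθ : 0 < θ)
    (hrow : ∀ x ∈ C, ∑ y ∈ C, w x y = k)
    (hsq : ∀ x ∈ C, ∀ y ∈ C, ∑ z ∈ C, w x z * w z y = if x = y then b + θ ^ 2 else b)
    (f : ι → ℝ) :
    #C * ∑ x ∈ C, ∑ y ∈ C, w x y * (f x * f y) ≤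
      #C * θ * ∑ x ∈ C, f x ^ 2 + (k - θ) * (∑ x ∈ C, f x) ^ 2 := by
  rcases C.eq_empty_or_nonempty with rfl | hC
  · simp
  have hL : (0 : ℝ) < #C := by exact_mod_cast hC.card_pos
  set a : ℝ := (∑ x ∈ C, f x) / #C with ha
  have hS : ∑ x ∈ C, f x = #C * a := by rw [ha]; field_simp
  -- Split off the mean: the constant part is an eigenvector of eigenvalue k, and e has mean zero.
  let e : ι → ℝ := fun x => f x - a
  have he : ∑ x ∈ C, e x = 0 := by
    simp only [e, sum_sub_distrib, sum_const, nsmul_eq_mul, hS]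
    ring
  have hf2 : ∑ x ∈ C, f x ^ 2 = ∑ x ∈ C, e x ^ 2 + #C * a ^ 2 := by
    have : ∀ x ∈ C, f x ^ 2 = e x ^ 2 + 2 * a * e x + a ^ 2 := fun x _ => by simp only [e]; ring
    rw [sum_congr rfl this, sum_add_distrib, sum_add_distrib, ← mul_sum, he]
    simp
  have hcol : ∀ y ∈ C, ∑ x ∈ C, w x y = k := fun y hy => by
    rw [← hrow y hy]
    exact sum_congr rfl fun x _ => hsymm x y
  have hq : ∑ x ∈ C, ∑ y ∈ C, w x y * (f x * f y) =
      ∑ x ∈ C, ∑ y ∈ C, w x y * (e x * e y) + k * #C * a ^ 2 := by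
    have h1 : ∀ x ∈ C, ∑ y ∈ C, w x y * (f x * f y) =
        ∑ y ∈ C, w x y * (e x * e y) + a * (e x * ∑ y ∈ C, w x y) + a * ∑ y ∈ C, w x y * e y +
          a ^ 2 * ∑ y ∈ C, w x y := by
      intro x _
      simp only [mul_sum, ← sum_add_distrib]
      refine sum_congr rfl fun y _ => ?_
      simp only [e]
      ring
    rw [sum_congr rfl h1]
    simp only [sum_add_distrib, ← mul_sum]
    have h2 : ∑ x ∈ C, e x * ∑ y ∈ C, w x y = 0 := by
      rw [sum_congr rfl fun x hx => by rw [hrow x hx], ← sum_mul, he, zero_mul]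
    have h3 : ∑ x ∈ C, ∑ y ∈ C, w x y * e y = 0 := by
      rw [sum_comm, sum_congr rfl fun y hy => by rw [← sum_mul, hcol y hy], ← mul_sum, he, mul_zero]
    have h4 : ∑ x ∈ C, ∑ y ∈ C, w x y = k * #C := by
      rw [sum_congr rfl hrow, sum_const, nsmul_eq_mul, mul_comm]
    rw [h2, h3, h4]
    ring
  have hee : ∑ x ∈ C, ∑ y ∈ C, w x y * (e x * e y) ≤ θ * ∑ x ∈ C, e x ^ 2 := by
    -- Expand ‖(θ - W) e‖² ≥ 0. On mean zero, ‖W e‖² = θ² ‖e‖², so only the wanted cross term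
    -- remains.
    have h0 : 0 ≤ ∑ x ∈ C, (θ * e x - ∑ y ∈ C, w x y * e y) ^ 2 :=
      sum_nonneg fun _ _ => sq_nonneg _
    have h1 : ∀ x ∈ C, (θ * e x - ∑ y ∈ C, w x y * e y) ^ 2 =
        θ ^ 2 * e x ^ 2 - 2 * θ * ∑ y ∈ C, w x y * (e x * e y) +
          (∑ y ∈ C, w x y * e y) ^ 2 := by
      intro x _
      have : ∑ y ∈ C, w x y * (e x * e y) = e x * ∑ y ∈ C, w x y * e y := by
        rw [mul_sum]
        exact sum_congr rfl fun y _ => by ring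
      rw [this]
      ring
    rw [sum_congr rfl h1, sum_add_distrib, sum_sub_distrib, ← mul_sum, ← mul_sum,
      sum_sq_apply hsymm hsq, he] at h0
    have : 0 ≤ 2 * θ * (θ * ∑ x ∈ C, e x ^ 2 - ∑ x ∈ C, ∑ y ∈ C, w x y * (e x * e y)) := by
      linarith
    have := nonneg_of_mul_nonneg_right this (by positivity)
    linarith
  rw [hq, hf2, hS]
  have := mul_le_mul_of_nonneg_left hee hL.le
  linarith

end QuadraticForm

/-! ### Counting subspaces in intervals -/

section Counting

variable {F V : Type*} [Field F] [AddCommGroup V] [Module F V] [FiniteDimensional F V]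

/-- The `q`-analogue `1 + q + ⋯ + q ^ (n - 1)` of the number `n`, where `q` is the order of `F`. -/
noncomputable def qNum (F : Type*) (n : ℕ) : ℝ := ∑ i ∈ range n, (Nat.card F : ℝ) ^ i

theorem qNum_succ (n : ℕ) : qNum F (n + 1) = Nat.card F * qNum F n + 1 := by
  rw [qNum, sum_range_succ', qNum, mul_sum]
  simp [pow_succ']

theorem qNum_succ' (n : ℕ) : qNum F (n + 1) = qNum F n + (Nat.card F : ℝ) ^ n := by
  rw [qNum, sum_range_succ, qNum]

variable [Finite F]

theorem two_le_card : (2 : ℝ) ≤ Nat.card F := by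
  exact_mod_cast Finite.one_lt_card (α := F)

theorem qNum_nonneg (n : ℕ) : 0 ≤ qNum F n := sum_nonneg fun _ _ => by positivity

theorem qNum_pos {n : ℕ} (hn : 0 < n) : 0 < qNum F n := by
  obtain ⟨m, rfl⟩ := Nat.exists_eq_succ_of_ne_zero hn.ne'
  have := qNum_nonneg (F := F) m
  have := two_le_card (F := F)
  rw [Nat.succ_eq_add_one, qNum_succ]
  positivity

theorem card_mul_sub_one (n : ℕ) : qNum F n * (Nat.card F - 1) = (Nat.card F : ℝ) ^ n - 1 :=
  geom_sum_mul _ _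

theorem card_coe_submodule (A : Submodule F V) : Nat.card A = Nat.card F ^ finrank F A :=
  Module.natCard_eq_pow_finrank

theorem card_coe_sdiff [Finite V] {A B : Submodule F V} (h : A ≤ B) :
    (Set.ncard ((B : Set V) \ A) : ℝ) =
      (Nat.card F : ℝ) ^ finrank F B - (Nat.card F : ℝ) ^ finrank F A := by
  have h1 := Set.ncard_sdiff_add_ncard_of_subset (s := (A : Set V)) (t := B) h
  have h2 : Set.ncard (A : Set V) = Nat.card F ^ finrank F A := by
    rw [← card_coe_submodule]; rfl
  have h3 : Set.ncard (B : Set V) = Nat.card F ^ finrank F B := by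
    rw [← card_coe_submodule]; rfl
  rw [h2, h3] at h1
  rw [← Nat.cast_pow, ← Nat.cast_pow, ← h1]
  push_cast
  ring

open Classical in
/-- The number of covers of `A` in the interval from `A` to `B`. -/
theorem card_covers [Fintype (Submodule F V)] {A B : Submodule F V} (h : A ≤ B) :
    (#{x : Submodule F V | A ≤ x ∧ x ≤ B ∧ finrank F x = finrank F A + 1} : ℝ) =
      qNum F (finrank F B - finrank F A) := by
  have : Finite V := Module.finite_of_finite F
  have : Fintype V := Fintype.ofFinite V
  set q : ℝ := (Nat.card F : ℝ) with hq
  have hq2 : 2 ≤ q := two_le_card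
  let S : Finset V := ((B : Set V) \ A).toFinset
  let T : Finset (Submodule F V) := {x | A ≤ x ∧ x ≤ B ∧ finrank F x = finrank F A + 1}
  have hmaps : ∀ v ∈ S, A ⊔ F ∙ v ∈ T := by
    intro v hv
    have hv' : v ∈ B ∧ v ∉ A := by simpa [S] using hv
    simp only [T, mem_filter, mem_univ, true_and]
    exact ⟨le_sup_left, sup_le h (by simpa using hv'.1),
      Submodule.finrank_sup_span_singleton hv'.2⟩
  -- The vectors v outside A that generate a given cover x over A are exactly those of x outside A.
  have hfib : ∀ x ∈ T, (#{v ∈ S | A ⊔ F ∙ v = x} : ℝ) =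
      q ^ (finrank F A + 1) - q ^ finrank F A := by
    intro x hx
    obtain ⟨hAx, hxB, hxd⟩ : A ≤ x ∧ x ≤ B ∧ finrank F x = finrank F A + 1 := by simpa [T] using hx
    rw [hq, ← hxd, ← card_coe_sdiff hAx, Set.ncard_eq_toFinset_card']
    congr 2
    ext v
    simp only [S, mem_filter, Set.mem_toFinset, Set.mem_sdiff, SetLike.mem_coe]
    constructor
    · rintro ⟨⟨-, hvA⟩, rfl⟩
      exact ⟨Submodule.mem_sup_right (Submodule.mem_span_singleton_self v), hvA⟩
    · rintro ⟨hvx, hvA⟩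
      refine ⟨⟨hxB hvx, hvA⟩, ?_⟩
      refine Submodule.eq_of_le_of_finrank_le (sup_le hAx (by simpa using hvx)) ?_
      rw [Submodule.finrank_sup_span_singleton hvA, hxd]
  have hcount : (#S : ℝ) = #T * (q ^ (finrank F A + 1) - q ^ finrank F A) := by
    rw [card_eq_sum_card_fiberwise hmaps]
    push_cast
    rw [sum_congr rfl hfib, sum_const, nsmul_eq_mul]
  have hS : (#S : ℝ) = q ^ finrank F B - q ^ finrank F A := by
    rw [hq, ← card_coe_sdiff h, Set.ncard_eq_toFinset_card']
  have hd : finrank F B = finrank F A + (finrank F B - finrank F A) := by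
    have := Submodule.finrank_mono h
    omega
  have hgeom := card_mul_sub_one (F := F) (finrank F B - finrank F A)
  rw [← hq] at hgeom
  have h1 : q ^ finrank F B = q ^ finrank F A * q ^ (finrank F B - finrank F A) := by
    rw [← pow_add, ← hd]
  have hpos : 0 < q ^ finrank F A * (q - 1) := by
    have : 0 < q - 1 := by linarith
    positivity
  apply mul_right_cancel₀ hpos.ne'
  calc (#T : ℝ) * (q ^ finrank F A * (q - 1))
      = #T * (q ^ (finrank F A + 1) - q ^ finrank F A) := by ring
    _ = q ^ finrank F A * (q ^ (finrank F B - finrank F A) - 1) := by rw [← hcount, hS, h1]; ring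
    _ = _ := by rw [← hgeom]; ring

variable {ω : LinearMap.BilinForm F V} {g : ℕ}

open Classical in
/-- The number of subspaces covered by `B` in the interval from `A` to `B`. -/
theorem IsSymplectic.card_coatoms [Fintype (Submodule F V)] (hω : IsSymplectic ω g)
    {A B : Submodule F V} (h : A ≤ B) :
    (#{x : Submodule F V | A ≤ x ∧ x ≤ B ∧ finrank F x + 1 = finrank F B} : ℝ) =
      qNum F (finrank F B - finrank F A) := by
  have hA := hω.finrank_orthogonal A
  have hB := hω.finrank_orthogonal B
  have e : finrank F B - finrank F A =
      finrank F (ω.orthogonal A) - finrank F (ω.orthogonal B) := by omega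
  -- Taking orthogonals reverses the interval and turns coatoms into covers.
  rw [e, ← card_covers (LinearMap.BilinForm.orthogonal_le h)]
  congr 1
  refine card_bij' (fun x _ => ω.orthogonal x) (fun x _ => ω.orthogonal x) ?_ ?_
    (fun x _ => hω.orthogonal_orthogonal x) (fun x _ => hω.orthogonal_orthogonal x)
  · intro x hx
    simp only [mem_filter, mem_univ, true_and] at hx ⊢
    have := hω.finrank_orthogonal x
    exact ⟨LinearMap.BilinForm.orthogonal_le hx.2.1, LinearMap.BilinForm.orthogonal_le hx.1,
      by omega⟩
  · intro x hx
    simp only [mem_filter, mem_univ, true_and] at hx ⊢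
    have := hω.finrank_orthogonal x
    exact ⟨hω.le_orthogonal_comm.1 hx.2.1, by
      have := LinearMap.BilinForm.orthogonal_le (B := ω) hx.1
      rwa [hω.orthogonal_orthogonal] at this, by omega⟩

end Counting

end SymplecticGeometry

namespace SymplecticGeometry

open Finset

/-! ### Spectral gap between consecutive dimensions -/

section Levels

variable {F V : Type*} [Field F] [AddCommGroup V] [Module F V] [FiniteDimensional F V]
  [Finite F] [Fintype (Submodule F V)] {ω : LinearMap.BilinForm F V} {g : ℕ}

open Classical in
/-- The isotropic subspaces of dimension `r` that contain `σ`. -/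
noncomputable def level (ω : LinearMap.BilinForm F V) (σ : Submodule F V) (r : ℕ) :
    Finset (Submodule F V) := {t | σ ≤ t ∧ Isotropic ω t ∧ finrank F t = r}

variable {σ : Submodule F V} {r ρ e : ℕ}

omit [Finite F] [FiniteDimensional F V] in
theorem mem_level {t : Submodule F V} :
    t ∈ level ω σ r ↔ σ ≤ t ∧ Isotropic ω t ∧ finrank F t = r := by
  simp [level]

theorem IsSymplectic.isotropic_of_cover (hω : IsSymplectic ω g) {z x : Submodule F V}
    (hz : Isotropic ω z) (hzx : z ≤ x) (hx : x ≤ ω.orthogonal z)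
    (hd : finrank F x = finrank F z + 1) : Isotropic ω x := by
  have hlt : z < x := lt_of_le_of_ne hzx (by rintro rfl; omega)
  obtain ⟨v, hvx, hvz⟩ := SetLike.exists_of_lt hlt
  have : z ⊔ F ∙ v = x := by
    refine Submodule.eq_of_le_of_finrank_le (sup_le hzx (by simpa using hvx)) ?_
    rw [Submodule.finrank_sup_span_singleton hvz, hd]
  rw [← this]
  refine hω.isotropic_sup.2 ⟨hz, hω.isotropic_span_singleton v, ?_⟩
  exact hω.le_orthogonal_comm.1 (by simpa using hx hvx)

open Classical

/-- S is left free because the kernel sums below take it to be the orthogonal of another subspace or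
of a sum of two. -/
theorem IsSymplectic.card_upper (hω : IsSymplectic ω g) {x : Submodule F V}
    (hx : x ∈ level ω σ r) {S : Submodule F V} (hxS : x ≤ S) (hS : S ≤ ω.orthogonal x) :
    (#{w ∈ level ω σ (r + 1) | x ≤ w ∧ w ≤ S} : ℝ) = qNum F (finrank F S - r) := by
  obtain ⟨hσ, hiso, hr⟩ := mem_level.1 hx
  rw [← hr, ← card_covers hxS]
  congr 2
  ext w
  simp only [mem_filter, mem_level, mem_univ, true_and]
  constructor
  · rintro ⟨⟨-, -, h3⟩, h4, h5⟩
    exact ⟨h4, h5, by rw [h3]⟩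
  · rintro ⟨h1, h2, h3⟩
    exact ⟨⟨hσ.trans h1, hω.isotropic_of_cover hiso h1 (h2.trans hS) h3, by rw [h3]⟩, h1, h2⟩

theorem IsSymplectic.card_upper' (hω : IsSymplectic ω g) {x : Submodule F V}
    (hx : x ∈ level ω σ r) :
    (#{w ∈ level ω σ (r + 1) | x ≤ w} : ℝ) = qNum F (2 * (g - r)) := by
  obtain ⟨hσ, hiso, hr⟩ := mem_level.1 hx
  have h := hω.card_upper hx hiso le_rfl
  have h1 := hω.finrank_orthogonal x
  rw [show 2 * (g - r) = finrank F (ω.orthogonal x) - r by omega, ← h]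
  congr 2
  ext w
  simp only [mem_filter, mem_level]
  constructor
  · rintro ⟨hw, hxw⟩
    exact ⟨hw, hxw, hw.2.1.trans (LinearMap.BilinForm.orthogonal_le hxw)⟩
  · rintro ⟨hw, hxw, -⟩
    exact ⟨hw, hxw⟩

theorem IsSymplectic.card_lower (hω : IsSymplectic ω g) {x : Submodule F V}
    (hx : x ∈ level ω σ (ρ + 1)) :
    (#{z ∈ level ω σ ρ | z ≤ x} : ℝ) = qNum F (ρ + 1 - finrank F σ) := by
  obtain ⟨hσ, hiso, hr⟩ := mem_level.1 hx
  rw [← hr, ← hω.card_coatoms hσ]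
  congr 2
  ext z
  simp only [mem_filter, mem_level, mem_univ, true_and, hr]
  constructor
  · rintro ⟨⟨h1, -, h3⟩, h4⟩
    exact ⟨h1, h4, by omega⟩
  · rintro ⟨h1, h2, h3⟩
    exact ⟨⟨h1, hiso.mono h2, by omega⟩, h2⟩

/-- The indicator of orthogonality. -/
noncomputable def orthKernel (ω : LinearMap.BilinForm F V) (x y : Submodule F V) : ℝ :=
  if x ≤ ω.orthogonal y then 1 else 0

theorem IsSymplectic.orthKernel_symm (hω : IsSymplectic ω g) (x y : Submodule F V) :
    orthKernel ω x y = orthKernel ω y x := by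
  unfold orthKernel
  rw [hω.le_orthogonal_comm]

theorem IsSymplectic.sum_orthKernel (hω : IsSymplectic ω g) (hg : g = ρ + e + 2)
    {z x : Submodule F V} (hz : z ∈ level ω σ ρ) (hx : x ∈ level ω σ (ρ + 1)) (hzx : z ≤ x) :
    ∑ y ∈ level ω σ (ρ + 1) with z ≤ y, orthKernel ω x y = qNum F (2 * e + 3) := by
  obtain ⟨-, hxi, hxd⟩ := mem_level.1 hx
  have h := hω.card_upper hz (S := ω.orthogonal x) (hzx.trans hxi)
    (LinearMap.BilinForm.orthogonal_le hzx)
  have h1 := hω.finrank_orthogonal x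
  rw [show 2 * e + 3 = finrank F (ω.orthogonal x) - ρ by omega, ← h, ← filter_filter,
    card_filter]
  push_cast
  refine sum_congr rfl fun y _ => ?_
  rw [hω.orthKernel_symm, orthKernel]

/-- The subspaces over z are the points of the symplectic space zᗮ/z of dimension 2e + 4. Those
orthogonal to both x and y form a subspace of codimension 2, or a hyperplane when x = y. The extra
q^(2e+2) points on the diagonal are the square of θ = q^(e+1). -/
theorem IsSymplectic.sum_orthKernel_mul (hω : IsSymplectic ω g) (hg : g = ρ + e + 2)
    {z x y : Submodule F V} (hz : z ∈ level ω σ ρ) (hx : x ∈ level ω σ (ρ + 1)) (hzx : z ≤ x)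
    (hy : y ∈ level ω σ (ρ + 1)) (hzy : z ≤ y) :
    ∑ t ∈ level ω σ (ρ + 1) with z ≤ t, orthKernel ω x t * orthKernel ω t y =
      if x = y then qNum F (2 * e + 2) + ((Nat.card F : ℝ) ^ (e + 1)) ^ 2
        else qNum F (2 * e + 2) := by
  obtain ⟨-, hxi, hxd⟩ := mem_level.1 hx
  obtain ⟨-, hyi, hyd⟩ := mem_level.1 hy
  obtain ⟨-, hzi, hzd⟩ := mem_level.1 hz
  have hS : z ≤ ω.orthogonal (x ⊔ y) := by
    rw [orthogonal_sup]
    exact le_inf (hzx.trans hxi) (hzy.trans hyi)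
  have h := hω.card_upper hz hS (LinearMap.BilinForm.orthogonal_le (hzx.trans le_sup_left))
  have h1 := hω.finrank_orthogonal (x ⊔ y)
  have h2 : ∑ t ∈ level ω σ (ρ + 1) with z ≤ t, orthKernel ω x t * orthKernel ω t y =
      qNum F (finrank F (ω.orthogonal (x ⊔ y)) - ρ) := by
    rw [← h, ← filter_filter, card_filter]
    push_cast
    refine sum_congr rfl fun t _ => ?_
    rw [hω.orthKernel_symm x t, orthKernel, orthKernel, orthogonal_sup]
    simp only [le_inf_iff]
    split_ifs <;> simp_all
  rw [h2]
  split_ifs with hxy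
  · subst hxy
    rw [sup_idem] at h1 ⊢
    rw [show finrank F (ω.orthogonal x) - ρ = 2 * e + 2 + 1 by omega, qNum_succ']
    ring
  · have h3 : finrank F ↥(x ⊔ y) = ρ + 2 := by
      have h4 := finrank_sup_le_of_le hzx hzy
      have h5 : x < x ⊔ y := by
        refine lt_of_le_of_ne le_sup_left fun H => hxy ?_
        have : y ≤ x := H ▸ le_sup_right
        exact (Submodule.eq_of_le_of_finrank_le this (by omega)).symm
      have := Submodule.finrank_lt_finrank_of_lt h5
      omega
    rw [show finrank F (ω.orthogonal (x ⊔ y)) - ρ = 2 * e + 2 by omega]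

/-- The orthogonality form of `f` over the pairs with a common lower neighbour. -/
noncomputable def localForm (ω : LinearMap.BilinForm F V) (σ : Submodule F V) (ρ : ℕ)
    (f : Submodule F V → ℝ) : ℝ :=
  ∑ z ∈ level ω σ ρ, ∑ x ∈ level ω σ (ρ + 1) with z ≤ x, ∑ y ∈ level ω σ (ρ + 1) with z ≤ y,
    orthKernel ω x y * (f x * f y)

theorem IsSymplectic.sum_lower (hω : IsSymplectic ω g) (f : Submodule F V → ℝ) :
    ∑ z ∈ level ω σ ρ, ∑ x ∈ level ω σ (ρ + 1) with z ≤ x, f x =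
      qNum F (ρ + 1 - finrank F σ) * ∑ x ∈ level ω σ (ρ + 1), f x := by
  simp_rw [sum_filter]
  rw [sum_comm, mul_sum]
  refine sum_congr rfl fun x hx => ?_
  rw [← sum_filter, sum_const, nsmul_eq_mul, hω.card_lower hx]

/-- This is the strongly regular estimate in the link of each z, summed over z. The last sum, the
squared masses of f on the links, is the part left to the gap one dimension below. -/
theorem IsSymplectic.localForm_le (hω : IsSymplectic ω g) (hg : g = ρ + e + 2)
    (f : Submodule F V → ℝ) :
    qNum F (2 * e + 4) * localForm ω σ ρ f ≤
      qNum F (2 * e + 4) * (Nat.card F : ℝ) ^ (e + 1) *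
        (qNum F (ρ + 1 - finrank F σ) * ∑ x ∈ level ω σ (ρ + 1), f x ^ 2) +
      (qNum F (2 * e + 3) - (Nat.card F : ℝ) ^ (e + 1)) *
        ∑ z ∈ level ω σ ρ, (∑ x ∈ level ω σ (ρ + 1) with z ≤ x, f x) ^ 2 := by
  rw [← hω.sum_lower, localForm, mul_sum, mul_sum, mul_sum, ← sum_add_distrib]
  refine sum_le_sum fun z hz => ?_
  have hc := hω.card_upper' hz
  rw [show 2 * (g - ρ) = 2 * e + 4 by omega] at hc
  rw [← hc]
  have h2 := two_le_card (F := F)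
  refine quadratic_form_le (b := qNum F (2 * e + 2)) hω.orthKernel_symm (by positivity) ?_ ?_ f
  · intro x hx
    rw [mem_filter] at hx
    exact hω.sum_orthKernel hg hz hx.1 hx.2
  · intro x hx y hy
    rw [mem_filter] at hx hy
    exact hω.sum_orthKernel_mul hg hz hx.1 hx.2 hy.1 hy.2

theorem sum_mul_sum_le (A B : Finset (Submodule F V)) (f h : Submodule F V → ℝ) :
    ∑ z ∈ A, h z * ∑ x ∈ B with z ≤ x, f x = ∑ x ∈ B, f x * ∑ z ∈ A with z ≤ x, h z := by
  simp_rw [sum_filter, mul_sum]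
  rw [sum_comm]
  refine sum_congr rfl fun x _ => sum_congr rfl fun z _ => ?_
  split_ifs <;> ring

/-- The spectral gap of the walk between the levels `r` and `r + 1`: the operator that sums over
the lower neighbours has norm at most `1 - c`, suitably normalized, on functions of mean zero. -/
def HasGap (ω : LinearMap.BilinForm F V) (g : ℕ) (σ : Submodule F V) (r : ℕ) (c : ℝ) : Prop :=
  ∀ f : Submodule F V → ℝ, ∑ x ∈ level ω σ r, f x = 0 →
    ∑ w ∈ level ω σ (r + 1), (∑ x ∈ level ω σ r with x ≤ w, f x) ^ 2 ≤
      (1 - c) * (qNum F (2 * (g - r)) * qNum F (r + 1 - finrank F σ)) *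
        ∑ x ∈ level ω σ r, f x ^ 2

/-- An operator and its adjoint have the same norm. With D the sum over upper neighbours and P = ‖D
f‖² = ⟨f, D* D f⟩, Cauchy–Schwarz and the gap applied to D f give P² ≤ ‖f‖² κ P. -/
theorem IsSymplectic.sum_sq_lower_le (hω : IsSymplectic ω g) {c : ℝ} (hc1 : c ≤ 1) (hc : HasGap ω g σ ρ c)
    (f : Submodule F V → ℝ) (hf : ∑ x ∈ level ω σ (ρ + 1), f x = 0) :
    ∑ z ∈ level ω σ ρ, (∑ x ∈ level ω σ (ρ + 1) with z ≤ x, f x) ^ 2 ≤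
      (1 - c) * (qNum F (2 * (g - ρ)) * qNum F (ρ + 1 - finrank F σ)) *
        ∑ x ∈ level ω σ (ρ + 1), f x ^ 2 := by
  set D : Submodule F V → ℝ := fun z => ∑ x ∈ level ω σ (ρ + 1) with z ≤ x, f x with hD
  set κ := (1 - c) * (qNum F (2 * (g - ρ)) * qNum F (ρ + 1 - finrank F σ))
  have hD0 : ∑ z ∈ level ω σ ρ, D z = 0 := by
    rw [hD, hω.sum_lower, hf, mul_zero]
  have hgap := hc D hD0
  set P := ∑ z ∈ level ω σ ρ, D z ^ 2 with hP
  have hPf : P = ∑ x ∈ level ω σ (ρ + 1), f x * ∑ z ∈ level ω σ ρ with z ≤ x, D z := by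
    rw [← sum_mul_sum_le, hP]
    exact sum_congr rfl fun z _ => sq _
  have hCS := sum_mul_sq_le_sq_mul_sq (level ω σ (ρ + 1)) f
    (fun x => ∑ z ∈ level ω σ ρ with z ≤ x, D z)
  rw [← hPf] at hCS
  have hP0 : 0 ≤ P := sum_nonneg fun _ _ => sq_nonneg _
  have hf0 : 0 ≤ ∑ x ∈ level ω σ (ρ + 1), f x ^ 2 := sum_nonneg fun _ _ => sq_nonneg _
  have h1 : P * P ≤ (κ * ∑ x ∈ level ω σ (ρ + 1), f x ^ 2) * P := by
    calc P * P = P ^ 2 := (sq P).symm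
      _ ≤ _ := hCS
      _ ≤ _ := mul_le_mul_of_nonneg_left hgap hf0
      _ = _ := by ring
  have hκ : 0 ≤ κ := mul_nonneg (by linarith) (mul_nonneg (qNum_nonneg _) (qNum_nonneg _))
  rcases hP0.eq_or_lt with h0 | h0
  · rw [← h0]
    positivity
  · exact le_of_mul_le_mul_right h1 h0

/-- Distinct x, y have a common upper neighbour exactly when they are orthogonal and have a common
lower one. These are then unique, namely x + y and x ∩ y. -/
theorem IsSymplectic.card_upper_pair (hω : IsSymplectic ω g) {x y : Submodule F V}
    (hx : x ∈ level ω σ (ρ + 1)) (hy : y ∈ level ω σ (ρ + 1)) (hxy : x ≠ y) :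
    (#{w ∈ level ω σ (ρ + 2) | x ≤ w ∧ y ≤ w} : ℝ) =
      orthKernel ω x y * #{z ∈ level ω σ ρ | z ≤ x ∧ z ≤ y} := by
  obtain ⟨hσx, hxi, hxd⟩ := mem_level.1 hx
  obtain ⟨hσy, hyi, hyd⟩ := mem_level.1 hy
  have h5 : x < x ⊔ y := by
    refine lt_of_le_of_ne le_sup_left fun H => hxy ?_
    have : y ≤ x := H ▸ le_sup_right
    exact (Submodule.eq_of_le_of_finrank_le this (by omega)).symm
  have h6 := Submodule.finrank_lt_finrank_of_lt h5
  have h7 := finrank_sup_add_finrank_inf x y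
  by_cases hK : x ≤ ω.orthogonal y ∧ finrank F ↥(x ⊔ y) = ρ + 2
  · have e1 : ({w ∈ level ω σ (ρ + 2) | x ≤ w ∧ y ≤ w} : Finset _) = {x ⊔ y} := by
      ext w
      simp only [mem_filter, mem_level, mem_singleton]
      constructor
      · rintro ⟨⟨-, -, h3⟩, h4, h5⟩
        exact (Submodule.eq_of_le_of_finrank_le (sup_le h4 h5) (by omega)).symm
      · rintro rfl
        exact ⟨⟨hσx.trans le_sup_left, hω.isotropic_sup.2 ⟨hxi, hyi, hK.1⟩, hK.2⟩, le_sup_left,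
          le_sup_right⟩
    have e2 : ({z ∈ level ω σ ρ | z ≤ x ∧ z ≤ y} : Finset _) = {x ⊓ y} := by
      ext z
      simp only [mem_filter, mem_level, mem_singleton]
      constructor
      · rintro ⟨⟨-, -, h3⟩, h4, h5⟩
        exact Submodule.eq_of_le_of_finrank_le (le_inf h4 h5) (by omega)
      · rintro rfl
        exact ⟨⟨le_inf hσx hσy, hxi.mono inf_le_left, by omega⟩, inf_le_left, inf_le_right⟩
    rw [e1, e2, orthKernel, if_pos hK.1]
    simp
  · have e1 : ({w ∈ level ω σ (ρ + 2) | x ≤ w ∧ y ≤ w} : Finset _) = ∅ := by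
      refine filter_eq_empty_iff.2 fun w hw hxyw => hK ?_
      obtain ⟨-, hwi, hwd⟩ := mem_level.1 hw
      have h8 := sup_le hxyw.1 hxyw.2
      have h9 := Submodule.finrank_mono h8
      exact ⟨(hω.isotropic_sup.1 (hwi.mono h8)).2.2, by omega⟩
    rw [e1, card_empty, Nat.cast_zero, eq_comm, mul_eq_zero, orthKernel]
    by_cases h8 : x ≤ ω.orthogonal y
    · right
      rw [Nat.cast_eq_zero, card_eq_zero]
      refine filter_eq_empty_iff.2 fun z hz hxyz => hK ⟨h8, ?_⟩
      obtain ⟨-, -, hzd⟩ := mem_level.1 hz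
      have := Submodule.finrank_mono (le_inf hxyz.1 hxyz.2)
      omega
    · left
      rw [if_neg h8]

theorem sum_sum_filter_eq (A B : Finset (Submodule F V)) (P : Submodule F V → Submodule F V → Prop)
    (K : Submodule F V → Submodule F V → ℝ) :
    ∑ z ∈ A, ∑ x ∈ B with P z x, ∑ y ∈ B with P z y, K x y =
      ∑ x ∈ B, ∑ y ∈ B, K x y * #{z ∈ A | P z x ∧ P z y} := by
  simp_rw [sum_filter, card_filter]
  rw [sum_comm]
  refine sum_congr rfl fun x _ => ?_
  have h1 : ∀ z ∈ A, (if P z x then ∑ y ∈ B, if P z y then K x y else 0 else 0) =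
      ∑ y ∈ B, K x y * if P z x ∧ P z y then 1 else 0 := by
    intro z _
    split_ifs with h
    · refine sum_congr rfl fun y _ => ?_
      simp [h]
    · simp [h]
  rw [sum_congr rfl h1, sum_comm]
  refine sum_congr rfl fun y _ => ?_
  rw [← mul_sum]
  push_cast
  rfl

/-- Off the diagonal, paths through an upper neighbour match orthogonal paths through a lower one.
On the diagonal the two counts are the numbers of upper and of lower neighbours, whence the
correction. -/
theorem IsSymplectic.sum_sq_upper_eq (hω : IsSymplectic ω g) (f : Submodule F V → ℝ) :
    ∑ w ∈ level ω σ (ρ + 2), (∑ x ∈ level ω σ (ρ + 1) with x ≤ w, f x) ^ 2 =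
      localForm ω σ ρ f + (qNum F (2 * (g - (ρ + 1))) - qNum F (ρ + 1 - finrank F σ)) *
        ∑ x ∈ level ω σ (ρ + 1), f x ^ 2 := by
  simp_rw [sq (∑ x ∈ _ with _, f x), sum_mul_sum]
  rw [sum_sum_filter_eq _ _ (fun w x => x ≤ w) fun x y => f x * f y, localForm,
    sum_sum_filter_eq _ _ (fun z x => z ≤ x), mul_sum, ← sum_add_distrib]
  refine sum_congr rfl fun x hx => ?_
  have h1 : ∀ y ∈ level ω σ (ρ + 1),
      f x * f y * (#{w ∈ level ω σ (ρ + 2) | x ≤ w ∧ y ≤ w} : ℝ) =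
      orthKernel ω x y * (f x * f y) * #{z ∈ level ω σ ρ | z ≤ x ∧ z ≤ y} +
      if x = y then (qNum F (2 * (g - (ρ + 1))) - qNum F (ρ + 1 - finrank F σ)) * f x ^ 2
        else 0 := by
    intro y hy
    split_ifs with hxy
    · subst hxy
      simp only [and_self]
      rw [hω.card_upper' hx, hω.card_lower hx, orthKernel,
        if_pos (show x ≤ ω.orthogonal x from (mem_level.1 hx).2.1)]
      ring
    · rw [hω.card_upper_pair hx hy hxy]
      ring
  rw [sum_congr rfl h1, sum_add_distrib, sum_ite_eq, if_pos hx]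

theorem pow_le_qNum (e : ℕ) : (Nat.card F : ℝ) ^ (e + 1) ≤ qNum F (2 * e + 3) := by
  rw [qNum]
  exact single_le_sum (f := fun i => (Nat.card F : ℝ) ^ i) (fun _ _ => by positivity)
    (mem_range.2 (by omega))

theorem IsSymplectic.localForm_le_of_hasGap (hω : IsSymplectic ω g) (hg : g = ρ + e + 2) {c : ℝ}
    (hc1 : c ≤ 1) (hc : HasGap ω g σ ρ c) (f : Submodule F V → ℝ)
    (hf : ∑ x ∈ level ω σ (ρ + 1), f x = 0) :
    localForm ω σ ρ f ≤ qNum F (ρ + 1 - finrank F σ) *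
      (qNum F (2 * e + 3) - c * (qNum F (2 * e + 3) - (Nat.card F : ℝ) ^ (e + 1))) *
        ∑ x ∈ level ω σ (ρ + 1), f x ^ 2 := by
  have h1 := hω.localForm_le (σ := σ) hg f
  have h2 := hω.sum_sq_lower_le hc1 hc f hf
  rw [show 2 * (g - ρ) = 2 * e + 4 by omega] at h2
  have h3 : (0 : ℝ) < qNum F (2 * e + 4) := qNum_pos (by omega)
  have h4 := pow_le_qNum (F := F) e
  have h5 := mul_le_mul_of_nonneg_left h2 (sub_nonneg.2 h4)
  refine le_of_mul_le_mul_left (h1.trans ((add_le_add_right h5 _).trans (le_of_eq ?_))) h3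
  ring

/-- The local-to-global step: the upper walk on dimension ρ + 1 is the local form plus a diagonal
term, and the local form is controlled by the gap between ρ and ρ + 1. The last hypothesis records
how much of the gap survives. -/
theorem IsSymplectic.hasGap_succ (hω : IsSymplectic ω g) (hg : g = ρ + e + 2)
    (hσ : finrank F σ ≤ ρ) {c c' : ℝ} (hc1 : c ≤ 1) (hc : HasGap ω g σ ρ c)
    (hcc' : c' * (qNum F (2 * e + 2) * qNum F (ρ + 2 - finrank F σ)) ≤
      c * (qNum F (ρ + 1 - finrank F σ) *
        (qNum F (2 * e + 3) - (Nat.card F : ℝ) ^ (e + 1)))) :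
    HasGap ω g σ (ρ + 1) c' := by
  intro f hf
  have h1 := hω.localForm_le_of_hasGap hg hc1 hc f hf
  rw [hω.sum_sq_upper_eq, show 2 * (g - (ρ + 1)) = 2 * e + 2 by omega]
  have hd : qNum F (ρ + 2 - finrank F σ) = Nat.card F * qNum F (ρ + 1 - finrank F σ) + 1 := by
    rw [← qNum_succ]; congr 1; omega
  have hu : qNum F (2 * e + 3) = Nat.card F * qNum F (2 * e + 2) + 1 := qNum_succ _
  have hf0 : 0 ≤ ∑ x ∈ level ω σ (ρ + 1), f x ^ 2 := sum_nonneg fun _ _ => sq_nonneg _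
  have h2 := mul_le_mul_of_nonneg_right hcc' hf0
  have h3 : qNum F (ρ + 1 + 1 - finrank F σ) = qNum F (ρ + 2 - finrank F σ) := rfl
  rw [h3]
  -- The trivial eigenvalue of the upper walk is the diagonal term plus the trivial eigenvalue of
  -- the local form, so just the gain proportional to c remains.
  have h4 : qNum F (2 * e + 2) * qNum F (ρ + 2 - finrank F σ) =
      qNum F (2 * e + 2) - qNum F (ρ + 1 - finrank F σ) +
        qNum F (ρ + 1 - finrank F σ) * qNum F (2 * e + 3) := by
    rw [hd, hu]; ring
  calc _ ≤ _ := add_le_add_left h1 _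
    _ = qNum F (2 * e + 2) * qNum F (ρ + 2 - finrank F σ) * ∑ x ∈ level ω σ (ρ + 1), f x ^ 2 -
        c * (qNum F (ρ + 1 - finrank F σ) *
        (qNum F (2 * e + 3) - (Nat.card F : ℝ) ^ (e + 1))) *
        ∑ x ∈ level ω σ (ρ + 1), f x ^ 2 := by rw [h4]; ring
    _ ≤ _ := by linarith

/-- The only subspace at this level is σ, so a function of mean zero vanishes. -/
theorem hasGap_finrank (hσ : Isotropic ω σ) : HasGap ω g σ (finrank F σ) 1 := by
  intro f hf
  have h : level ω σ (finrank F σ) = {σ} := by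
    ext x
    rw [mem_level, mem_singleton]
    constructor
    · rintro ⟨h1, -, h3⟩
      exact (Submodule.eq_of_le_of_finrank_le h1 h3.le).symm
    · rintro rfl
      exact ⟨le_rfl, hσ, rfl⟩
  rw [h, sum_singleton] at hf
  have h2 : ∀ w ∈ level ω σ (finrank F σ + 1),
      (∑ x ∈ level ω σ (finrank F σ) with x ≤ w, f x) ^ 2 = 0 := by
    intro w _
    rw [h, sum_eq_zero, zero_pow two_ne_zero]
    intro x hx
    rw [mem_singleton.1 (mem_filter.1 hx).1, hf]
  rw [sum_eq_zero h2]
  simp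

/-- The spectral gap at distance `j` above `σ` and `h` below the maximal dimension. -/
noncomputable def gapBound (j h : ℕ) : ℝ := (1 + 2 / 2 ^ j) / 3 * (1 - 4 / 3 / 2 ^ h)

theorem gapBound_le_one (j h : ℕ) : gapBound j h ≤ 1 := by
  have h1 : (1 : ℝ) ≤ 2 ^ j := one_le_pow₀ one_le_two
  have h2 : (1 : ℝ) ≤ 2 ^ h := one_le_pow₀ one_le_two
  have h3 : (2 : ℝ) / 2 ^ j ≤ 2 := div_le_self (by norm_num) h1
  have h4 : (0 : ℝ) ≤ 4 / 3 / 2 ^ h := by positivity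
  have h5 : (0 : ℝ) ≤ 2 / 2 ^ j := by positivity
  unfold gapBound
  nlinarith

/-- The two top terms of the geometric sum suffice: q^(2e+1) (1 + q) ≥ 3 · 2^e q^(e+1), with the
worst case q = 2. -/
theorem pow_le_mul_qNum (e : ℕ) :
    (Nat.card F : ℝ) ^ (e + 1) ≤ 1 / 3 / 2 ^ e * qNum F (2 * e + 3) := by
  have hq := two_le_card (F := F)
  set q : ℝ := (Nat.card F : ℝ)
  have h1 : q ^ (2 * e + 1) + q ^ (2 * e + 2) ≤ qNum F (2 * e + 3) := by
    rw [qNum_succ', qNum_succ']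
    have := qNum_nonneg (F := F) (2 * e + 1)
    linarith
  have h2 : (2 : ℝ) ^ e ≤ q ^ e := pow_le_pow_left₀ (by norm_num) hq e
  have h0 : (0 : ℝ) < 2 ^ e := by positivity
  rw [div_div, one_div, ← div_eq_inv_mul, le_div_iff₀ (by positivity)]
  refine le_trans ?_ h1
  calc q ^ (e + 1) * (3 * 2 ^ e) ≤ q ^ (e + 1) * (3 * q ^ e) := by gcongr
    _ ≤ q ^ (e + 1) * ((1 + q) * q ^ e) := by gcongr; linarith
    _ = _ := by ring

theorem two_pow_le_qNum (n : ℕ) : (2 : ℝ) ^ n - 1 ≤ qNum F n := by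
  induction n with
  | zero => simp [qNum]
  | succ n ih =>
    have h1 := mul_le_mul_of_nonneg_right (two_le_card (F := F)) (qNum_nonneg (F := F) n)
    rw [qNum_succ, pow_succ]
    linarith

/-- With x = 1/(3 · 2^e), the local eigenvalue q^(e+1) is at most an x-fraction of [2e+3], and 1 -
2x ≤ (1 - x)². -/
theorem gapBound_mul_le (j e : ℕ) :
    (1 + 2 / 2 ^ j) / 3 * (1 - 4 / 3 / 2 ^ (e + 1)) * qNum F (2 * e + 3) ≤
      gapBound j (e + 2) * (qNum F (2 * e + 3) - (Nat.card F : ℝ) ^ (e + 1)) := by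
  have h1 := pow_le_mul_qNum (F := F) e
  have hQ := qNum_nonneg (F := F) (2 * e + 3)
  have h2 : (1 : ℝ) ≤ 2 ^ e := one_le_pow₀ one_le_two
  set x : ℝ := 1 / 3 / 2 ^ e with hx
  have hx1 : x ≤ 1 / 3 := div_le_self (by norm_num) h2
  have e1 : (4 : ℝ) / 3 / 2 ^ (e + 1) = 2 * x := by rw [hx, pow_succ]; field_simp; norm_num
  have e2 : (4 : ℝ) / 3 / 2 ^ (e + 2) = x := by rw [hx, pow_add]; field_simp; norm_num
  rw [gapBound, e1, e2]
  have hA : (0 : ℝ) ≤ (1 + 2 / 2 ^ j) / 3 := by positivity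
  have h3 : (1 - 2 * x) * qNum F (2 * e + 3) ≤
      (1 - x) * (qNum F (2 * e + 3) - (Nat.card F : ℝ) ^ (e + 1)) := by
    have h4 := mul_le_mul_of_nonneg_left h1 (show 0 ≤ 1 - x by linarith)
    have h5 : 0 ≤ x ^ 2 * qNum F (2 * e + 3) := by positivity
    linarith
  calc _ = (1 + 2 / 2 ^ j) / 3 * ((1 - 2 * x) * qNum F (2 * e + 3)) := by ring
    _ ≤ _ := mul_le_mul_of_nonneg_left h3 hA
    _ = _ := by ring

/-- The two factors of `gapBound` absorb the two losses of the induction. The factor in j pays for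
replacing [j+2] by q [j+1] = [j+2] - 1, the factor in e for the eigenvalue q^(e+1). Both losses
decay geometrically, so the gap stays bounded below. -/
theorem gapBound_step (j e : ℕ) :
    gapBound (j + 1) (e + 1) * (qNum F (2 * e + 2) * qNum F (j + 2)) ≤
      gapBound j (e + 2) * (qNum F (j + 1) *
        (qNum F (2 * e + 3) - (Nat.card F : ℝ) ^ (e + 1))) := by
  have h1 := mul_le_mul_of_nonneg_left (gapBound_mul_le (F := F) j e)
    (qNum_nonneg (F := F) (j + 1))
  have hm : (0 : ℝ) ≤ 1 - 4 / 3 / 2 ^ (e + 1) := by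
    have : (4 : ℝ) / 3 / 2 ^ (e + 1) ≤ 4 / 3 / 2 ^ 1 := by
      gcongr
      · norm_num
      · omega
    linarith
  have hy : (1 : ℝ) ≤ 2 ^ j := one_le_pow₀ one_le_two
  have hd := two_pow_le_qNum (F := F) (j + 2)
  have hd' : qNum F (j + 2) = Nat.card F * qNum F (j + 1) + 1 := qNum_succ _
  have hu : qNum F (2 * e + 3) = Nat.card F * qNum F (2 * e + 2) + 1 := qNum_succ _
  have hu0 := qNum_nonneg (F := F) (2 * e + 2)
  have hd0 := qNum_nonneg (F := F) (j + 1)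
  have h2 : (1 + 2 / 2 ^ (j + 1)) / 3 * qNum F (j + 2) ≤
      (1 + 2 / 2 ^ j) / 3 * (Nat.card F * qNum F (j + 1)) := by
    rw [show Nat.card F * qNum F (j + 1) = qNum F (j + 2) - 1 by rw [hd']; ring]
    have e1 : (2 : ℝ) / 2 ^ (j + 1) = 1 / 2 ^ j := by rw [pow_succ]; field_simp
    have e2 : (2 : ℝ) ^ (j + 2) = 4 * 2 ^ j := by ring
    rw [e1]
    rw [e2] at hd
    have h3 : 1 / 3 / (2 : ℝ) ^ j * (4 * 2 ^ j - 1) ≤ 1 / 3 / 2 ^ j * qNum F (j + 2) := by gcongr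
    have h4 : (1 + 2 / 2 ^ j) / 3 ≤ 1 / 3 / (2 : ℝ) ^ j * (4 * 2 ^ j - 1) := by
      rw [div_le_iff₀ (by norm_num), div_div, div_mul_eq_mul_div, div_mul_eq_mul_div,
        le_div_iff₀ (by positivity)]
      field_simp
      linarith
    have h5 : (1 + 2 / 2 ^ j) / 3 * (qNum F (j + 2) - 1) - (1 + 1 / 2 ^ j) / 3 * qNum F (j + 2) =
      1 / 3 / (2 : ℝ) ^ j * qNum F (j + 2) - (1 + 2 / 2 ^ j) / 3 := by ring
    linarith
  refine le_trans ?_ (h1.trans (le_of_eq (by ring)))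
  have h3 : (1 + 2 / 2 ^ (j + 1)) / 3 * qNum F (j + 2) * qNum F (2 * e + 2) ≤
      (1 + 2 / 2 ^ j) / 3 * qNum F (j + 1) * qNum F (2 * e + 3) := by
    calc _ ≤ (1 + 2 / 2 ^ j) / 3 * (Nat.card F * qNum F (j + 1)) * qNum F (2 * e + 2) :=
          mul_le_mul_of_nonneg_right h2 hu0
      _ = (1 + 2 / 2 ^ j) / 3 * qNum F (j + 1) * (Nat.card F * qNum F (2 * e + 2)) := by ring
      _ ≤ _ := by
        rw [hu]
        gcongr
        linarith
  have h4 := mul_le_mul_of_nonneg_right h3 hm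
  rw [gapBound]
  linarith

theorem IsSymplectic.hasGap (hω : IsSymplectic ω g) (hσ : Isotropic ω σ) {j e : ℕ}
    (hg : g = finrank F σ + j + e + 1) :
    HasGap ω g σ (finrank F σ + j) (gapBound j (e + 1)) := by
  induction j generalizing e with
  | zero =>
    intro f hf
    -- At the bottom the gap is 1, which is more than required.
    refine (hasGap_finrank (g := g) hσ f hf).trans ?_
    have h1 := gapBound_le_one 0 (e + 1)
    have hf0 : 0 ≤ ∑ x ∈ level ω σ (finrank F σ), f x ^ 2 := sum_nonneg fun _ _ => sq_nonneg _
    rw [sub_self, zero_mul, zero_mul]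
    exact mul_nonneg (mul_nonneg (by linarith) (mul_nonneg (qNum_nonneg _) (qNum_nonneg _))) hf0
  | succ j ih =>
    refine hω.hasGap_succ (ρ := finrank F σ + j) (e := e) (by omega) (by omega) (gapBound_le_one j (e + 1 + 1))
      (ih (e := e + 1) (by omega)) ?_
    rw [show finrank F σ + j + 2 - finrank F σ = j + 2 by omega,
      show finrank F σ + j + 1 - finrank F σ = j + 1 by omega]
    exact gapBound_step j e

end Levels

end SymplecticGeometry

namespace SymplecticGeometry

open Finset

/-! ### Poincaré inequality with a universal constant -/

section Poincare

variable {F V : Type*} [Field F] [AddCommGroup V] [Module F V] [FiniteDimensional F V]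
  [Finite F] [Fintype (Submodule F V)] {ω : LinearMap.BilinForm F V} {g : ℕ}
  {σ : Submodule F V} {r ρ e : ℕ}

open Classical

/-- The energy of `f` over the orthogonal pairs with a common lower neighbour. -/
noncomputable def localEnergy (ω : LinearMap.BilinForm F V) (σ : Submodule F V) (ρ : ℕ)
    (f : Submodule F V → ℝ) : ℝ :=
  ∑ z ∈ level ω σ ρ, ∑ x ∈ level ω σ (ρ + 1) with z ≤ x, ∑ y ∈ level ω σ (ρ + 1) with z ≤ y,
    orthKernel ω x y * (f x - f y) ^ 2

theorem IsSymplectic.sum_orthKernel_mul_left (hω : IsSymplectic ω g) (hg : g = ρ + e + 2)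
    (h : Submodule F V → ℝ) :
    ∑ z ∈ level ω σ ρ, ∑ x ∈ level ω σ (ρ + 1) with z ≤ x, ∑ y ∈ level ω σ (ρ + 1) with z ≤ y,
      orthKernel ω x y * h x =
      qNum F (2 * e + 3) * (qNum F (ρ + 1 - finrank F σ) * ∑ x ∈ level ω σ (ρ + 1), h x) := by
  rw [← hω.sum_lower, mul_sum]
  refine sum_congr rfl fun z hz => ?_
  rw [mul_sum]
  refine sum_congr rfl fun x hx => ?_
  rw [mem_filter] at hx
  rw [← sum_mul, hω.sum_orthKernel hg hz hx.1 hx.2]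

theorem IsSymplectic.localEnergy_eq (hω : IsSymplectic ω g) (hg : g = ρ + e + 2)
    (f : Submodule F V → ℝ) :
    localEnergy ω σ ρ f = 2 * (qNum F (2 * e + 3) * (qNum F (ρ + 1 - finrank F σ) *
      ∑ x ∈ level ω σ (ρ + 1), f x ^ 2)) - 2 * localForm ω σ ρ f := by
  have h1 := hω.sum_orthKernel_mul_left (σ := σ) hg fun x => f x ^ 2
  have h2 : ∑ z ∈ level ω σ ρ, ∑ x ∈ level ω σ (ρ + 1) with z ≤ x,
      ∑ y ∈ level ω σ (ρ + 1) with z ≤ y, orthKernel ω x y * f y ^ 2 =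
      qNum F (2 * e + 3) * (qNum F (ρ + 1 - finrank F σ) *
        ∑ x ∈ level ω σ (ρ + 1), f x ^ 2) := by
    rw [← h1]
    refine sum_congr rfl fun z _ => ?_
    rw [sum_comm]
    refine sum_congr rfl fun x _ => sum_congr rfl fun y _ => ?_
    rw [hω.orthKernel_symm]
  rw [localEnergy, localForm, two_mul]
  nth_rewrite 1 [← h1]
  rw [← h2, mul_sum, ← sum_add_distrib, ← sum_sub_distrib]
  refine sum_congr rfl fun z _ => ?_
  rw [mul_sum, ← sum_add_distrib, ← sum_sub_distrib]
  refine sum_congr rfl fun x _ => ?_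
  rw [mul_sum, ← sum_add_distrib, ← sum_sub_distrib]
  refine sum_congr rfl fun y _ => ?_
  ring

theorem sum_sum_sub_sq (X : Finset (Submodule F V)) (f : Submodule F V → ℝ)
    (hf : ∑ x ∈ X, f x = 0) :
    ∑ x ∈ X, ∑ y ∈ X, (f x - f y) ^ 2 = 2 * #X * ∑ x ∈ X, f x ^ 2 := by
  have h1 : ∀ x ∈ X, ∑ y ∈ X, (f x - f y) ^ 2 = #X * f x ^ 2 + ∑ y ∈ X, f y ^ 2 := by
    intro x _
    have h2 : ∀ y ∈ X, (f x - f y) ^ 2 = f x ^ 2 - 2 * f x * f y + f y ^ 2 := fun y _ => by ring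
    rw [sum_congr rfl h2, sum_add_distrib, sum_sub_distrib, ← mul_sum, hf, sum_const, nsmul_eq_mul]
    ring
  rw [sum_congr rfl h1, sum_add_distrib, ← mul_sum, sum_const, nsmul_eq_mul]
  ring

/-- The **Poincaré inequality** for the isotropic subspaces of dimension `ρ + 1` containing `σ`,
with a constant that depends neither on the field nor on the dimensions. -/
theorem IsSymplectic.poincare (hω : IsSymplectic ω g) (hσ : Isotropic ω σ) {j : ℕ}
    (hρ : ρ = finrank F σ + j) (hg : g = ρ + e + 2) (f : Submodule F V → ℝ) :
    qNum F (2 * e + 3) * qNum F (j + 1) *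
      ∑ x ∈ level ω σ (ρ + 1), ∑ y ∈ level ω σ (ρ + 1), (f x - f y) ^ 2 ≤
      9 * #(level ω σ (ρ + 1)) * localEnergy ω σ ρ f := by
  rcases (level ω σ (ρ + 1)).eq_empty_or_nonempty with hX | hX
  · simp [hX]
  set X := level ω σ (ρ + 1) with hXdef
  have hcard : (0 : ℝ) < #X := by exact_mod_cast hX.card_pos
  set a : ℝ := (∑ x ∈ X, f x) / #X with ha
  let h : Submodule F V → ℝ := fun x => f x - a
  have hh : ∑ x ∈ X, h x = 0 := by
    simp only [h, sum_sub_distrib, sum_const, nsmul_eq_mul, ha]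
    field_simp
    ring
  have e1 : ∀ x y, (f x - f y) ^ 2 = (h x - h y) ^ 2 := fun x y => by simp only [h]; ring
  have e2 : localEnergy ω σ ρ f = localEnergy ω σ ρ h := by
    simp only [localEnergy, e1]
  simp_rw [e2, e1]
  have hg' : g = finrank F σ + j + (e + 1) + 1 := by omega
  have hgap := hω.hasGap hσ hg'
  rw [← hρ] at hgap
  have h1 := hω.localForm_le_of_hasGap hg (gapBound_le_one j (e + 1 + 1)) hgap h hh
  rw [sum_sum_sub_sq X h hh, hω.localEnergy_eq hg]
  rw [show ρ + 1 - finrank F σ = j + 1 by omega] at h1 ⊢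
  have h2 := gapBound_mul_le (F := F) j e
  have hQ := qNum_nonneg (F := F) (2 * e + 3)
  have hd := qNum_nonneg (F := F) (j + 1)
  have hf0 : 0 ≤ ∑ x ∈ X, h x ^ 2 := sum_nonneg fun _ _ => sq_nonneg _
  -- Each factor of the gap is at least 1/3: the first exceeds its limit for large j, the second is
  -- smallest at e = 0.
  have h3 : 1 / 9 * qNum F (2 * e + 3) ≤
      (1 + 2 / 2 ^ j) / 3 * (1 - 4 / 3 / 2 ^ (e + 1)) * qNum F (2 * e + 3) := by
    refine mul_le_mul_of_nonneg_right ?_ hQ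
    have h4 : (4 : ℝ) / 3 / 2 ^ (e + 1) ≤ 4 / 3 / 2 ^ 1 := by
      gcongr
      · norm_num
      · omega
    have h5 : (0 : ℝ) ≤ 2 / 2 ^ j := by positivity
    calc (1 : ℝ) / 9 = 1 / 3 * (1 / 3) := by norm_num
      _ ≤ _ := mul_le_mul (by linarith) (by linarith) (by norm_num) (by positivity)
  have h6 := mul_le_mul_of_nonneg_right (h3.trans h2) (mul_nonneg hd hf0)
  have h7 : 1 / 9 * qNum F (2 * e + 3) * (qNum F (j + 1) * ∑ x ∈ X, h x ^ 2) ≤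
      qNum F (2 * e + 3) * (qNum F (j + 1) * ∑ x ∈ X, h x ^ 2) - localForm ω σ ρ h := by
    linarith
  have h8 := mul_le_mul_of_nonneg_left h7 (show (0 : ℝ) ≤ 18 * #X by positivity)
  linarith

end Poincare

/-! ### The normalized distance of functions to a group -/

section Disagreement

variable {Ω Γ : Type*} [Fintype Ω]

open Classical in
/-- The number of points at which two functions differ. -/
noncomputable def disagree (a b : Ω → Γ) : ℝ := #{i | a i ≠ b i}

@[simp] theorem disagree_self (a : Ω → Γ) : disagree a a = 0 := by simp [disagree]

/-- All estimates for cochains reduce to this union bound: an identity in Γ that follows from two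
others fails at no more points than these do together. -/
theorem disagree_le_add {Γ₁ Γ₂ : Type*} {a b : Ω → Γ} {a₁ b₁ : Ω → Γ₁} {a₂ b₂ : Ω → Γ₂}
    (h : ∀ i, a₁ i = b₁ i → a₂ i = b₂ i → a i = b i) :
    disagree a b ≤ disagree a₁ b₁ + disagree a₂ b₂ := by
  classical
  unfold disagree
  norm_cast
  refine (card_le_card ?_).trans (card_union_le _ _)
  intro i
  simp only [mem_filter, mem_univ, true_and, mem_union]
  contrapose!
  exact fun hi => h i hi.1 hi.2

theorem disagree_triangle (a b c : Ω → Γ) : disagree a c ≤ disagree a b + disagree b c :=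
  disagree_le_add fun _ h₁ h₂ => h₁.trans h₂

theorem disagree_le_of_imp {Γ₁ : Type*} {a b : Ω → Γ} {a₁ b₁ : Ω → Γ₁}
    (h : ∀ i, a₁ i = b₁ i → a i = b i) : disagree a b ≤ disagree a₁ b₁ := by
  have := disagree_le_add (a := a) (b := b) (a₁ := a₁) (b₁ := b₁) (a₂ := a₁) (b₂ := a₁)
    fun i h₁ _ => h i h₁
  simpa using this

theorem disagree_congr {Γ₁ : Type*} {a b : Ω → Γ} {a₁ b₁ : Ω → Γ₁}
    (h : ∀ i, a₁ i = b₁ i ↔ a i = b i) : disagree a b = disagree a₁ b₁ :=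
  le_antisymm (disagree_le_of_imp fun i => (h i).1) (disagree_le_of_imp fun i => (h i).2)

theorem disagree_comm (a b : Ω → Γ) : disagree a b = disagree b a :=
  disagree_congr fun _ => eq_comm

theorem disagree_triangle_right (a b c : Ω → Γ) :
    disagree a c ≤ disagree a b + disagree c b :=
  disagree_le_add fun _ h₁ h₂ => h₁.trans h₂.symm

theorem disagree_mul_le [Group Γ] (a b a' b' : Ω → Γ) :
    disagree (a * a') (b * b') ≤ disagree a b + disagree a' b' :=
  disagree_le_add fun _ h₁ h₂ => by rw [Pi.mul_apply, Pi.mul_apply, h₁, h₂]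

theorem disagree_comp_equiv (φ : Ω ≃ Ω) (a b : Ω → Γ) :
    disagree (a ∘ φ) (b ∘ φ) = disagree a b := by
  classical
  unfold disagree
  congr 1
  refine card_bij (fun i _ => φ i) ?_ ?_ ?_
  · simp
  · intro i _ j _ h
    exact φ.injective h
  · intro j hj
    exact ⟨φ.symm j, by simpa using hj, by simp⟩

end Disagreement

/-! ### From the Poincaré inequality to group-valued functions -/

section Expansion

variable {F V : Type*} [Field F] [AddCommGroup V] [Module F V] [FiniteDimensional F V]
  [Finite F] [Fintype (Submodule F V)] {ω : LinearMap.BilinForm F V} {g : ℕ}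
  {σ : Submodule F V} {r ρ e : ℕ} {Ω Γ : Type*} [Fintype Ω]

open Classical

theorem sum_indicator_sub_sq (S : Finset Γ) {a b : Γ} (ha : a ∈ S) (hb : b ∈ S) :
    ∑ γ ∈ S, ((if a = γ then (1 : ℝ) else 0) - if b = γ then 1 else 0) ^ 2 =
      2 * if a ≠ b then 1 else 0 := by
  have h : ∀ γ ∈ S, ((if a = γ then (1 : ℝ) else 0) - if b = γ then 1 else 0) ^ 2 =
      (if a = γ then (1 : ℝ) else 0) + (if b = γ then 1 else 0) -
        2 * if a = γ then (if a = b then 1 else 0) else 0 := by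
    intro γ _
    by_cases h1 : a = γ <;> by_cases h2 : b = γ <;> by_cases h3 : a = b <;>
      simp_all
    norm_num
  rw [sum_congr rfl h, sum_sub_distrib, sum_add_distrib, ← mul_sum, sum_ite_eq, sum_ite_eq,
    sum_ite_eq, if_pos ha, if_pos hb, if_pos ha]
  by_cases h3 : a = b
  · simp [h3]
    norm_num
  · simp [h3]
    norm_num

/-- Sum the Poincaré inequality over the indicators of the values of ψ; each pair with distinct
values is counted twice on both sides. -/
theorem IsSymplectic.expansion (hω : IsSymplectic ω g) (hσ : Isotropic ω σ) {j : ℕ}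
    (hρ : ρ = finrank F σ + j) (hg : g = ρ + e + 2) (ψ : Submodule F V → Γ) :
    qNum F (2 * e + 3) * qNum F (j + 1) *
      ∑ x ∈ level ω σ (ρ + 1), ∑ y ∈ level ω σ (ρ + 1), (if ψ x ≠ ψ y then (1 : ℝ) else 0) ≤
      9 * #(level ω σ (ρ + 1)) *
        ∑ z ∈ level ω σ ρ, ∑ x ∈ level ω σ (ρ + 1) with z ≤ x,
          ∑ y ∈ level ω σ (ρ + 1) with z ≤ y,
            orthKernel ω x y * (if ψ x ≠ ψ y then (1 : ℝ) else 0) := by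
  let S : Finset Γ := univ.image ψ
  have hS : ∀ x, ψ x ∈ S := fun x => mem_image_of_mem _ (mem_univ x)
  have h1 := sum_le_sum fun (γ : Γ) (_ : γ ∈ S) =>
    hω.poincare hσ hρ hg fun x => if ψ x = γ then (1 : ℝ) else 0
  rw [← mul_sum, ← mul_sum] at h1
  have h2 : ∑ γ ∈ S, ∑ x ∈ level ω σ (ρ + 1), ∑ y ∈ level ω σ (ρ + 1),
      ((if ψ x = γ then (1 : ℝ) else 0) - if ψ y = γ then 1 else 0) ^ 2 =
      2 * ∑ x ∈ level ω σ (ρ + 1), ∑ y ∈ level ω σ (ρ + 1), if ψ x ≠ ψ y then (1 : ℝ) else 0 := by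
    rw [sum_comm, mul_sum]
    refine sum_congr rfl fun x _ => ?_
    rw [sum_comm, mul_sum]
    refine sum_congr rfl fun y _ => ?_
    exact sum_indicator_sub_sq S (hS x) (hS y)
  have h3 : ∑ γ ∈ S, localEnergy ω σ ρ (fun x => if ψ x = γ then (1 : ℝ) else 0) =
      2 * ∑ z ∈ level ω σ ρ, ∑ x ∈ level ω σ (ρ + 1) with z ≤ x,
        ∑ y ∈ level ω σ (ρ + 1) with z ≤ y,
          orthKernel ω x y * (if ψ x ≠ ψ y then (1 : ℝ) else 0) := by
    unfold localEnergy
    rw [sum_comm, mul_sum]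
    refine sum_congr rfl fun z _ => ?_
    rw [sum_comm, mul_sum]
    refine sum_congr rfl fun x _ => ?_
    rw [sum_comm, mul_sum]
    refine sum_congr rfl fun y _ => ?_
    rw [← mul_sum, sum_indicator_sub_sq S (hS x) (hS y)]
    ring
  rw [h2, h3] at h1
  linarith

theorem disagree_eq_sum (a b : Ω → Γ) :
    disagree a b = ∑ i, if a i ≠ b i then (1 : ℝ) else 0 := by
  rw [disagree, card_filter]
  push_cast
  rfl

/-- If a family of functions indexed by the subspaces containing `σ` changes little between
neighbours, then it is nearly constant on average. -/
theorem IsSymplectic.sum_disagree_le (hω : IsSymplectic ω g) (hσ : Isotropic ω σ)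
    (hr : finrank F σ < r) (hrg : r < g) (Ψ : Submodule F V → Ω → Γ) {ε : ℝ}
    (hΨ : ∀ x y, σ ≤ x → σ ≤ y → finrank F x = r → finrank F y = r → Isotropic ω (x ⊔ y) →
      finrank F ↥(x ⊔ y) ≤ r + 1 → disagree (Ψ x) (Ψ y) ≤ ε) :
    ∑ x ∈ level ω σ r, ∑ y ∈ level ω σ r, disagree (Ψ x) (Ψ y) ≤
      9 * (#(level ω σ r) : ℝ) ^ 2 * ε := by
  obtain ⟨j, rfl⟩ : ∃ j, r = finrank F σ + j + 1 := ⟨r - finrank F σ - 1, by omega⟩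
  obtain ⟨e, he⟩ : ∃ e, g = finrank F σ + j + e + 2 := ⟨g - (finrank F σ + j + 2), by omega⟩
  set ρ := finrank F σ + j with hρ
  set X := level ω σ (ρ + 1) with hX
  have h1 := sum_le_sum fun (i : Ω) (_ : i ∈ univ) =>
    hω.expansion hσ hρ he fun x => Ψ x i
  rw [← mul_sum, ← mul_sum] at h1
  have h2 : ∑ i, ∑ x ∈ X, ∑ y ∈ X, (if Ψ x i ≠ Ψ y i then (1 : ℝ) else 0) =
      ∑ x ∈ X, ∑ y ∈ X, disagree (Ψ x) (Ψ y) := by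
    simp_rw [disagree_eq_sum]
    rw [sum_comm]
    exact sum_congr rfl fun x _ => sum_comm
  have h3 : ∑ i, ∑ z ∈ level ω σ ρ, ∑ x ∈ X with z ≤ x, ∑ y ∈ X with z ≤ y,
      orthKernel ω x y * (if Ψ x i ≠ Ψ y i then (1 : ℝ) else 0) ≤
      ∑ z ∈ level ω σ ρ, ∑ x ∈ X with z ≤ x, ∑ y ∈ X with z ≤ y, orthKernel ω x y * ε := by
    rw [sum_comm]
    refine sum_le_sum fun z hz => ?_
    rw [sum_comm]
    refine sum_le_sum fun x hx => ?_
    rw [sum_comm]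
    refine sum_le_sum fun y hy => ?_
    rw [← mul_sum, ← disagree_eq_sum]
    rw [mem_filter] at hx hy
    obtain ⟨⟨hσx, hxi, hxd⟩, hzx⟩ := hx.imp_left mem_level.1
    obtain ⟨⟨hσy, hyi, hyd⟩, hzy⟩ := hy.imp_left mem_level.1
    obtain ⟨-, -, hzd⟩ := mem_level.1 hz
    unfold orthKernel
    split_ifs with hxy
    · rw [one_mul, one_mul]
      have := finrank_sup_le_of_le hzx hzy
      exact hΨ x y hσx hσy hxd hyd (hω.isotropic_sup.2 ⟨hxi, hyi, hxy⟩) (by omega)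
    · simp
  rw [hω.sum_orthKernel_mul_left he (fun _ => ε), sum_const, nsmul_eq_mul,
    show ρ + 1 - finrank F σ = j + 1 by omega] at h3
  rw [h2] at h1
  have h4 : 0 < qNum F (2 * e + 3) * qNum F (j + 1) :=
    mul_pos (qNum_pos (by omega)) (qNum_pos (by omega))
  refine le_of_mul_le_mul_left (h1.trans ?_) h4
  calc _ ≤ _ := mul_le_mul_of_nonneg_left h3 (by positivity)
    _ = _ := by ring

end Expansion

end SymplecticGeometry

/-! ### Holonomy is independent of the intermediate subspace -/

namespace SymplecticGeometry

open Finset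
open scoped Pointwise

variable {F V : Type*} [Field F] [AddCommGroup V] [Module F V] [FiniteDimensional F V]
  {ω : LinearMap.BilinForm F V} {g : ℕ} {Ω Γ : Type*} [Group Γ]

/-- The values of `f` on all translates of a pair. -/
def translates (ω : LinearMap.BilinForm F V) (f : Submodule F V → Submodule F V → Γ)
    (x y : Submodule F V) (h : isometryGroup ω) : Γ :=
  f (h • x) (h • y)

/-- Moving a pair by h only reindexes the group, so disagreements are invariant under simultaneous
translation. -/
theorem translates_smul (f : Submodule F V → Submodule F V → Γ) (h : isometryGroup ω)
    (x y : Submodule F V) :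
    translates ω f (h • x) (h • y) = translates ω f x y ∘ Equiv.mulRight h := by
  funext i
  simp [translates, mul_smul]

section Flags

variable [Fintype Ω]

/-- The cochain `Φ` is nearly closed on the isotropic flags of dimensions `a`, `b`, `c`. -/
def FlagDefect (ω : LinearMap.BilinForm F V) (Φ : Submodule F V → Submodule F V → Ω → Γ)
    (a b c : ℕ) (ε : ℝ) : Prop :=
  ∀ p t w : Submodule F V, p ≤ t → t ≤ w → Isotropic ω w → finrank F p = a → finrank F t = b →
    finrank F w = c → disagree (Φ p t * Φ t w) (Φ p w) ≤ ε

variable {Φ : Submodule F V → Submodule F V → Ω → Γ} {a b c : ℕ} {ε : ℝ}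

/-- The common factor Φ t w cancels from the two products Φ p t Φ t w and Φ p' t Φ t w, at the cost
of one flag each. -/
theorem FlagDefect.disagree_le (hΦ : FlagDefect ω Φ a b c ε) {p p' t w : Submodule F V}
    (hp : finrank F p = a) (hp' : finrank F p' = a) (ht : finrank F t = b) (hw : finrank F w = c)
    (hpt : p ≤ t) (hpt' : p' ≤ t) (htw : t ≤ w) (hwi : Isotropic ω w) :
    disagree (Φ p t * (Φ p' t)⁻¹) (Φ p w * (Φ p' w)⁻¹) ≤ 2 * ε := by
  have h1 := hΦ p t w hpt htw hwi hp ht hw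
  have h2 := hΦ p' t w hpt' htw hwi hp' ht hw
  have h3 : disagree (Φ p t * (Φ p' t)⁻¹) (Φ p w * (Φ p' w)⁻¹) ≤
      disagree (Φ p t * Φ t w) (Φ p w) + disagree (Φ p' t * Φ t w) (Φ p' w) := by
    refine disagree_le_add fun i e1 e2 => ?_
    simp only [Pi.mul_apply, Pi.inv_apply] at e1 e2 ⊢
    rw [← e1, ← e2]
    group
  linarith

end Flags

variable [Finite F] [Fintype (Submodule F V)] [Fintype (isometryGroup ω)]
  {f : Submodule F V → Submodule F V → Γ} {a b c : ℕ} {ε : ℝ}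

/-- The holonomy of `f` around two subspaces of dimension `b` through the same pair of subspaces
is nearly trivial, no matter how far apart they are. -/
theorem FlagDefect.disagree_of_le (hω : IsSymplectic ω g)
    (hf : FlagDefect ω (translates ω f) a b c ε) (hε : 0 ≤ ε) (hbc : b < c) (hcg : c ≤ g)
    {p p' t t' : Submodule F V} (hp : finrank F p = a) (hp' : finrank F p' = a)
    (ht : finrank F t = b) (ht' : finrank F t' = b) (hti : Isotropic ω t) (hti' : Isotropic ω t')
    (hpt : p ≤ t) (hpt' : p ≤ t') (hp't : p' ≤ t) (hp't' : p' ≤ t') :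
    disagree (translates ω f p t * (translates ω f p' t)⁻¹)
      (translates ω f p t' * (translates ω f p' t')⁻¹) ≤ 72 * ε := by
  classical
  set Ψ : Submodule F V → isometryGroup ω → Γ :=
    fun t => translates ω f p t * (translates ω f p' t)⁻¹ with hΨ
  set σ := p ⊔ p' with hσ
  have hσt : σ ≤ t := sup_le hpt hp't
  have hσt' : σ ≤ t' := sup_le hpt' hp't'
  have hσi : Isotropic ω σ := hti.mono hσt
  rcases (Submodule.finrank_mono hσt).eq_or_lt with hd | hd
  · have e1 := Submodule.eq_of_le_of_finrank_le hσt (by omega)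
    have e2 := Submodule.eq_of_le_of_finrank_le hσt' (by omega)
    rw [← e1, ← e2, disagree_self]
    positivity
  rw [ht] at hd
  -- Neighbours lie in a common isotropic w of dimension c, since b < c. Comparing each with w costs
  -- 2ε.
  have hadj : ∀ x y, σ ≤ x → σ ≤ y → finrank F x = b → finrank F y = b → Isotropic ω (x ⊔ y) →
      finrank F ↥(x ⊔ y) ≤ b + 1 → disagree (Ψ x) (Ψ y) ≤ 4 * ε := by
    intro x y hx hy hxd hyd hi hd
    obtain ⟨w, hw, hwi, hwd⟩ := hω.exists_isotropic_ge hi (hd.trans hbc) hcg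
    have h1 := hf.disagree_le hp hp' hxd hwd (le_sup_left.trans hx) (le_sup_right.trans hx)
      (le_sup_left.trans hw) hwi
    have h2 := hf.disagree_le hp hp' hyd hwd (le_sup_left.trans hy) (le_sup_right.trans hy)
      (le_sup_right.trans hw) hwi
    have h3 := disagree_triangle_right (Ψ x) (translates ω f p w * (translates ω f p' w)⁻¹) (Ψ y)
    linarith
  have hsum := hω.sum_disagree_le hσi hd (hbc.trans_le hcg) Ψ hadj
  set X := level ω σ b with hX
  have htX : t ∈ X := mem_level.2 ⟨hσt, hti, ht⟩
  have htX' : t' ∈ X := mem_level.2 ⟨hσt', hti', ht'⟩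
  have hinv : ∀ h : isometryGroup ω, (∀ e ∈ σ, h • e = e) → ∀ x,
      Ψ (h • x) = Ψ x ∘ Equiv.mulRight h := by
    intro h hh x
    have h1 : h • p = p := smul_eq_of_fixes fun e he => hh e (Submodule.mem_sup_left he)
    have h2 : h • p' = p' := smul_eq_of_fixes fun e he => hh e (Submodule.mem_sup_right he)
    have h3 := translates_smul f h p x
    have h4 := translates_smul f h p' x
    rw [h1] at h3
    rw [h2] at h4
    simp only [hΨ, h3, h4]
    rfl
  -- The pointwise stabilizer of σ fixes p and p' and is transitive on X, so the mean distance to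
  -- the other points is the same from every x. The averaged bound thus holds at t and at t'.
  have hconst : ∀ x ∈ X, ∑ y ∈ X, disagree (Ψ x) (Ψ y) = ∑ y ∈ X, disagree (Ψ t) (Ψ y) := by
    intro x hx
    obtain ⟨hσx, hxi, hxd⟩ := mem_level.1 hx
    obtain ⟨h, hh, htx⟩ := hω.exists_smul_eq hti hxi hσt hσx (ht.trans hxd.symm)
    have hfix : h • σ = σ := smul_eq_of_fixes hh
    have hmem : ∀ y, h • y ∈ X ↔ y ∈ X := by
      intro y
      rw [hX, mem_level, mem_level, smul_finrank, isotropic_smul_iff]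
      conv_lhs => rw [← hfix]
      rw [smul_le_smul_iff]
    symm
    refine sum_bij (fun y _ => h • y) (fun y hy => (hmem y).2 hy)
      (fun y _ z _ hyz => MulAction.injective h hyz)
      (fun y hy => ⟨h⁻¹ • y, (hmem _).1 (by rwa [smul_inv_smul]), smul_inv_smul h y⟩) ?_
    intro y _
    rw [← htx, hinv h hh, hinv h hh, disagree_comp_equiv]
  have hXpos : (0 : ℝ) < #X := by exact_mod_cast card_pos.2 ⟨t, htX⟩
  have h1 : ∑ y ∈ X, disagree (Ψ t) (Ψ y) ≤ 36 * #X * ε := by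
    rw [sum_congr rfl hconst, sum_const, nsmul_eq_mul] at hsum
    refine le_of_mul_le_mul_left (hsum.trans (le_of_eq ?_)) hXpos
    ring
  -- Pass through a random y, at mean distance at most 9 · 4ε = 36ε from both ends.
  have h2 : ∑ y ∈ X, disagree (Ψ t) (Ψ t') ≤
      ∑ y ∈ X, (disagree (Ψ t) (Ψ y) + disagree (Ψ t') (Ψ y)) := by
    exact sum_le_sum fun y _ => disagree_triangle_right (Ψ t) (Ψ y) (Ψ t')
  rw [sum_add_distrib, hconst t' htX', sum_const, nsmul_eq_mul] at h2
  refine le_of_mul_le_mul_left (h2.trans ?_) hXpos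
  linarith

end SymplecticGeometry

namespace SymplecticGeometry

variable {F V : Type*} [Field F] [AddCommGroup V] [Module F V] [FiniteDimensional F V]
  {ω : LinearMap.BilinForm F V} {g : ℕ}

/-! ### Pushing isotropic subspaces towards a fixed one -/

section Truncation

theorem finrank_sup_add_le (B : Submodule F V) {A A' : Submodule F V} (h : A ≤ A') :
    finrank F ↥(B ⊔ A') + finrank F A ≤ finrank F ↥(B ⊔ A) + finrank F A' := by
  have h1 := finrank_sup_le_of_le (A := B ⊔ A) (B := A') (C := A) le_sup_right h
  rwa [sup_assoc, sup_eq_right.2 h] at h1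

/-- A complete flag of a finite-dimensional space. -/
theorem exists_complete_flag (F V : Type*) [Field F] [AddCommGroup V] [Module F V]
    [FiniteDimensional F V] :
    ∃ X : ℕ → Submodule F V, Monotone X ∧ X 0 = ⊥ ∧ X (finrank F V) = ⊤ ∧
      ∀ A l, finrank F ↥(A ⊓ X (l + 1)) ≤ finrank F ↥(A ⊓ X l) + 1 := by
  have key : ∀ n ≤ finrank F V, ∃ X : ℕ → Submodule F V, Monotone X ∧ X 0 = ⊥ ∧
      ∀ l ≤ n, finrank F (X l) = l := by
    intro n
    induction n with
    | zero => exact fun _ => ⟨fun _ => ⊥, monotone_const, rfl, fun l hl => by simp_all⟩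
    | succ n ih =>
      intro hn
      obtain ⟨X, hX, h0, hd⟩ := ih (by omega)
      obtain ⟨Y, hY, -, hYd⟩ := exists_finrank_eq_between (A := X n) (C := ⊤) le_top (n := n + 1)
        (by rw [hd n le_rfl]; omega) (by rwa [finrank_top])
      refine ⟨fun l => if l ≤ n then X l else Y, ?_, by simpa using h0, ?_⟩
      · intro a b hab
        dsimp only
        split_ifs with h1 h2
        · exact hX hab
        · exact (hX h1).trans hY
        · omega
        · exact le_rfl
      · intro l hl
        by_cases h1 : l ≤ n
        · rw [show (fun l => if l ≤ n then X l else Y) l = X l from if_pos h1]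
          exact hd l h1
        · rw [show (fun l => if l ≤ n then X l else Y) l = Y from if_neg h1, hYd]
          omega
  obtain ⟨X, hX, h0, hd⟩ := key _ le_rfl
  have htop : X (finrank F V) = ⊤ := Submodule.eq_top_of_finrank_eq (hd _ le_rfl)
  refine ⟨X, hX, h0, htop, fun A l => ?_⟩
  by_cases hl : l + 1 ≤ finrank F V
  · have h1 := finrank_add_le_inf (A := A ⊓ X (l + 1)) (B := X l) (C := X (l + 1)) inf_le_right
      (hX (Nat.le_succ l))
    rw [hd _ hl, hd l (by omega), inf_assoc, inf_eq_right.2 (hX (Nat.le_succ l))] at h1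
    omega
  · have h1 : X l = ⊤ := top_le_iff.1 (htop ▸ hX (by omega))
    have h2 : X (l + 1) = ⊤ := top_le_iff.1 (htop ▸ hX (by omega))
    rw [h1, h2]
    omega

theorem exists_eq_of_step_le_one {φ : ℕ → ℕ} (hφ : ∀ l, φ (l + 1) ≤ φ l + 1) {k n : ℕ}
    (h0 : φ 0 ≤ k) (hn : k ≤ φ n) : ∃ l, φ l = k := by
  induction n with
  | zero => exact ⟨0, le_antisymm h0 hn⟩
  | succ n ih =>
    by_cases h : k ≤ φ n
    · exact ih h
    · exact ⟨n + 1, by have := hφ n; omega⟩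

/-- Cutting x down to x ∩ Bᗮ loses dim B - dim (B ∩ xᗮ). Adding B restores at least as much, because
its overlap with x lies in B ∩ xᗮ when x is isotropic. -/
theorem IsSymplectic.le_finrank_sup_inf_orthogonal (hω : IsSymplectic ω g) {x B : Submodule F V}
    (hx : Isotropic ω x) :
    finrank F x ≤ finrank F ↥(B ⊔ x ⊓ ω.orthogonal B) := by
  have h1 : x ⊓ ω.orthogonal B = ω.orthogonal (ω.orthogonal x ⊔ B) := by
    rw [orthogonal_sup, hω.orthogonal_orthogonal]
  have h2 := hω.finrank_orthogonal (ω.orthogonal x ⊔ B)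
  rw [← h1] at h2
  have h3 := finrank_sup_add_finrank_inf (ω.orthogonal x) B
  have h4 := hω.finrank_orthogonal x
  have h5 := finrank_sup_add_finrank_inf B (x ⊓ ω.orthogonal B)
  have h6 : B ⊓ (x ⊓ ω.orthogonal B) ≤ ω.orthogonal x ⊓ B :=
    le_inf ((inf_le_right.trans inf_le_left).trans hx) inf_le_left
  have h7 := Submodule.finrank_mono h6
  omega

/-- A deformation of the isotropic subspaces of dimension `k` containing `B` to those that contain
a slightly larger `B'`, which moves them little and does not increase distances. -/
theorem IsSymplectic.exists_push (hω : IsSymplectic ω g) {B B' : Submodule F V} {k s : ℕ}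
    (hBB : B ≤ B') (hB' : Isotropic ω B') (hk : finrank F B' ≤ k)
    (hs : finrank F B' ≤ finrank F B + s) :
    ∃ G : Submodule F V → Submodule F V,
      (∀ x : Submodule F V, Isotropic ω x → finrank F x = k → B ≤ x →
        Isotropic ω (G x) ∧ finrank F (G x) = k ∧ B' ≤ G x ∧ k ≤ finrank F ↥(x ⊓ G x) + s) ∧
      ∀ x y : Submodule F V, Isotropic ω (x ⊔ y) → finrank F x = k → finrank F y = k →
        finrank F ↥(x ⊔ y) ≤ k + s →
        Isotropic ω (G x ⊔ G y) ∧ finrank F ↥(G x ⊔ G y) ≤ k + s := by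
  obtain ⟨X, hX, hX0, hXtop, hXstep⟩ := exists_complete_flag F V
  -- B' + (x ∩ B'ᗮ) is isotropic but may be too large. Truncating by a flag chosen once for all x
  -- raises the dimension by at most one at a time, so it takes the value k exactly.
  obtain ⟨Y, hY⟩ : ∃ Y : Submodule F V → ℕ → Submodule F V,
      ∀ x l, Y x l = B' ⊔ x ⊓ (ω.orthogonal B' ⊓ X l) := ⟨_, fun _ _ => rfl⟩
  have hBY : ∀ x l, B' ≤ Y x l := fun x l => by
    rw [hY]
    exact le_sup_left
  have hex : ∀ x : Submodule F V, Isotropic ω x → finrank F x = k → ∃ l, finrank F (Y x l) = k := by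
    intro x hx hxk
    refine exists_eq_of_step_le_one (n := finrank F V) (fun l => ?_) ?_ ?_
    · have h1 := hXstep (x ⊓ ω.orthogonal B') l
      have h2 := finrank_sup_add_le B' (inf_le_inf_left (x ⊓ ω.orthogonal B')
        (hX (Nat.le_add_right l 1)))
      rw [hY, hY, ← inf_assoc, ← inf_assoc]
      omega
    · rw [hY, hX0, inf_bot_eq, inf_bot_eq, sup_bot_eq]
      exact hk
    · rw [hY, hXtop, inf_top_eq, ← hxk]
      exact hω.le_finrank_sup_inf_orthogonal hx
  choose! L hL using hex
  have hYiso : ∀ x l, Isotropic ω x → Isotropic ω (Y x l) := by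
    intro x l hx
    rw [hY]
    refine hω.isotropic_sup.2 ⟨hB', hx.mono inf_le_left, ?_⟩
    exact hω.le_orthogonal_comm.1 (inf_le_right.trans inf_le_left)
  -- Both images lie in the truncation of x + y at the larger of the two flag indices, whose
  -- dimension exceeds k by at most dim (x + y) - k. The shared flag makes this comparison possible.
  have hpair : ∀ x y : Submodule F V, Isotropic ω (x ⊔ y) → finrank F x = k →
      finrank F ↥(x ⊔ y) ≤ k + s → L y ≤ L x →
        Isotropic ω (Y x (L x) ⊔ Y y (L y)) ∧ finrank F ↥(Y x (L x) ⊔ Y y (L y)) ≤ k + s := by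
    intro x y hi hx hd hl
    have hle : Y x (L x) ⊔ Y y (L y) ≤ Y (x ⊔ y) (L x) := by
      rw [hY, hY, hY]
      exact sup_le (sup_le_sup_left (inf_le_inf_right _ le_sup_left) _)
        (sup_le_sup_left (inf_le_inf le_sup_right (inf_le_inf_left _ (hX hl))) _)
    refine ⟨(hYiso _ _ hi).mono hle, (Submodule.finrank_mono hle).trans ?_⟩
    have h1 := hL x (hi.mono le_sup_left) hx
    rw [hY] at h1 ⊢
    generalize ω.orthogonal B' ⊓ X (L x) = Q at h1 ⊢
    have h2 := finrank_sup_add_le B' (inf_le_inf_right Q (le_sup_left : x ≤ x ⊔ y))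
    have h3 := finrank_add_le_inf (A := x) (B := (x ⊔ y) ⊓ Q) (C := x ⊔ y) le_sup_left inf_le_left
    rw [← inf_assoc, inf_eq_left.2 (le_sup_left : x ≤ x ⊔ y)] at h3
    omega
  refine ⟨fun x => Y x (L x), fun x hx hxk hBx =>
    ⟨hYiso x _ hx, hL x hx hxk, hBY x _, ?_⟩, ?_⟩
  · have h1 := hL x hx hxk
    -- The part of x kept in the image contains the truncation together with B, and replacing B by
    -- B' adds at most s dimensions.
    have h3 : x ⊓ (ω.orthogonal B' ⊓ X (L x)) ⊔ B ≤ x ⊓ Y x (L x) := by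
      rw [hY]
      exact sup_le (le_inf inf_le_left le_sup_right) (le_inf hBx (hBB.trans le_sup_left))
    have h2 := finrank_sup_add_le (x ⊓ (ω.orthogonal B' ⊓ X (L x))) hBB
    rw [sup_comm _ B', ← hY] at h2
    have h4 := Submodule.finrank_mono h3
    dsimp only
    omega
  · intro x y hi hx hy hd
    rcases le_total (L y) (L x) with hl | hl
    · exact hpair x y hi hx hd hl
    · have := hpair y x (by rwa [sup_comm]) hy (by rwa [sup_comm]) hl
      rwa [sup_comm] at this

end Truncation

/-! ### Contraction of the complex of isotropic subspaces -/

section Contraction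

variable {Ω Γ : Type*} [Fintype Ω] [Group Γ] {Ψ : Submodule F V → Submodule F V → Ω → Γ}
  {k m s : ℕ} {η : ℝ}

/-- A cochain on the isotropic subspaces of dimension `k` that is nearly closed on the triangles
that lie in an isotropic subspace of dimension `k + m`. -/
structure RipsDefect (ω : LinearMap.BilinForm F V) (Ψ : Submodule F V → Submodule F V → Ω → Γ)
    (k m : ℕ) (η : ℝ) : Prop where
  refl : ∀ x : Submodule F V, finrank F x = k → Isotropic ω x → Ψ x x = 1
  symm : ∀ x y, Ψ y x = (Ψ x y)⁻¹
  triangle : ∀ x y z : Submodule F V, finrank F x = k → finrank F y = k → finrank F z = k →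
    Isotropic ω (x ⊔ y ⊔ z) → finrank F ↥(x ⊔ y ⊔ z) ≤ k + m →
      disagree (Ψ x y * Ψ y z) (Ψ x z) ≤ η

/-- The subspaces `z` through which one passes from `x` to `x'`. -/
structure IsBridge (ω : LinearMap.BilinForm F V) (k s : ℕ) (x x' z : Submodule F V) : Prop where
  finrank_eq : finrank F z = k
  isotropic : Isotropic ω z
  left : x ≤ ω.orthogonal z
  right : x' ≤ ω.orthogonal z
  le_finrank : k ≤ finrank F ↥(z ⊓ (x ⊓ x')) + 3 * s

/-- The sum of three k-spaces through u has dimension at most 3k - 2 dim u, so a large common u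
makes the triangle admissible. -/
theorem RipsDefect.triangle' (hω : IsSymplectic ω g) (hΨ : RipsDefect ω Ψ k m η)
    {x y z u : Submodule F V} (hx : finrank F x = k) (hy : finrank F y = k) (hz : finrank F z = k)
    (hxi : Isotropic ω x) (hyi : Isotropic ω y) (hzi : Isotropic ω z)
    (hxy : x ≤ ω.orthogonal y) (hxz : x ≤ ω.orthogonal z) (hyz : y ≤ ω.orthogonal z)
    (hux : u ≤ x) (huy : u ≤ y) (huz : u ≤ z) (hu : 2 * k ≤ 2 * finrank F u + m) :
    disagree (Ψ x y * Ψ y z) (Ψ x z) ≤ η := by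
  refine hΨ.triangle x y z hx hy hz ?_ ?_
  · exact hω.isotropic_sup.2 ⟨hω.isotropic_sup.2 ⟨hxi, hyi, hxy⟩, hzi, sup_le hxz hyz⟩
  · have h1 := finrank_sup_le_of_le hux huy
    have h2 := finrank_sup_le_of_le (hux.trans (le_sup_left : x ≤ x ⊔ y)) huz
    omega

/-- The quadrilateral x, z, x', z' is cut along zz' into two triangles, which is allowed because the
bridges are orthogonal. -/
theorem RipsDefect.bridge_pair (hω : IsSymplectic ω g) (hΨ : RipsDefect ω Ψ k m η)
    {x x' z z' u : Submodule F V} (hx : finrank F x = k) (hx' : finrank F x' = k)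
    (hxi : Isotropic ω x) (hxi' : Isotropic ω x') (hz : IsBridge ω k s x x' z)
    (hz' : IsBridge ω k s x x' z') (hzz : z ≤ ω.orthogonal z') (hux : u ≤ x) (hux' : u ≤ x')
    (huz : u ≤ z) (huz' : u ≤ z') (hu : 2 * k ≤ 2 * finrank F u + m) :
    disagree (Ψ x z * Ψ z x') (Ψ x z' * Ψ z' x') ≤ 2 * η := by
  have h1 := hΨ.triangle' hω hx hz'.finrank_eq hz.finrank_eq hxi hz'.isotropic hz.isotropic
    hz'.left hz.left (hω.le_orthogonal_comm.1 hzz) hux huz' huz hu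
  have h2 := hΨ.triangle' hω hz.finrank_eq hz'.finrank_eq hx' hz.isotropic hz'.isotropic hxi'
    hzz (hω.le_orthogonal_comm.1 hz.right) (hω.le_orthogonal_comm.1 hz'.right) huz huz' hux' hu
  rw [hΨ.symm z' z] at h2
  have h3 : disagree (Ψ x z * Ψ z x') (Ψ x z' * Ψ z' x') ≤
      disagree (Ψ x z' * Ψ z' z) (Ψ x z) + disagree (Ψ z z' * Ψ z' x') (Ψ z x') := by
    refine disagree_le_add fun i e1 e2 => ?_
    have e3 := congrFun (hΨ.symm z z') i
    simp only [Pi.mul_apply, Pi.inv_apply] at e1 e2 e3 ⊢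
    rw [← e1, ← e2, e3]
    group
  have h4 := hΨ.symm z' z
  rw [← h4] at h2
  linarith

/-- Two bridges need not be orthogonal, so both are compared with a third one, orthogonal to all
four subspaces and containing their common part u, of codimension at most 6s. The room for it is 12s
≤ m ≤ g - k. -/
theorem RipsDefect.bridge_indep (hω : IsSymplectic ω g) (hΨ : RipsDefect ω Ψ k m η)
    (hsm : 40 * s ≤ m) (hg : k + m ≤ g) {x x' z z' : Submodule F V} (hx : finrank F x = k)
    (hx' : finrank F x' = k) (hxi : Isotropic ω x) (hxi' : Isotropic ω x')
    (hz : IsBridge ω k s x x' z) (hz' : IsBridge ω k s x x' z') :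
    disagree (Ψ x z * Ψ z x') (Ψ x z' * Ψ z' x') ≤ 4 * η := by
  have h1 := finrank_add_le_inf (A := z ⊓ (x ⊓ x')) (B := z' ⊓ (x ⊓ x')) (C := x)
    (inf_le_right.trans inf_le_left) (inf_le_right.trans inf_le_left)
  set u := (z ⊓ (x ⊓ x')) ⊓ (z' ⊓ (x ⊓ x')) with hu
  have hux : u ≤ x := inf_le_left.trans (inf_le_right.trans inf_le_left)
  have hux' : u ≤ x' := inf_le_left.trans (inf_le_right.trans inf_le_right)
  have huz : u ≤ z := inf_le_left.trans inf_le_left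
  have huz' : u ≤ z' := inf_le_right.trans inf_le_left
  have h2 := hz.le_finrank
  have h3 := hz'.le_finrank
  have hzk := hz.finrank_eq
  have hzk' := hz'.finrank_eq
  have hku : k ≤ finrank F u + 6 * s := by omega
  have huk := Submodule.finrank_mono hux
  have h4 := finrank_sup_le_of_le hux hux'
  have h5 := finrank_sup_le_of_le huz huz'
  have h6 := finrank_sup_le_of_le (hux.trans (le_sup_left : x ≤ x ⊔ x'))
    (huz.trans (le_sup_left : z ≤ z ⊔ z'))
  have horth : ∀ {y}, Isotropic ω y → u ≤ y → y ≤ ω.orthogonal u := fun hy huy =>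
    hy.trans (LinearMap.BilinForm.orthogonal_le huy)
  obtain ⟨t, hut, htS, hti, htk⟩ := hω.exists_isotropic_extension
    (u := u) (S := x ⊔ x' ⊔ (z ⊔ z')) (hux.trans (le_sup_left.trans le_sup_left))
    (sup_le (sup_le (horth hxi hux) (horth hxi' hux'))
      (sup_le (horth hz.isotropic huz) (horth hz'.isotropic huz'))) (k := k)
    (by omega) (by omega)
  have hSt := hω.le_orthogonal_comm.1 htS
  have hxt : x ≤ ω.orthogonal t := le_sup_left.trans (le_sup_left.trans hSt)
  have hxt' : x' ≤ ω.orthogonal t := le_sup_right.trans (le_sup_left.trans hSt)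
  have hzt : z ≤ ω.orthogonal t := le_sup_left.trans (le_sup_right.trans hSt)
  have hzt' : z' ≤ ω.orthogonal t := le_sup_right.trans (le_sup_right.trans hSt)
  have ht : IsBridge ω k (2 * s) x x' t := by
    refine ⟨htk, hti, hxt, hxt', ?_⟩
    have := Submodule.finrank_mono (le_inf hut (le_inf hux hux'))
    omega
  have hz2 : ∀ {z}, IsBridge ω k s x x' z → IsBridge ω k (2 * s) x x' z := fun h =>
    ⟨h.finrank_eq, h.isotropic, h.left, h.right, h.le_finrank.trans (by omega)⟩
  have h7 := hΨ.bridge_pair hω hx hx' hxi hxi' (hz2 hz) ht hzt hux hux' huz hut (by omega)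
  have h8 := hΨ.bridge_pair hω hx hx' hxi hxi' (hz2 hz') ht hzt' hux hux' huz' hut (by omega)
  have h9 := disagree_triangle_right (Ψ x z * Ψ z x') (Ψ x t * Ψ t x') (Ψ x z' * Ψ z' x')
  linarith

/-- One t orthogonal to all four corners and containing their intersection, of codimension at most
3s, bridges both xx' and yy'; this is the 3s in `IsBridge`. Changing both bridges to t costs 4η
each, and the triangles xty and x'ty' cost η each. -/
theorem RipsDefect.square (hω : IsSymplectic ω g) (hΨ : RipsDefect ω Ψ k m η)
    (hsm : 40 * s ≤ m) (hg : k + m ≤ g) {x y x' y' z z' : Submodule F V} (hx : finrank F x = k)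
    (hy : finrank F y = k) (hx' : finrank F x' = k) (hy' : finrank F y' = k)
    (hxy : Isotropic ω (x ⊔ y)) (hxy' : Isotropic ω (x' ⊔ y'))
    (hd : finrank F ↥(x ⊔ y) ≤ k + s)
    (hxx : k ≤ finrank F ↥(x ⊓ x') + s) (hyy : k ≤ finrank F ↥(y ⊓ y') + s)
    (hz : IsBridge ω k s x x' z) (hz' : IsBridge ω k s y y' z') :
    disagree (Ψ x y) (Ψ x z * Ψ z x' * Ψ x' y' * (Ψ y z' * Ψ z' y')⁻¹) ≤ 10 * η := by
  have h0 := finrank_sup_add_finrank_inf x y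
  have h1 := finrank_add_le_inf (A := x ⊓ x') (B := x ⊓ y) (C := x) inf_le_left inf_le_left
  have h2 := finrank_add_le_inf (A := x ⊓ x' ⊓ (x ⊓ y)) (B := y ⊓ y') (C := y)
    (inf_le_right.trans inf_le_right) inf_le_left
  set u := x ⊓ x' ⊓ (x ⊓ y) ⊓ (y ⊓ y') with hu
  have hux : u ≤ x := inf_le_left.trans (inf_le_left.trans inf_le_left)
  have hux' : u ≤ x' := inf_le_left.trans (inf_le_left.trans inf_le_right)
  have huy : u ≤ y := inf_le_right.trans inf_le_left
  have huy' : u ≤ y' := inf_le_right.trans inf_le_right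
  have hku : k ≤ finrank F u + 3 * s := by omega
  have huk := Submodule.finrank_mono hux
  have h4 := finrank_sup_le_of_le hux huy
  have h5 := finrank_sup_le_of_le hux' huy'
  have h6 := finrank_sup_le_of_le (hux.trans (le_sup_left : x ≤ x ⊔ y))
    (hux'.trans (le_sup_left : x' ≤ x' ⊔ y'))
  obtain ⟨hxi, hyi, hxyo⟩ := hω.isotropic_sup.1 hxy
  obtain ⟨hxi', hyi', hxyo'⟩ := hω.isotropic_sup.1 hxy'
  obtain ⟨t, hut, htS, hti, htk⟩ := hω.exists_isotropic_extension
    (u := u) (S := x ⊔ y ⊔ (x' ⊔ y')) (hux.trans (le_sup_left.trans le_sup_left))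
    (sup_le (hxy.trans (LinearMap.BilinForm.orthogonal_le (hux.trans le_sup_left)))
      (hxy'.trans (LinearMap.BilinForm.orthogonal_le (hux'.trans le_sup_left)))) (k := k)
    (by omega) (by omega)
  have hSt := hω.le_orthogonal_comm.1 htS
  have hxt : x ≤ ω.orthogonal t := le_sup_left.trans (le_sup_left.trans hSt)
  have hyt : y ≤ ω.orthogonal t := le_sup_right.trans (le_sup_left.trans hSt)
  have hxt' : x' ≤ ω.orthogonal t := le_sup_left.trans (le_sup_right.trans hSt)
  have hyt' : y' ≤ ω.orthogonal t := le_sup_right.trans (le_sup_right.trans hSt)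
  have ht : IsBridge ω k s x x' t := by
    refine ⟨htk, hti, hxt, hxt', ?_⟩
    have := Submodule.finrank_mono (le_inf hut (le_inf hux hux'))
    omega
  have ht' : IsBridge ω k s y y' t := by
    refine ⟨htk, hti, hyt, hyt', ?_⟩
    have := Submodule.finrank_mono (le_inf hut (le_inf huy huy'))
    omega
  have h7 := hΨ.bridge_indep hω hsm hg hx hx' hxi hxi' hz ht
  have h8 := hΨ.bridge_indep hω hsm hg hy hy' hyi hyi' hz' ht'
  have h9 := hΨ.triangle' hω hx htk hy hxi hti hyi hxt hxyo (hω.le_orthogonal_comm.1 hyt)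
    hux hut huy (by omega)
  have h10 := hΨ.triangle' hω hx' htk hy' hxi' hti hyi' hxt' hxyo' (hω.le_orthogonal_comm.1 hyt')
    hux' hut huy' (by omega)
  have h11 : disagree (Ψ x y) (Ψ x t * Ψ t x' * Ψ x' y' * (Ψ y t * Ψ t y')⁻¹) ≤
      disagree (Ψ x t * Ψ t y) (Ψ x y) + disagree (Ψ x' t * Ψ t y') (Ψ x' y') := by
    refine disagree_le_add fun i e1 e2 => ?_
    have e3 := congrFun (hΨ.symm x' t) i
    have e4 := congrFun (hΨ.symm y t) i
    simp only [Pi.mul_apply, Pi.inv_apply] at e1 e2 e3 e4 ⊢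
    rw [← e1, ← e2, e3, e4]
    group
  have h12 : disagree (Ψ x t * Ψ t x' * Ψ x' y' * (Ψ y t * Ψ t y')⁻¹)
      (Ψ x z * Ψ z x' * Ψ x' y' * (Ψ y z' * Ψ z' y')⁻¹) ≤
      disagree (Ψ x z * Ψ z x') (Ψ x t * Ψ t x') +
        disagree (Ψ y z' * Ψ z' y') (Ψ y t * Ψ t y') := by
    refine disagree_le_add fun i e1 e2 => ?_
    simp only [Pi.mul_apply, Pi.inv_apply] at e1 e2 ⊢
    rw [e1, e2]
  have h13 := disagree_triangle (Ψ x y) (Ψ x t * Ψ t x' * Ψ x' y' * (Ψ y t * Ψ t y')⁻¹)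
    (Ψ x z * Ψ z x' * Ψ x' y' * (Ψ y z' * Ψ z' y')⁻¹)
  linarith

theorem IsSymplectic.exists_isBridge (hω : IsSymplectic ω g) (hsm : 40 * s ≤ m)
    (hg : k + m ≤ g) {x x' : Submodule F V} (hx : finrank F x = k)
    (hx' : finrank F x' = k) (hxi : Isotropic ω x) (hxi' : Isotropic ω x')
    (hxx : k ≤ finrank F ↥(x ⊓ x') + s) : ∃ z, IsBridge ω k s x x' z := by
  have h1 := finrank_sup_add_finrank_inf x x'
  have h2 := Submodule.finrank_mono (inf_le_left : x ⊓ x' ≤ x)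
  obtain ⟨t, hut, htS, hti, htk⟩ := hω.exists_isotropic_extension
    (u := x ⊓ x') (S := x ⊔ x') (inf_le_left.trans le_sup_left)
    (sup_le (hxi.trans (LinearMap.BilinForm.orthogonal_le inf_le_left))
      (hxi'.trans (LinearMap.BilinForm.orthogonal_le inf_le_right))) (k := k)
    (by omega) (by omega)
  have hSt := hω.le_orthogonal_comm.1 htS
  exact ⟨t, htk, hti, le_sup_left.trans hSt, le_sup_right.trans hSt, by
    rw [inf_eq_right.2 hut]; omega⟩

/-- The contraction of the complex of isotropic subspaces of dimension `k` to a point, in `n`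
steps of size `s`. -/
theorem RipsDefect.exists_primitive (hω : IsSymplectic ω g) (hΨ : RipsDefect ω Ψ k m η)
    (hsm : 40 * s ≤ m) (hg : k + m ≤ g) (n : ℕ) {B : Submodule F V} (hB : Isotropic ω B)
    (hBk : finrank F B ≤ k) (hn : k ≤ finrank F B + n * s) :
    ∃ H : Submodule F V → Ω → Γ, ∀ x y : Submodule F V, finrank F x = k → finrank F y = k → B ≤ x → B ≤ y →
      Isotropic ω (x ⊔ y) → finrank F ↥(x ⊔ y) ≤ k + s →
        disagree (Ψ x y) (H x * (H y)⁻¹) ≤ 10 * n * η := by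
  induction n generalizing B with
  | zero =>
    refine ⟨1, fun x y hx hy hBx hBy hi _ => ?_⟩
    have e1 := Submodule.eq_of_le_of_finrank_le hBx (by omega)
    have e2 := Submodule.eq_of_le_of_finrank_le hBy (by omega)
    subst e1
    rw [← e2, hΨ.refl B hx hB]
    simp
  | succ n ih =>
    -- B grows by s dimensions at each step and stops at k.
    obtain ⟨B', hBB, hB', hBd⟩ := hω.exists_isotropic_ge hB
      (k := min k (finrank F B + s)) (by omega) (by omega)
    obtain ⟨H, hH⟩ := ih hB' (by omega) (by rw [Nat.succ_mul] at hn; omega)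
    obtain ⟨G, hG, hG'⟩ := hω.exists_push (k := k) (s := s) hBB hB' (by omega) (by omega)
    have hbr : ∀ x : Submodule F V, Isotropic ω x → finrank F x = k → B ≤ x →
        ∃ z, IsBridge ω k s x (G x) z := by
      intro x hxi hx hBx
      obtain ⟨h1, h2, -, h4⟩ := hG x hxi hx hBx
      exact hω.exists_isBridge hsm hg hx h2 hxi h1 h4
    choose! Z hZ using hbr
    -- Travel from x to its pushed image over a bridge, since the two need not be orthogonal, and
    -- use the primitive for B' there.
    refine ⟨fun x => Ψ x (Z x) * Ψ (Z x) (G x) * H (G x), fun x y hx hy hBx hBy hi hd => ?_⟩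
    have hxi := hi.mono (le_sup_left : x ≤ x ⊔ y)
    have hyi := hi.mono (le_sup_right : y ≤ x ⊔ y)
    obtain ⟨hGx1, hGx2, hGx3, hGx4⟩ := hG x hxi hx hBx
    obtain ⟨hGy1, hGy2, hGy3, hGy4⟩ := hG y hyi hy hBy
    obtain ⟨hGi, hGd⟩ := hG' x y hi hx hy hd
    have h1 := hH (G x) (G y) hGx2 hGy2 hGx3 hGy3 hGi hGd
    have h2 := hΨ.square hω hsm hg hx hy hGx2 hGy2 hi hGi hd hGx4 hGy4 (hZ x hxi hx hBx)
      (hZ y hyi hy hBy)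
    have h3 : disagree (Ψ x y) (Ψ x (Z x) * Ψ (Z x) (G x) * H (G x) *
        (Ψ y (Z y) * Ψ (Z y) (G y) * H (G y))⁻¹) ≤
        disagree (Ψ x y) (Ψ x (Z x) * Ψ (Z x) (G x) * Ψ (G x) (G y) *
          (Ψ y (Z y) * Ψ (Z y) (G y))⁻¹) +
        disagree (Ψ (G x) (G y)) (H (G x) * (H (G y))⁻¹) := by
      refine disagree_le_add fun i e1 e2 => ?_
      simp only [Pi.mul_apply, Pi.inv_apply] at e1 e2 ⊢
      rw [e1, e2]
      group
    refine h3.trans ((add_le_add h2 h1).trans (le_of_eq ?_))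
    push_cast
    ring

end Contraction

end SymplecticGeometry

/-! ### Primitive of the function-valued cochain -/

namespace SymplecticGeometry

variable {F V : Type*} [Field F] [AddCommGroup V] [Module F V] [FiniteDimensional F V]
  {ω : LinearMap.BilinForm F V} {g : ℕ}

/-- Two subspaces of the same dimension can be joined inside their sum in steps of size `s`. -/
theorem exists_step {x y : Submodule F V} {k s n : ℕ} (hx : finrank F x = k)
    (hy : finrank F y = k) (hd : finrank F ↥(x ⊔ y) ≤ k + (n + 1) * s) :
    ∃ z ≤ x ⊔ y, finrank F z = k ∧ finrank F ↥(x ⊔ z) ≤ k + s ∧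
      finrank F ↥(z ⊔ y) ≤ k + n * s := by
  have h0 := finrank_sup_add_finrank_inf x y
  have hc := Submodule.finrank_mono (inf_le_left : x ⊓ y ≤ x)
  -- Trade dimensions over x ∩ y: z consists of at most s new dimensions of y and of x with as many
  -- removed.
  obtain ⟨y', hy1, hy2, hyd⟩ := exists_finrank_eq_between (inf_le_right : x ⊓ y ≤ y)
    (n := min (finrank F ↥(x ⊓ y) + s) k) (by omega) (by omega)
  obtain ⟨x', hx1, hx2, hxd⟩ := exists_finrank_eq_between (inf_le_left : x ⊓ y ≤ x)
    (n := k - (finrank F y' - finrank F ↥(x ⊓ y))) (by omega) (by omega)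
  have e1 : x' ⊓ y' = x ⊓ y := le_antisymm (inf_le_inf hx2 hy2) (le_inf hx1 hy1)
  have h1 := finrank_sup_add_finrank_inf x' y'
  rw [e1] at h1
  have h2 := finrank_sup_le_of_le (inf_le_left : x ⊓ y ≤ x) hy1
  have h3 := finrank_sup_le_of_le hx1 (inf_le_right : x ⊓ y ≤ y)
  refine ⟨x' ⊔ y', sup_le_sup hx2 hy2, by omega, ?_, ?_⟩
  · rw [← sup_assoc, sup_eq_left.2 hx2]
    omega
  · rw [sup_assoc, sup_eq_right.2 hy2]
    rw [Nat.succ_mul] at hd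
    omega

variable [Finite F] [Fintype (Submodule F V)] [Fintype (isometryGroup ω)] {Γ : Type*} [Group Γ]
  {f : Submodule F V → Submodule F V → Γ} {k m i₂ i₃ s n : ℕ} {ε : ℝ}

/-- The hypotheses on a cochain all of whose flags of dimensions in `{k, k + m, i₂, i₃}` through
a subspace of dimension `k` have small defect. -/
structure NearCocycle (ω : LinearMap.BilinForm F V) [Fintype (isometryGroup ω)] (g : ℕ)
    (f : Submodule F V → Submodule F V → Γ) (k m i₂ i₃ : ℕ) (ε : ℝ) : Prop where
  symplectic : IsSymplectic ω g
  nonneg : 0 ≤ ε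
  pos : 0 < m
  lt₂ : k + m < i₂
  lt₃ : i₂ < i₃
  le : i₃ ≤ g
  defect : ∀ b ∈ ({k, k + m, i₂, i₃} : Finset ℕ), ∀ c ∈ ({k, k + m, i₂, i₃} : Finset ℕ),
    k < b → b < c → FlagDefect ω (translates ω f) k b c ε

namespace NearCocycle

variable (hf : NearCocycle ω g f k m i₂ i₃ ε)
include hf

/-- Choose t' of dimension k + m between x + y and w: going from t to t' costs 72ε, and from t' up
to w another 2ε. -/
theorem disagree_le {x y t w : Submodule F V} (hx : finrank F x = k) (hy : finrank F y = k)
    (ht : finrank F t = k + m) (hti : Isotropic ω t) (hxt : x ≤ t) (hyt : y ≤ t)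
    (hw : finrank F w ∈ ({k + m, i₂, i₃} : Finset ℕ)) (hwi : Isotropic ω w) (hxw : x ≤ w)
    (hyw : y ≤ w) :
    disagree (translates ω f x t * (translates ω f y t)⁻¹)
      (translates ω f x w * (translates ω f y w)⁻¹) ≤ 74 * ε := by
  have hε := hf.nonneg
  have hpos := hf.pos
  have h12 := hf.lt₂
  have h23 := hf.lt₃
  have hd := Submodule.finrank_mono (sup_le hxt hyt)
  have hkw : k + m ≤ finrank F w := by
    simp only [Finset.mem_insert, Finset.mem_singleton] at hw
    omega
  obtain ⟨t', h1, h2, h3⟩ := exists_finrank_eq_between (sup_le hxw hyw) (n := k + m)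
    (by omega) hkw
  have hti' := hwi.mono h2
  have hb := (hf.defect (k + m) (by simp) i₂ (by simp) (by omega) h12).disagree_of_le hf.symplectic
    hε h12 (h23.le.trans hf.le) hx hy ht h3 hti hti' hxt (le_sup_left.trans h1) hyt
    (le_sup_right.trans h1)
  by_cases hwd : finrank F w = k + m
  · have e := Submodule.eq_of_le_of_finrank_le h2 (by omega)
    rw [← e]
    linarith
  · have hlt : k + m < finrank F w := by omega
    have hc := (hf.defect (k + m) (by simp) (finrank F w)
      (by simp only [Finset.mem_insert, Finset.mem_singleton] at hw ⊢; omega) (by omega)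
      hlt).disagree_le hx hy h3 rfl (le_sup_left.trans h1) (le_sup_right.trans h1) h2 hwi
    have := disagree_triangle (translates ω f x t * (translates ω f y t)⁻¹)
      (translates ω f x t' * (translates ω f y t')⁻¹)
      (translates ω f x w * (translates ω f y w)⁻¹)
    linarith

/-- The induced cochain on the subspaces of dimension `k`. -/
theorem exists_ripsDefect : ∃ Ψ : Submodule F V → Submodule F V → isometryGroup ω → Γ,
    RipsDefect ω Ψ k m (216 * ε) ∧ ∀ x y w : Submodule F V, finrank F x = k → finrank F y = k →
      finrank F ↥(x ⊔ y) ≤ k + m → x ≤ w → y ≤ w → Isotropic ω w →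
      finrank F w ∈ ({k + m, i₂, i₃} : Finset ℕ) →
        disagree (translates ω f x w * (translates ω f y w)⁻¹) (Ψ x y) ≤ 74 * ε := by
  have hpos := hf.pos
  have h12 := hf.lt₂
  have h23 := hf.lt₃
  have h3 := hf.le
  have hω := hf.symplectic
  have hT : ∀ σ : Submodule F V, Isotropic ω σ → finrank F σ ≤ k + m →
      ∃ t, σ ≤ t ∧ Isotropic ω t ∧ finrank F t = k + m := fun σ hσ hd =>
    hω.exists_isotropic_ge hσ hd (by omega)
  choose! T hT1 hT2 hT3 using hT
  -- The intermediate subspace depends only on x + y, which makes Ψ exactly antisymmetric.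
  let Ψ : Submodule F V → Submodule F V → isometryGroup ω → Γ := fun x y =>
    translates ω f x (T (x ⊔ y)) * (translates ω f y (T (x ⊔ y)))⁻¹
  have hΨ : ∀ x y t : Submodule F V, finrank F x = k → finrank F y = k → x ≤ t → y ≤ t →
      Isotropic ω t → finrank F t = k + m →
        disagree (Ψ x y) (translates ω f x t * (translates ω f y t)⁻¹) ≤ 72 * ε := by
    intro x y t hx hy hxt hyt hti ht
    have hi := hti.mono (sup_le hxt hyt)
    have hd := Submodule.finrank_mono (sup_le hxt hyt)
    rw [ht] at hd
    have hle := hT1 _ hi hd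
    exact (hf.defect (k + m) (by simp) i₂ (by simp) (by omega) h12).disagree_of_le hω
      hf.nonneg h12 (h23.le.trans h3) hx hy (hT3 _ hi hd) ht (hT2 _ hi hd) hti
      (le_sup_left.trans hle) hxt (le_sup_right.trans hle) hyt
  refine ⟨Ψ, ⟨fun x _ _ => mul_inv_cancel _, fun x y => ?_, ?_⟩, ?_⟩
  · simp only [Ψ, sup_comm y x, mul_inv_rev, inv_inv]
  · intro x y z hx hy hz hi hd
    -- Computed in a single t over all three vertices the holonomies compose exactly; replacing the
    -- three choices by t costs 3 · 72ε.
    obtain ⟨t, ht, hti, htd⟩ := hω.exists_isotropic_ge hi hd (by omega)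
    have hxt : x ≤ t := le_sup_left.trans (le_sup_left.trans ht)
    have hyt : y ≤ t := le_sup_right.trans (le_sup_left.trans ht)
    have hzt : z ≤ t := le_sup_right.trans ht
    have h1 := hΨ x y t hx hy hxt hyt hti htd
    have h2 := hΨ y z t hy hz hyt hzt hti htd
    have h3 := hΨ x z t hx hz hxt hzt hti htd
    have h4 := disagree_mul_le (Ψ x y) (translates ω f x t * (translates ω f y t)⁻¹)
      (Ψ y z) (translates ω f y t * (translates ω f z t)⁻¹)
    rw [show translates ω f x t * (translates ω f y t)⁻¹ *
      (translates ω f y t * (translates ω f z t)⁻¹) =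
      translates ω f x t * (translates ω f z t)⁻¹ by group] at h4
    have h5 := disagree_triangle_right (Ψ x y * Ψ y z)
      (translates ω f x t * (translates ω f z t)⁻¹) (Ψ x z)
    linarith
  · intro x y w hx hy hd hxw hyw hwi hw
    have hi := hwi.mono (sup_le hxw hyw)
    have hle := hT1 _ hi hd
    rw [disagree_comm]
    exact hf.disagree_le hx hy (hT3 _ hi hd) (hT2 _ hi hd) (le_sup_left.trans hle)
      (le_sup_right.trans hle) hw hwi hxw hyw

/-- A nearly closed cochain is nearly a coboundary. -/
theorem exists_primitive (hsm : 40 * s ≤ m) (hn : k ≤ n * s) :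
    ∃ H : Submodule F V → isometryGroup ω → Γ, ∀ u v : Submodule F V, u ≤ v → Isotropic ω v →
      finrank F u < finrank F v → finrank F u ∈ ({k, k + m, i₂, i₃} : Finset ℕ) →
      finrank F v ∈ ({k, k + m, i₂, i₃} : Finset ℕ) →
        disagree (translates ω f u v) (H u * (H v)⁻¹) ≤ (n * (2160 * n + 74) + 1) * ε := by
  classical
  have hpos := hf.pos
  have h12 := hf.lt₂
  have h23 := hf.lt₃
  have h3 := hf.le
  have hω := hf.symplectic
  have hε := hf.nonneg
  obtain ⟨Ψ, hΨ, hΨw⟩ := hf.exists_ripsDefect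
  obtain ⟨H, hH⟩ := hΨ.exists_primitive (s := s) hω hsm (by omega) n (B := ⊥) isotropic_bot
    (by simp) (by simpa using hn)
  -- The contraction controls only pairs whose sum has dimension at most k + s. Other pairs below w
  -- are joined by such moves inside w, each costing 10n · 216ε for the primitive and 74ε for the
  -- passage from w to Ψ.
  have hpath : ∀ l : ℕ, ∀ x y w : Submodule F V, finrank F x = k → finrank F y = k →
      finrank F ↥(x ⊔ y) ≤ k + l * s → x ≤ w → y ≤ w → Isotropic ω w →
      finrank F w ∈ ({k + m, i₂, i₃} : Finset ℕ) →
        disagree (translates ω f x w * (translates ω f y w)⁻¹) (H x * (H y)⁻¹) ≤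
          l * (2160 * n + 74) * ε := by
    intro l
    induction l with
    | zero =>
      intro x y w hx hy hd _ _ _ _
      have e1 := Submodule.eq_of_le_of_finrank_le (le_sup_left : x ≤ x ⊔ y) (by omega)
      have e2 := Submodule.eq_of_le_of_finrank_le (le_sup_right : y ≤ x ⊔ y) (by omega)
      rw [e1.trans e2.symm]
      simp
    | succ l ih =>
      intro x y w hx hy hd hxw hyw hwi hw
      obtain ⟨z, hz, hzk, hz1, hz2⟩ := exists_step hx hy hd
      have hzw := hz.trans (sup_le hxw hyw)
      have h1 := ih z y w hzk hy hz2 hzw hyw hwi hw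
      have h2 := hΨw x z w hx hzk (by omega) hxw hzw hwi hw
      have h3 := hH x z hx hzk bot_le bot_le (hwi.mono (sup_le hxw hzw)) hz1
      have h4 := disagree_triangle (translates ω f x w * (translates ω f z w)⁻¹) (Ψ x z)
        (H x * (H z)⁻¹)
      have h5 := disagree_mul_le (translates ω f x w * (translates ω f z w)⁻¹) (H x * (H z)⁻¹)
        (translates ω f z w * (translates ω f y w)⁻¹) (H z * (H y)⁻¹)
      rw [show translates ω f x w * (translates ω f z w)⁻¹ *
        (translates ω f z w * (translates ω f y w)⁻¹) =
        translates ω f x w * (translates ω f y w)⁻¹ by group,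
        show H x * (H z)⁻¹ * (H z * (H y)⁻¹) = H x * (H y)⁻¹ by group] at h5
      push_cast
      linarith
  have hpair : ∀ x y w : Submodule F V, finrank F x = k → finrank F y = k → x ≤ w → y ≤ w →
      Isotropic ω w → finrank F w ∈ ({k + m, i₂, i₃} : Finset ℕ) →
        disagree (translates ω f x w * (translates ω f y w)⁻¹) (H x * (H y)⁻¹) ≤
          n * (2160 * n + 74) * ε := by
    intro x y w hx hy hxw hyw hwi hw
    refine hpath n x y w hx hy ?_ hxw hyw hwi hw
    have := finrank_sup_add_finrank_inf x y
    omega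
  have hP : ∀ w : Submodule F V, k ≤ finrank F w → ∃ p ≤ w, finrank F p = k := by
    intro w hw
    obtain ⟨p, -, hp, hpd⟩ := exists_finrank_eq_between (bot_le : ⊥ ≤ w) (n := k) (by simp) hw
    exact ⟨p, hp, hpd⟩
  choose! P hP1 hP2 using hP
  -- In the other dimensions the primitive is transported from a chosen k-dimensional subspace.
  refine ⟨fun t => if finrank F t = k then H t else (translates ω f (P t) t)⁻¹ * H (P t),
    fun u v huv hvi hlt hu hv => ?_⟩
  have hkv : k < finrank F v ∧ k ≤ finrank F u := by
    simp only [Finset.mem_insert, Finset.mem_singleton] at hu hv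
    omega
  have hv' : finrank F v ∈ ({k + m, i₂, i₃} : Finset ℕ) := by
    simp only [Finset.mem_insert, Finset.mem_singleton] at hv ⊢
    omega
  have hPv1 := hP1 v hkv.1.le
  have hPv2 := hP2 v hkv.1.le
  dsimp only
  rw [if_neg hkv.1.ne']
  by_cases hu' : finrank F u = k
  · rw [if_pos hu']
    have h1 := hpair u (P v) v hu' hPv2 huv hPv1 hvi hv'
    have h2 : disagree (translates ω f u v) (H u * ((translates ω f (P v) v)⁻¹ * H (P v))⁻¹) ≤
        disagree (translates ω f u v * (translates ω f (P v) v)⁻¹) (H u * (H (P v))⁻¹) := by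
      refine disagree_le_of_imp fun i e => ?_
      simp only [Pi.mul_apply, Pi.inv_apply] at e ⊢
      rw [mul_inv_eq_iff_eq_mul] at e
      rw [e]
      group
    linarith
  · rw [if_neg hu']
    have hPu1 := hP1 u hkv.2
    have hPu2 := hP2 u hkv.2
    have h1 := hpair (P u) (P v) v hPu2 hPv2 (hPu1.trans huv) hPv1 hvi hv'
    -- The flag from the chosen k-space through u to v accounts for the final +1.
    have h2 := hf.defect (finrank F u) hu (finrank F v) hv (by omega) hlt (P u) u v hPu1 huv hvi
      hPu2 rfl rfl
    have h3 : disagree (translates ω f u v) ((translates ω f (P u) u)⁻¹ * H (P u) *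
        ((translates ω f (P v) v)⁻¹ * H (P v))⁻¹) ≤
        disagree (translates ω f (P u) v * (translates ω f (P v) v)⁻¹)
          (H (P u) * (H (P v))⁻¹) +
        disagree (translates ω f (P u) u * translates ω f u v) (translates ω f (P u) v) := by
      refine disagree_le_add fun i e1 e2 => ?_
      simp only [Pi.mul_apply, Pi.inv_apply] at e1 e2 ⊢
      rw [mul_inv_eq_iff_eq_mul, ← e2] at e1
      rw [← mul_right_inj (translates ω f (P u) u i), e1]
      group
    linarith

end NearCocycle

end SymplecticGeometry

/-! ### Orbits and transitivity on flags -/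

namespace SymplecticGeometry

open Finset
open scoped Pointwise

section Orbits

variable {G Y Z : Type*} [Group G] [Fintype G] [MulAction G Y] [MulAction G Z]

open Classical in
/-- Sampling an orbit through a random group element is dominated by uniform sampling. -/
theorem card_mul_card_smul_mem_le (π : Y → Z) (hπ : ∀ (h : G) y, π (h • y) = h • π y) (y₀ : Y)
    (T : Finset Z) (hT : ∀ z ∈ T, ∃ h : G, h • π y₀ = z) (B : Finset Y) :
    #T * #{h : G | h • y₀ ∈ B} ≤ Fintype.card G * #B := by
  choose! t ht using hT
  have h1 : ∀ z ∈ T, #{h : G | h • t z • y₀ ∈ B} = #{h : G | h • y₀ ∈ B} := by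
    intro z _
    refine card_bij (fun h _ => h * t z) ?_ ?_ ?_
    · intro h hh
      simpa [mul_smul] using hh
    · intro a _ b _ hab
      exact mul_right_cancel hab
    · intro h hh
      exact ⟨h * (t z)⁻¹, by simpa [← mul_smul] using hh, by simp⟩
  calc #T * #{h : G | h • y₀ ∈ B} = ∑ z ∈ T, #{h : G | h • t z • y₀ ∈ B} := by
        rw [sum_congr rfl h1, sum_const, smul_eq_mul]
    _ = ∑ h : G, #{z ∈ T | h • t z • y₀ ∈ B} := by
        simp_rw [card_filter]
        exact sum_comm
    _ ≤ ∑ _h : G, #B := by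
        refine sum_le_sum fun h _ => ?_
        -- For fixed h these points are distinct because their projections h • z are.
        refine card_le_card_of_injOn (fun z => h • t z • y₀) ?_ ?_
        · intro z hz
          exact (mem_filter.1 hz).2
        · intro z hz z' hz' hzz
          have e := congrArg π hzz
          simp only [hπ] at e
          rw [ht z (mem_filter.1 hz).1, ht z' (mem_filter.1 hz').1] at e
          exact MulAction.injective h e
    _ = _ := by rw [sum_const, smul_eq_mul, card_univ]

end Orbits

variable {F V : Type*} [Field F] [AddCommGroup V] [Module F V] [FiniteDimensional F V]
  {ω : LinearMap.BilinForm F V} {g : ℕ}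

/-- Follow h by an isometry that fixes B pointwise and carries the image of A' to B'; subspaces of A
keep their images. -/
theorem IsSymplectic.exists_smul_extend (hω : IsSymplectic ω g) {A A' B B' : Submodule F V}
    (hA : A ≤ A') (hB : B ≤ B') (hAi : Isotropic ω A') (hBi : Isotropic ω B')
    (hd : finrank F A' = finrank F B') {h : isometryGroup ω} (hh : h • A = B) :
    ∃ h' : isometryGroup ω, h' • A' = B' ∧ ∀ x ≤ A, h' • x = h • x := by
  obtain ⟨r, hr, hr'⟩ := hω.exists_smul_eq (hAi.smul h) hBi
    (hh ▸ (smul_le_smul_iff h).2 hA) hB (by rw [smul_finrank, hd])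
  refine ⟨r * h, by rw [mul_smul, hr'], fun x hx => ?_⟩
  rw [mul_smul]
  refine smul_eq_of_fixes fun e he => hr e ?_
  rw [← hh]
  exact (smul_le_smul_iff h).2 hx he

/-- The isotropic flags of dimensions `d 0`, ..., `d 3`. -/
structure IsFlag (ω : LinearMap.BilinForm F V) (d : Fin 4 → ℕ) (A : Fin 4 → Submodule F V) :
    Prop where
  mono : Monotone A
  isotropic : ∀ i, Isotropic ω (A i)
  finrank_eq : ∀ i, finrank F (A i) = d i

/-- The symplectic group acts transitively on the flags of given dimensions. -/
theorem IsSymplectic.exists_smul_flag (hω : IsSymplectic ω g) {d : Fin 4 → ℕ}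
    {A B : Fin 4 → Submodule F V} (hA : IsFlag ω d A) (hB : IsFlag ω d B) :
    ∃ h : isometryGroup ω, ∀ i, h • A i = B i := by
  have key : ∀ n : Fin 4, ∃ h : isometryGroup ω, ∀ i ≤ n, h • A i = B i := by
    intro n
    induction n using Fin.induction with
    | zero =>
      obtain ⟨h, -, hh⟩ := hω.exists_smul_eq (hA.isotropic 0) (hB.isotropic 0) bot_le bot_le
        ((hA.finrank_eq 0).trans (hB.finrank_eq 0).symm)
      refine ⟨h, fun i hi => ?_⟩
      rw [Fin.le_zero_iff.1 hi, hh]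
    | succ n ih =>
      obtain ⟨h, hh⟩ := ih
      obtain ⟨h', h1, h2⟩ := hω.exists_smul_extend (hA.mono (Fin.castSucc_le_succ n))
        (hB.mono (Fin.castSucc_le_succ n)) (hA.isotropic _) (hB.isotropic _)
        ((hA.finrank_eq _).trans (hB.finrank_eq _).symm) (hh _ le_rfl)
      refine ⟨h', fun i hi => ?_⟩
      rcases hi.eq_or_lt with rfl | hi
      · exact h1
      · have hi' : i ≤ n.castSucc := Fin.le_castSucc_iff.2 hi
        rw [h2 _ (hA.mono hi'), hh i hi']
  obtain ⟨h, hh⟩ := key (Fin.last 3)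
  exact ⟨h, fun i => hh i (Fin.le_last i)⟩

end SymplecticGeometry

/-! ### The standard symplectic form -/

namespace SymplecticBuilding

open SymplecticGeometry SimplicialExpansion Finset
open scoped Pointwise

variable (F : Type*) [Field F] (g : ℕ)

/-- The standard symplectic form as a bilinear form. -/
noncomputable def symplecticForm : LinearMap.BilinForm F (Space F g) :=
  LinearMap.mk₂ F form
    (fun a b c => by simp only [form, Prod.fst_add, Prod.snd_add, add_dotProduct]; ring)
    (fun r a b => by simp only [form, Prod.smul_fst, Prod.smul_snd, smul_dotProduct, smul_eq_mul,
      mul_sub])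
    (fun a b c => by simp only [form, Prod.fst_add, Prod.snd_add, dotProduct_add]; ring)
    (fun r a _ => by simp only [form, Prod.smul_fst, Prod.smul_snd, dotProduct_smul, smul_eq_mul,
      mul_sub])

variable {F g}

theorem symplecticForm_apply (a b : Space F g) : symplecticForm F g a b = form a b := rfl

theorem isSymplectic_symplecticForm : IsSymplectic (symplecticForm F g) g where
  alt a := by
    rw [symplecticForm_apply, form, dotProduct_comm, sub_self]
  nondegenerate := by
    have hl : ∀ a : Space F g, (∀ b, symplecticForm F g a b = 0) → a = 0 := by
      intro a ha
      refine Prod.ext (funext fun i => ?_) (funext fun i => ?_)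
      · simpa [symplecticForm_apply, form] using ha (0, Pi.single i 1)
      · simpa [symplecticForm_apply, form] using ha (Pi.single i 1, 0)
    refine ⟨fun a ha => hl a ha, fun b hb => hl b fun a => ?_⟩
    have := hb a
    rw [symplecticForm_apply, form] at this ⊢
    rw [dotProduct_comm b.1, dotProduct_comm b.2, ← neg_sub, neg_eq_zero]
    exact this
  finrank_eq := by
    rw [Module.finrank_prod]
    simp [two_mul]

theorem isIsotropic_iff {W : Submodule F (Space F g)} :
    IsIsotropic W ↔ Isotropic (symplecticForm F g) W :=
  ⟨fun h a ha b hb => h b hb a ha, fun h a ha _ hb => h hb a ha⟩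

end SymplecticBuilding

/-! ### Faces of the building as flags, and their sampling -/

namespace SymplecticBuilding

open SymplecticGeometry SimplicialExpansion Finset
open scoped Pointwise

variable {F : Type*} [Field F] {g : ℕ} {I : Finset ℕ} {d : Fin 4 → ℕ}

open Classical in
theorem mem_faces {s : Finset (Submodule F (Space F g))} :
    s ∈ (colorRestriction F g I).faces ↔ s.Nonempty ∧
      (∀ W ∈ s, W ≠ ⊥ ∧ Isotropic (symplecticForm F g) W ∧ finrank F W ∈ I) ∧
      IsChain (· ≤ ·) (s : Set (Submodule F (Space F g))) := by
  change (_ ∧ _) ∧ _ ↔ _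
  simp only [isIsotropic_iff, Set.mem_ofPred_eq]
  constructor
  · rintro ⟨⟨h1, h2, h3⟩, h4⟩
    exact ⟨h1, fun W hW => ⟨(h2 W hW).1, (h2 W hW).2, h4 W hW⟩, h3⟩
  · rintro ⟨h1, h2, h3⟩
    exact ⟨⟨h1, fun W hW => ⟨(h2 W hW).1, (h2 W hW).2.1⟩, h3⟩, fun W hW => (h2 W hW).2.2⟩

theorem eq_or_finrank_lt {s : Finset (Submodule F (Space F g))}
    (hs : s ∈ (colorRestriction F g I).faces) {u v : Submodule F (Space F g)} (hu : u ∈ s)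
    (hv : v ∈ s) : u = v ∨ (u ≤ v ∧ finrank F u < finrank F v) ∨
      (v ≤ u ∧ finrank F v < finrank F u) := by
  by_cases huv : u = v
  · exact Or.inl huv
  · rcases (mem_faces.1 hs).2.2 hu hv huv with h | h
    · exact Or.inr (Or.inl ⟨h, Submodule.finrank_lt_finrank_of_lt (lt_of_le_of_ne h huv)⟩)
    · exact Or.inr (Or.inr ⟨h, Submodule.finrank_lt_finrank_of_lt (lt_of_le_of_ne h (Ne.symm huv))⟩)

open Classical in
theorem smul_mem_faces {s : Finset (Submodule F (Space F g))}
    (hs : s ∈ (colorRestriction F g I).faces) (h : isometryGroup (symplecticForm F g)) :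
    h • s ∈ (colorRestriction F g I).faces := by
  obtain ⟨h1, h2, h3⟩ := mem_faces.1 hs
  refine mem_faces.2 ⟨h1.smul_finset, fun W hW => ?_, ?_⟩
  · obtain ⟨U, hU, rfl⟩ := mem_smul_finset.1 hW
    obtain ⟨h4, h5, h6⟩ := h2 U hU
    refine ⟨fun H => h4 ?_, h5.smul h, by rwa [smul_finrank]⟩
    rw [← Submodule.finrank_eq_zero, ← smul_finrank h, H, finrank_bot]
  · intro a ha b hb hab
    obtain ⟨a, ha', rfl⟩ := mem_smul_finset.1 ha
    obtain ⟨b, hb', rfl⟩ := mem_smul_finset.1 hb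
    simp only [smul_le_smul_iff]
    exact h3 ha' hb' fun e => hab (by rw [e])

open Classical in
theorem image_flag_mem_faces (hd0 : 0 < d 0) (hd : StrictMono d)
    {A : Fin 4 → Submodule F (Space F g)} (hA : IsFlag (symplecticForm F g) d A) :
    univ.image A ∈ (colorRestriction F g (univ.image d)).faces ∧ #(univ.image A) = 3 + 1 := by
  have hinj : Function.Injective A := fun i j hij =>
    hd.injective (by rw [← hA.finrank_eq, hij, hA.finrank_eq])
  refine ⟨mem_faces.2 ⟨univ_nonempty.image A, fun W hW => ?_, ?_⟩, ?_⟩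
  · obtain ⟨i, -, rfl⟩ := mem_image.1 hW
    refine ⟨fun H => ?_, hA.isotropic i, ?_⟩
    · have h1 := hA.finrank_eq i
      rw [H, finrank_bot] at h1
      have h2 := hd.monotone (Fin.zero_le i)
      omega
    · rw [hA.finrank_eq]
      exact mem_image_of_mem d (mem_univ i)
  · rw [coe_image, coe_univ, Set.image_univ]
    exact hA.mono.isChain_range
  · rw [card_image_of_injective _ hinj, card_univ, Fintype.card_fin]

open Classical in
-- In a chain the dimensions are distinct, so four subspaces with dimensions among four colors use
-- each color once.
theorem exists_flag_of_mem_faces (hd : StrictMono d) {s : Finset (Submodule F (Space F g))}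
    (hs : s ∈ (colorRestriction F g (univ.image d)).faces) (hc : #s = 3 + 1) :
    ∃ A, IsFlag (symplecticForm F g) d A ∧ univ.image A = s := by
  obtain ⟨-, h2, h3⟩ := mem_faces.1 hs
  have hinj : Set.InjOn (fun W : Submodule F (Space F g) => finrank F W) s := by
    intro u hu v hv huv
    dsimp only at huv
    rcases eq_or_finrank_lt hs hu hv with h | h | h
    · exact h
    · omega
    · omega
  have himage : s.image (fun W : Submodule F (Space F g) => finrank F W) = univ.image d := by
    refine eq_of_subset_of_card_le (fun n hn => ?_) ?_
    · obtain ⟨W, hW, rfl⟩ := mem_image.1 hn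
      exact (h2 W hW).2.2
    · rw [card_image_of_injOn hinj, hc, card_image_of_injective _ hd.injective, card_univ,
        Fintype.card_fin]
  have hex : ∀ i, ∃ W : Submodule F (Space F g), W ∈ s ∧ finrank F W = d i := fun i => by
    have : d i ∈ s.image (fun W : Submodule F (Space F g) => finrank F W) := himage ▸ mem_image_of_mem d (mem_univ i)
    simpa using this
  choose A hAs hAd using hex
  have hA : IsFlag (symplecticForm F g) d A := by
    refine ⟨fun i j hij => ?_, fun i => (h2 _ (hAs i)).2.1, hAd⟩
    have h4 := hd.monotone hij
    rcases eq_or_finrank_lt hs (hAs i) (hAs j) with h | h | h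
    · exact h.le
    · exact h.1
    · rw [hAd, hAd] at h
      omega
  refine ⟨A, hA, eq_of_subset_of_card_le (fun W hW => ?_) ?_⟩
  · obtain ⟨i, -, rfl⟩ := mem_image.1 hW
    exact hAs i
  · rw [hc, card_image_of_injective, card_univ, Fintype.card_fin]
    exact fun i j hij => hd.injective (by rw [← hAd, hij, hAd])

/-- Every flag of three subspaces that starts in dimension `d 0` extends to a complete one. -/
theorem exists_flag_through (hd : StrictMono d) (hg : d 3 ≤ g)
    {p t w : Submodule F (Space F g)} (hpt : p ≤ t) (htw : t ≤ w)
    (hw : Isotropic (symplecticForm F g) w) (hp : finrank F p = d 0) {b c : Fin 4}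
    (hb : finrank F t = d b) (hc : finrank F w = d c) (h0b : 0 < b) (hbc : b < c) :
    ∃ A, IsFlag (symplecticForm F g) d A ∧ A 0 = p ∧ A b = t ∧ A c = w := by
  have h01 : d 0 < d 1 := hd (by decide)
  have h12 : d 1 < d 2 := hd (by decide)
  have h23 : d 2 < d 3 := hd (by decide)
  have ht := hw.mono htw
  have key : ∀ A : Fin 4 → Submodule F (Space F g), A 0 ≤ A 1 → A 1 ≤ A 2 → A 2 ≤ A 3 →
      Isotropic (symplecticForm F g) (A 3) → finrank F (A 0) = d 0 → finrank F (A 1) = d 1 →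
      finrank F (A 2) = d 2 → finrank F (A 3) = d 3 → IsFlag (symplecticForm F g) d A := by
    intro A h1 h2 h3 h4 e0 e1 e2 e3
    have hmono : Monotone A := Fin.monotone_iff_le_succ.2 fun i => by
      fin_cases i
      · exact h1
      · exact h2
      · exact h3
    refine ⟨hmono, fun i => h4.mono (hmono (Fin.le_last i)), fun i => ?_⟩
    fin_cases i
    · exact e0
    · exact e1
    · exact e2
    · exact e3
  obtain ⟨hb', hc'⟩ | ⟨hb', hc'⟩ | ⟨hb', hc'⟩ :
      (b = 1 ∧ c = 2) ∨ (b = 1 ∧ c = 3) ∨ (b = 2 ∧ c = 3) := by omega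
  · subst hb' hc'
    obtain ⟨z, hz, hzi, hzd⟩ := isSymplectic_symplecticForm.exists_isotropic_ge hw (k := d 3)
      (by omega) hg
    exact ⟨![p, t, w, z], key _ hpt htw hz hzi hp hb hc hzd, rfl, rfl, rfl⟩
  · subst hb' hc'
    obtain ⟨z, hz1, hz2, hzd⟩ := exists_finrank_eq_between htw (n := d 2) (by omega) (by omega)
    exact ⟨![p, t, z, w], key _ hpt hz1 hz2 hw hp hb hzd hc, rfl, rfl, rfl⟩
  · subst hb' hc'
    obtain ⟨z, hz1, hz2, hzd⟩ := exists_finrank_eq_between hpt (n := d 1) (by omega) (by omega)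
    exact ⟨![p, z, t, w], key _ hz1 hz2 htw hw hp hzd hb hc, rfl, rfl, rfl⟩

section Sampling

variable [Finite F]

open Classical in
/-- The pairs of a top-dimensional face and an ordered tuple of distinct vertices of it. -/
noncomputable def samples [Fintype (Submodule F (Space F g))] (I : Finset ℕ) (k : ℕ) :
    Finset (Finset (Submodule F (Space F g)) × (Fin (k + 1) → Submodule F (Space F g))) :=
  {q | (q.1 ∈ (colorRestriction F g I).faces ∧ q.1.card = 3 + 1) ∧
    Function.Injective q.2 ∧ ∀ j, q.2 j ∈ q.1}

variable [Fintype (Submodule F (Space F g))]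

open Classical

theorem mem_samples {k : ℕ}
    {q : Finset (Submodule F (Space F g)) × (Fin (k + 1) → Submodule F (Space F g))} :
    q ∈ samples I k ↔ (q.1 ∈ (colorRestriction F g I).faces ∧ q.1.card = 3 + 1) ∧
      Function.Injective q.2 ∧ ∀ j, q.2 j ∈ q.1 := by
  simp [samples]

theorem faceProb_eq (k : ℕ) (P : (Fin (k + 1) → Submodule F (Space F g)) → Prop) :
    faceProb (colorRestriction F g I) 3 k P =
      #{q ∈ samples (F := F) (g := g) I k | P q.2} / #(samples (F := F) (g := g) I k) := by
  unfold faceProb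
  rw [Set.ncard_eq_toFinset_card', Set.ncard_eq_toFinset_card']
  congr 3
  · ext q
    simp [samples, and_assoc]
  · ext q
    simp [samples, and_assoc]

/-- The crude count of tuples in a face, repetitions included, is the source of the factor 64 = 4³
for triangles. -/
theorem card_samples_le (k : ℕ) :
    #(samples (F := F) (g := g) I k) ≤ 4 ^ (k + 1) *
      #{s : Finset (Submodule F (Space F g)) |
        s ∈ (colorRestriction F g I).faces ∧ s.card = 3 + 1} := by
  set T : Finset (Finset (Submodule F (Space F g))) :=
    {s | s ∈ (colorRestriction F g I).faces ∧ s.card = 3 + 1} with hT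
  have hmaps : ∀ q ∈ samples (F := F) (g := g) I k, q.1 ∈ T := fun q hq => by
    simpa [hT] using (mem_samples.1 hq).1
  rw [card_eq_sum_card_fiberwise hmaps, mul_comm, ← smul_eq_mul]
  refine sum_le_card_nsmul _ _ _ fun s hs => ?_
  have hc : #s = 3 + 1 := (mem_filter.1 hs).2.2
  calc _ ≤ #(Fintype.piFinset fun _ : Fin (k + 1) => s) := by
        refine card_le_card_of_injOn (fun q => q.2) ?_ ?_
        · intro q hq
          obtain ⟨hq1, hq2⟩ := mem_filter.1 (mem_coe.1 hq)
          refine mem_coe.2 (Fintype.mem_piFinset.2 fun j => ?_)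
          rw [← hq2]
          exact (mem_samples.1 hq1).2.2 j
        · intro q hq q' hq' h
          exact Prod.ext ((mem_filter.1 hq).2.trans (mem_filter.1 hq').2.symm) h
    _ = _ := by rw [Fintype.card_piFinset_const, hc]

variable [Fintype (isometryGroup (symplecticForm F g))]

/-- The frequency of an event on the translates of a face of a fixed type. -/
theorem card_smul_flag_le (hd0 : 0 < d 0) (hd : StrictMono d)
    {A : Fin 4 → Submodule F (Space F g)} (hA : IsFlag (symplecticForm F g) d A) {k : ℕ}
    {e : Fin (k + 1) → Fin 4} (he : Function.Injective e)
    (P : (Fin (k + 1) → Submodule F (Space F g)) → Prop) :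
    (#{h : isometryGroup (symplecticForm F g) | P fun j => h • A (e j)} : ℝ) ≤
      4 ^ (k + 1) * Fintype.card (isometryGroup (symplecticForm F g)) *
        faceProb (colorRestriction F g (univ.image d)) 3 k P := by
  set T : Finset (Finset (Submodule F (Space F g))) :=
    {s | s ∈ (colorRestriction F g (univ.image d)).faces ∧ s.card = 3 + 1} with hT
  set Q := samples (F := F) (g := g) (univ.image d) k with hQ
  let y₀ : Finset (Submodule F (Space F g)) × (Fin (k + 1) → Submodule F (Space F g)) :=
    (univ.image A, fun j => A (e j))
  have hAinj : Function.Injective A := fun i j hij =>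
    hd.injective (by rw [← hA.finrank_eq, hij, hA.finrank_eq])
  have hface := image_flag_mem_faces hd0 hd hA
  have hy₀ : y₀ ∈ Q := mem_samples.2 ⟨hface, hAinj.comp he, fun j =>
    mem_image_of_mem A (mem_univ _)⟩
  have hsmul : ∀ (h : isometryGroup (symplecticForm F g)) {q}, q ∈ Q → h • q ∈ Q := by
    intro h q hq
    obtain ⟨⟨h1, h2⟩, h3, h4⟩ := mem_samples.1 hq
    refine mem_samples.2 ⟨⟨smul_mem_faces h1 h, ?_⟩, ?_, fun j => ?_⟩
    · rw [Prod.smul_fst, card_smul_finset, h2]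
    · exact (MulAction.injective h).comp h3
    · exact smul_mem_smul_finset (h4 j)
  have hT' : ∀ z ∈ T, ∃ h : isometryGroup (symplecticForm F g), h • y₀.1 = z := by
    intro z hz
    obtain ⟨B, hB, rfl⟩ := exists_flag_of_mem_faces hd (mem_filter.1 hz).2.1 (mem_filter.1 hz).2.2
    obtain ⟨h, hh⟩ := isSymplectic_symplecticForm.exists_smul_flag hA hB
    refine ⟨h, ?_⟩
    change (univ.image A).image (h • ·) = _
    rw [image_image]
    exact image_congr fun i _ => hh i
  have h1 := card_mul_card_smul_mem_le (G := isometryGroup (symplecticForm F g)) Prod.fst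
    (fun _ _ => rfl) y₀ T hT' {q ∈ Q | P q.2}
  have h2 : #{h : isometryGroup (symplecticForm F g) | P fun j => h • A (e j)} =
      #{h : isometryGroup (symplecticForm F g) | h • y₀ ∈ ({q ∈ Q | P q.2} : Finset _)} := by
    congr 1
    ext h
    simp only [mem_filter, mem_univ, true_and, hsmul h hy₀]
    rfl
  replace h1 : #T * #{h : isometryGroup (symplecticForm F g) | P fun j => h • A (e j)} ≤
      Fintype.card (isometryGroup (symplecticForm F g)) * #{q ∈ Q | P q.2} := by
    rw [h2]
    convert h1
  have h3 := card_samples_le (F := F) (g := g) (I := univ.image d) k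
  rw [← hQ, ← hT] at h3
  rw [faceProb_eq, ← hQ, mul_div_assoc', le_div_iff₀ (by exact_mod_cast card_pos.2 ⟨y₀, hy₀⟩)]
  norm_cast
  calc _ ≤ #{h : isometryGroup (symplecticForm F g) | P fun j => h • A (e j)} *
        (4 ^ (k + 1) * #T) := Nat.mul_le_mul_left _ h3
    _ = 4 ^ (k + 1) *
        (#T * #{h : isometryGroup (symplecticForm F g) | P fun j => h • A (e j)}) := by ring
    _ ≤ _ := by
      rw [mul_assoc]
      exact Nat.mul_le_mul_left _ h1

end Sampling

end SymplecticBuilding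

namespace SimplicialExpansion

variable {V Γ : Type*} [Group Γ] {X : PreAbstractSimplicialComplex V} {f : V → V → Γ} {u v w : V}

theorem IsOrientedEdge.symm (h : IsOrientedEdge X u v) : IsOrientedEdge X v u := by
  obtain ⟨h1, s, hs, hu, hv⟩ := h
  exact ⟨h1.symm, s, hs, hv, hu⟩

theorem IsCoboundary.isCocycle (hf : IsCoboundary X f) : IsCocycle X f := by
  obtain ⟨h, hh⟩ := hf
  refine ⟨fun u v huv => ?_, fun u v w ⟨huv, hvw, huw, s, hs, hu, hv, hw⟩ => ?_⟩
  · rw [hh u v huv, hh v u huv.symm]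
    simp [coboundaryZero]
  · rw [coboundaryOne, hh u v ⟨huv, s, hs, hu, hv⟩, hh v w ⟨hvw, s, hs, hv, hw⟩,
      hh w u ⟨huw.symm, s, hs, hw, hu⟩]
    simp [coboundaryZero]

theorem isCocycle_coboundaryZero (X : PreAbstractSimplicialComplex V) (h : V → Γ) :
    IsCocycle X (coboundaryZero h) :=
  IsCoboundary.isCocycle ⟨h, fun _ _ _ => rfl⟩

end SimplicialExpansion

/-! ### Between average and uniform defect -/

namespace SymplecticBuilding

open SymplecticGeometry SimplicialExpansion Finset
open scoped Pointwise

variable {F : Type*} [Field F] [Finite F] {g : ℕ} {Γ : Type*} [Group Γ]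
  {f : Submodule F (Space F g) → Submodule F (Space F g) → Γ}

section

variable [Fintype (Submodule F (Space F g))]

open Classical

theorem faceProb_eq_zero {I : Finset ℕ} {k : ℕ}
    {P : (Fin (k + 1) → Submodule F (Space F g)) → Prop}
    (h : ∀ q ∈ samples (F := F) (g := g) I k, ¬ P q.2) :
    faceProb (colorRestriction F g I) 3 k P = 0 := by
  rw [faceProb_eq, filter_false_of_mem h, card_empty, Nat.cast_zero, zero_div]

theorem coboundaryWeight_eq_zero {I : Finset ℕ} (hf : IsCocycle (colorRestriction F g I) f) :
    coboundaryWeight (colorRestriction F g I) 3 f = 0 := by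
  refine faceProb_eq_zero fun q hq => ?_
  obtain ⟨⟨h1, -⟩, h2, h3⟩ := mem_samples.1 hq
  exact not_not.2 (hf.2 _ _ _ ⟨h2.ne (by decide), h2.ne (by decide), h2.ne (by decide), q.1, h1,
    h3 0, h3 1, h3 2⟩)

theorem coboundaryWeight_nonneg {I : Finset ℕ} :
    0 ≤ coboundaryWeight (colorRestriction F g I) 3 f :=
  div_nonneg (Nat.cast_nonneg _) (Nat.cast_nonneg _)

variable [Fintype (isometryGroup (symplecticForm F g))]

/-- The average defect becomes a bound for each flag: the flag extends to a complete one, whose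
translates run over all top-dimensional faces. -/
theorem flagDefect_translates {d : Fin 4 → ℕ} (hd0 : 0 < d 0) (hd : StrictMono d) (hg : d 3 ≤ g)
    (hf : IsCochain (colorRestriction F g (univ.image d)) f) {b c : Fin 4} (hb : 0 < b)
    (hbc : b < c) :
    FlagDefect (symplecticForm F g) (translates (symplecticForm F g) f) (d 0) (d b) (d c)
      (64 * Fintype.card (isometryGroup (symplecticForm F g)) *
        coboundaryWeight (colorRestriction F g (univ.image d)) 3 f) := by
  intro p t w hpt htw hw hp ht hwc
  obtain ⟨A, hA, h1, h2, h3⟩ := exists_flag_through hd hg hpt htw hw hp ht hwc hb hbc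
  have he : Function.Injective ![0, b, c] := by
    intro i j
    fin_cases i <;> fin_cases j <;> simp [hb.ne, hb.ne', hbc.ne, hbc.ne', (hb.trans hbc).ne,
      (hb.trans hbc).ne']
  have key := card_smul_flag_le hd0 hd hA he
    fun v => coboundaryOne f (v 0) (v 1) (v 2) ≠ 1
  rw [show (64 : ℝ) = 4 ^ (2 + 1) by norm_num]
  refine le_trans ?_ key
  rw [disagree]
  norm_cast
  refine card_le_card fun h hh => ?_
  have hh' := (mem_filter.1 hh).2
  refine mem_filter.2 ⟨mem_univ _, fun H => hh' ?_⟩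
  have hne : h • w ≠ h • p := fun e => by
    have := (MulAction.injective h e)
    have := hd (hb.trans hbc)
    rw [← hp, ← hwc, ‹w = p›] at this
    exact lt_irrefl _ this
  -- Antisymmetry of f is known only on oriented edges; it is needed here to turn the closing edge
  -- around.
  have hedge : IsOrientedEdge (colorRestriction F g (univ.image d)) (h • w) (h • p) := by
    refine ⟨hne, _, smul_mem_faces (image_flag_mem_faces hd0 hd hA).1 h, ?_, ?_⟩
    · exact smul_mem_smul_finset (h3 ▸ mem_image_of_mem A (mem_univ c))
    · exact smul_mem_smul_finset (h1 ▸ mem_image_of_mem A (mem_univ 0))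
  have H' : coboundaryOne f (h • p) (h • t) (h • w) = 1 := by
    rw [← h1, ← h2, ← h3]
    exact H
  rw [coboundaryOne, hf _ _ hedge] at H'
  exact mul_inv_eq_one.1 H'

/-- A random translate of an approximate primitive is close to the cochain. -/
theorem exists_cochainDist_le_of_disagree_le {I : Finset ℕ} {K : ℝ} (hK : 0 ≤ K)
    (hf : IsCochain (colorRestriction F g I) f)
    (H : Submodule F (Space F g) → isometryGroup (symplecticForm F g) → Γ)
    (hH : ∀ u v, u ≤ v → Isotropic (symplecticForm F g) v → finrank F u < finrank F v →
      finrank F u ∈ I → finrank F v ∈ I →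
        disagree (translates (symplecticForm F g) f u v) (H u * (H v)⁻¹) ≤
          K * Fintype.card (isometryGroup (symplecticForm F g))) :
    ∃ h, cochainDist (colorRestriction F g I) 3 f (coboundaryZero h) ≤ K := by
  set Q := samples (F := F) (g := g) I 1 with hQ
  -- The candidate attached to x is y ↦ H(x⁻¹ y)(x), and D counts the samples at which it fails.
  let D (x : isometryGroup (symplecticForm F g)) : ℕ :=
    #{q ∈ Q | f (q.2 0) (q.2 1) ≠ coboundaryZero (fun y => H (x⁻¹ • y) x) (q.2 0) (q.2 1)}
  have hsmul : ∀ (x : isometryGroup (symplecticForm F g)) {q}, q ∈ Q → x • q ∈ Q := by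
    intro x q hq
    obtain ⟨⟨h1, h2⟩, h3, h4⟩ := mem_samples.1 hq
    refine mem_samples.2 ⟨⟨smul_mem_faces h1 x, ?_⟩, ?_, fun j => ?_⟩
    · rw [Prod.smul_fst, card_smul_finset, h2]
    · exact (MulAction.injective x).comp h3
    · exact smul_mem_smul_finset (h4 j)
  -- Translating the samples by x turns a failure of the candidate into a disagreement at the point
  -- x, so the sum over x is controlled by H.
  have hD : ∀ x, D x = #{q ∈ Q | translates (symplecticForm F g) f (q.2 0) (q.2 1) x ≠
      (H (q.2 0) * (H (q.2 1))⁻¹) x} := by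
    intro x
    refine (card_bij (fun q _ => x • q) ?_ ?_ ?_).symm
    · intro q hq
      obtain ⟨h1, h2⟩ := mem_filter.1 hq
      refine mem_filter.2 ⟨hsmul x h1, ?_⟩
      simpa [coboundaryZero, translates] using h2
    · intro a _ b _ hab
      exact MulAction.injective x hab
    · intro q hq
      obtain ⟨h1, h2⟩ := mem_filter.1 hq
      refine ⟨x⁻¹ • q, mem_filter.2 ⟨hsmul _ h1, ?_⟩, smul_inv_smul x q⟩
      simpa [coboundaryZero, translates] using h2
  have hsum : ∑ x, (D x : ℝ) ≤ ∑ _x : isometryGroup (symplecticForm F g), K * #Q := by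
    calc ∑ x, (D x : ℝ) = ∑ q ∈ Q, disagree (translates (symplecticForm F g) f (q.2 0) (q.2 1))
          (H (q.2 0) * (H (q.2 1))⁻¹) := by
          simp_rw [hD, disagree, card_filter]
          push_cast
          exact sum_comm
      _ ≤ ∑ q ∈ Q, K * Fintype.card (isometryGroup (symplecticForm F g)) := by
          refine sum_le_sum fun q hq => ?_
          obtain ⟨⟨h1, -⟩, h2, h3⟩ := mem_samples.1 hq
          have h4 := (mem_faces.1 h1).2.1
          rcases eq_or_finrank_lt h1 (h3 0) (h3 1) with h | ⟨h, h'⟩ | ⟨h, h'⟩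
          · exact absurd (h2 h) (by decide)
          · exact hH _ _ h (h4 _ (h3 1)).2.1 h' (h4 _ (h3 0)).2.2 (h4 _ (h3 1)).2.2
          -- A descending edge is reduced to the ascending one by antisymmetry.
          · refine le_trans (disagree_le_of_imp fun x hx => ?_)
              (hH _ _ h (h4 _ (h3 0)).2.1 h' (h4 _ (h3 1)).2.2 (h4 _ (h3 0)).2.2)
            have hedge : IsOrientedEdge (colorRestriction F g I) (x • q.2 0) (x • q.2 1) :=
              ⟨fun e => absurd (h2 (MulAction.injective x e)) (by decide), _,
                smul_mem_faces h1 x, smul_mem_smul_finset (h3 0), smul_mem_smul_finset (h3 1)⟩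
            rw [translates, hf _ _ hedge]
            rw [translates] at hx
            rw [hx]
            simp
      _ = _ := by
          simp only [sum_const, nsmul_eq_mul, card_univ]
          ring
  obtain ⟨x, -, hx⟩ := exists_le_of_sum_le univ_nonempty hsum
  refine ⟨fun y => H (x⁻¹ • y) x, ?_⟩
  rw [cochainDist, faceProb_eq]
  refine div_le_of_le_mul₀ (Nat.cast_nonneg _) hK ?_
  convert hx

theorem nearCocycle_translates {k m i₂ i₃ : ℕ} (hk : 0 < k) (hm : 0 < m) (h₂ : k + m < i₂)
    (h₃ : i₂ < i₃) (hg : i₃ ≤ g) (hf : IsCochain (colorRestriction F g {k, k + m, i₂, i₃}) f) :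
    NearCocycle (symplecticForm F g) g f k m i₂ i₃
      (64 * Fintype.card (isometryGroup (symplecticForm F g)) *
        coboundaryWeight (colorRestriction F g {k, k + m, i₂, i₃}) 3 f) := by
  set d : Fin 4 → ℕ := ![k, k + m, i₂, i₃] with hd
  have himage : ({k, k + m, i₂, i₃} : Finset ℕ) = univ.image d := by
    ext n
    simp [hd, Fin.exists_fin_succ, eq_comm]
  have hmono : StrictMono d := Fin.strictMono_iff_lt_succ.2 fun i => by
    fin_cases i
    · change k < k + m
      omega
    · exact h₂
    · exact h₃
  rw [himage] at hf ⊢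
  refine ⟨isSymplectic_symplecticForm, ?_, hm, h₂, h₃, hg, ?_⟩
  · exact mul_nonneg (by positivity) coboundaryWeight_nonneg
  · intro b hb c hc hkb hbc
    rw [himage] at hb hc
    obtain ⟨b, -, rfl⟩ := mem_image.1 hb
    obtain ⟨c, -, rfl⟩ := mem_image.1 hc
    exact flagDefect_translates hk hmono hg hf (hmono.lt_iff_lt.1 hkb) (hmono.lt_iff_lt.1 hbc)

theorem exists_primitive_translates {k m i₂ i₃ s n : ℕ} (hk : 0 < k) (hm : 0 < m)
    (h₂ : k + m < i₂) (h₃ : i₂ < i₃) (hg : i₃ ≤ g) (hsm : 40 * s ≤ m) (hn : k ≤ n * s)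
    (hf : IsCochain (colorRestriction F g {k, k + m, i₂, i₃}) f) :
    ∃ H : Submodule F (Space F g) → isometryGroup (symplecticForm F g) → Γ,
      ∀ u v, u ≤ v → Isotropic (symplecticForm F g) v → finrank F u < finrank F v →
        finrank F u ∈ ({k, k + m, i₂, i₃} : Finset ℕ) →
        finrank F v ∈ ({k, k + m, i₂, i₃} : Finset ℕ) →
          disagree (translates (symplecticForm F g) f u v) (H u * (H v)⁻¹) ≤
            64 * (n * (2160 * n + 74) + 1) *
              coboundaryWeight (colorRestriction F g {k, k + m, i₂, i₃}) 3 f *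
              Fintype.card (isometryGroup (symplecticForm F g)) := by
  obtain ⟨H, hH⟩ := (nearCocycle_translates hk hm h₂ h₃ hg hf).exists_primitive hsm hn
  exact ⟨H, fun u v h1 h2 h3 h4 h5 => (hH u v h1 h2 h3 h4 h5).trans_eq (by ring)⟩

end

instance : Finite (isometryGroup (symplecticForm F g)) :=
  Finite.of_injective (fun h x => (h : Space F g ≃ₗ[F] Space F g) x) fun _ _ h =>
    Subtype.ext (LinearEquiv.ext fun x => congrFun h x)

variable {k m i₂ i₃ s n : ℕ}

/-- A quantitative form of coboundary expansion with an explicit constant. -/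
theorem exists_cochainDist_le (hk : 0 < k) (hm : 0 < m) (h₂ : k + m < i₂) (h₃ : i₂ < i₃)
    (hg : i₃ ≤ g) (hsm : 40 * s ≤ m) (hn : k ≤ n * s)
    (hf : IsCochain (colorRestriction F g {k, k + m, i₂, i₃}) f) :
    ∃ h, cochainDist (colorRestriction F g {k, k + m, i₂, i₃}) 3 f (coboundaryZero h) ≤
      64 * (n * (2160 * n + 74) + 1) *
        coboundaryWeight (colorRestriction F g {k, k + m, i₂, i₃}) 3 f := by
  have := Fintype.ofFinite (Submodule F (Space F g))
  have := Fintype.ofFinite (isometryGroup (symplecticForm F g))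
  obtain ⟨H, hH⟩ := exists_primitive_translates hk hm h₂ h₃ hg hsm hn hf
  exact exists_cochainDist_le_of_disagree_le
    (mul_nonneg (by positivity) coboundaryWeight_nonneg) hf H hH

/-- Zero weight forces zero disagreement, so the primitive is exact at every group element and may
be read off at the identity. The error constant is irrelevant, so steps of size 1 suffice. -/
theorem isCoboundary_of_isCocycle (hk : 0 < k) (hm : 40 ≤ m) (h₂ : k + m < i₂) (h₃ : i₂ < i₃)
    (hg : i₃ ≤ g) (hf : IsCocycle (colorRestriction F g {k, k + m, i₂, i₃}) f) :
    IsCoboundary (colorRestriction F g {k, k + m, i₂, i₃}) f := by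
  classical
  have := Fintype.ofFinite (Submodule F (Space F g))
  have := Fintype.ofFinite (isometryGroup (symplecticForm F g))
  obtain ⟨H, hH⟩ := exists_primitive_translates (s := 1) (n := k) hk (by omega) h₂ h₃ hg hm
    (by omega) hf.1
  have key : ∀ u v, u ≤ v → Isotropic (symplecticForm F g) v → finrank F u < finrank F v →
      finrank F u ∈ ({k, k + m, i₂, i₃} : Finset ℕ) →
      finrank F v ∈ ({k, k + m, i₂, i₃} : Finset ℕ) → f u v = H u 1 * (H v 1)⁻¹ := by
    intro u v h1 h2 h3 h4 h5
    have h6 := hH u v h1 h2 h3 h4 h5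
    rw [coboundaryWeight_eq_zero hf, mul_zero, zero_mul, disagree] at h6
    by_contra hne
    have h7 : (1 : isometryGroup (symplecticForm F g)) ∈ ({i | translates (symplecticForm F g) f
        u v i ≠ (H u * (H v)⁻¹) i} : Finset _) := by
      refine mem_filter.2 ⟨mem_univ _, ?_⟩
      simpa [translates] using hne
    exact absurd (card_pos.2 ⟨1, h7⟩) (not_lt.2 (by exact_mod_cast h6))
  refine ⟨fun u => H u 1, fun u v huv => ?_⟩
  obtain ⟨hne, t, ht, hu, hv⟩ := huv
  have h4 := (mem_faces.1 ht).2.1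
  rcases eq_or_finrank_lt ht hu hv with h | ⟨h, h'⟩ | ⟨h, h'⟩
  · exact absurd h hne
  · exact key u v h (h4 v hv).2.1 h' (h4 u hu).2.2 (h4 v hv).2.2
  · rw [hf.1 u v ⟨hne, t, ht, hu, hv⟩, key v u h (h4 u hu).2.1 h' (h4 v hv).2.2 (h4 u hu).2.2]
    simp [coboundaryZero]

end SymplecticBuilding

/-! ### Numerical estimates and conclusion -/

section Estimates

open Real

/-- Let l = log (q/m). One of p, q - p is at least q/2, so the minimum is at most log 2 - l. The
total exponent is at most l (2 + log 2) - l², which is below 2 for every l. -/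
theorem exp_log_mul_min_log_mul_sq_le {m p q : ℝ} (hm : 0 < m) (hp : 0 < p) (hq : p + m ≤ q) :
    exp (log (q / m) * min (log (m / (q - p))) (log (m / p))) * (q / m) ^ 2 ≤ exp 2 := by
  have hq0 : 0 < q := by linarith
  set l := log (q / m) with hl
  have hl0 : 0 ≤ l := log_nonneg ((one_le_div hm).2 (by linarith))
  have hmin : min (log (m / (q - p))) (log (m / p)) ≤ log 2 - l := by
    have e : log 2 - l = log (m / (q / 2)) := by
      rw [hl, ← log_div two_ne_zero (by positivity)]
      congr 1
      field_simp
    rw [e]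
    rcases le_total p (q / 2) with h | h
    · refine (min_le_left _ _).trans (log_le_log (by apply div_pos hm; linarith) ?_)
      exact div_le_div_of_nonneg_left hm.le (by linarith) (by linarith)
    · refine (min_le_right _ _).trans (log_le_log (by positivity) ?_)
      exact div_le_div_of_nonneg_left hm.le (by linarith) h
  have hsq : (q / m) ^ 2 = exp (2 * l) := by
    rw [two_mul, exp_add, hl, exp_log (by positivity), sq]
  rw [hsq, ← exp_add, exp_le_exp]
  have h1 := mul_le_mul_of_nonneg_left hmin hl0
  have h2 := log_two_lt_d9
  -- The maximum of the quadratic is near l = (2 + log 2)/2 ≈ 1.35.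
  nlinarith [sq_nonneg (l - 1.35), mul_le_mul_of_nonneg_left h2.le hl0]

/-- For m ≥ 80 rounding gives m ≤ 60 ⌊m/40⌋, so n m ≤ 60 k + m ≤ 61 q. As n ≥ 1, the polynomial in n
is at most (2160 + 74 + 1) n². -/
theorem primitive_bound_le {k m q : ℕ} (hm : 80 ≤ m) (hq : k + m ≤ q) :
    64 * (((k / (m / 40) + 1 : ℕ) : ℝ) * (2160 * ((k / (m / 40) + 1 : ℕ) : ℝ) + 74) + 1) ≤
      64 * 2235 * 61 ^ 2 * ((q : ℝ) / m) ^ 2 := by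
  set s := m / 40 with hs
  set n := k / s + 1 with hn
  have hs60 : m ≤ 60 * s := by omega
  have hmpos : (0 : ℝ) < m := by exact_mod_cast (by omega : 0 < m)
  have hn1 : (1 : ℝ) ≤ n := by exact_mod_cast Nat.le_add_left 1 (k / s)
  have hnm : n * m ≤ 61 * q := by
    have h1 := Nat.div_mul_le_self k s
    have h2 : k / s * m ≤ k / s * (60 * s) := Nat.mul_le_mul_left _ hs60
    rw [hn, add_mul]
    nlinarith
  have hna : (n : ℝ) ≤ 61 * (q / m) := by
    rw [← mul_div_assoc, le_div_iff₀ hmpos]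
    exact_mod_cast hnm
  nlinarith [mul_le_mul hna hna (by positivity) (by positivity)]

end Estimates

theorem lemma6p6 :
    ∃ c : ℝ, 0 < c ∧ ∃ K : ℝ, 0 < K ∧
      ∀ (F : Type u) [Field F] [Finite F] (g i₀ i₁ i₂ i₃ : ℕ),
        0 < i₀ → i₀ + 79 < i₁ → i₁ < i₂ → i₂ < i₃ → i₃ ≤ g →
          SimplicialExpansion.IsCoboundaryExpander.{w}
            (SymplecticBuilding.colorRestriction F g {i₀, i₁, i₂, i₃}) 3
            (c * Real.exp (K * (Real.log ((i₃ : ℝ) / ((i₁ : ℝ) - (i₀ : ℝ))) *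
              min (Real.log (((i₁ : ℝ) - (i₀ : ℝ)) / ((i₃ : ℝ) - (i₀ : ℝ))))
                (Real.log (((i₁ : ℝ) - (i₀ : ℝ)) / (i₀ : ℝ)))))) := by
  -- The constant c is the reciprocal of the product of the two numerical bounds, and K = 1 works
  -- because the loss is quadratic in i₃/m.
  refine ⟨(64 * 2235 * 61 ^ 2 * Real.exp 2)⁻¹, by positivity, 1, one_pos, ?_⟩
  intro F _ _ g i₀ i₁ i₂ i₃ h₀ h₁ h₂ h₃ hg
  obtain ⟨m, rfl⟩ := Nat.exists_eq_add_of_le (show i₀ ≤ i₁ by omega)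
  have hm : 80 ≤ m := by omega
  have hq : i₀ + m ≤ i₃ := by omega
  rw [Nat.cast_add, add_sub_cancel_left, one_mul]
  have hexp := exp_log_mul_min_log_mul_sq_le (m := m) (p := i₀) (q := i₃)
    (by exact_mod_cast (by omega : 0 < m)) (by exact_mod_cast h₀) (by exact_mod_cast hq)
  have hbound := primitive_bound_le hm hq
  set E := Real.exp (Real.log ((i₃ : ℝ) / m) *
    min (Real.log ((m : ℝ) / (i₃ - i₀))) (Real.log ((m : ℝ) / i₀))) with hE
  have hE0 : 0 < E := Real.exp_pos _
  set n := i₀ / (m / 40) + 1 with hn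
  have hs : 40 * (m / 40) ≤ m := by omega
  have hns : i₀ ≤ n * (m / 40) := by
    have := Nat.lt_div_mul_add (a := i₀) (b := m / 40) (by omega)
    rw [hn, add_mul, one_mul]
    exact this.le
  refine ⟨⟨by positivity, fun Γ _ f hf => ?_⟩, fun Γ _ f => ⟨fun hf => ?_, fun hf => hf.isCocycle⟩⟩
  · obtain ⟨h, hh⟩ := SymplecticBuilding.exists_cochainDist_le h₀ (by omega) h₂ h₃ hg hs hns hf
    refine ⟨_, SimplicialExpansion.isCocycle_coboundaryZero _ h, ?_⟩
    set W := SimplicialExpansion.coboundaryWeight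
      (SymplecticBuilding.colorRestriction F g {i₀, i₀ + m, i₂, i₃}) 3 f with hW
    have hW0 : 0 ≤ W := div_nonneg (Nat.cast_nonneg _) (Nat.cast_nonneg _)
    have hconst : (64 * 2235 * 61 ^ 2 * Real.exp 2)⁻¹ * E *
        (64 * ((n : ℝ) * (2160 * n + 74) + 1)) ≤ 1 := by
      rw [mul_assoc, inv_mul_le_iff₀ (by positivity), mul_one]
      calc _ ≤ E * (64 * 2235 * 61 ^ 2 * ((i₃ : ℝ) / m) ^ 2) := by gcongr
        _ = 64 * 2235 * 61 ^ 2 * (E * ((i₃ : ℝ) / m) ^ 2) := by ring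
        _ ≤ _ := by gcongr
    calc _ ≤ (64 * 2235 * 61 ^ 2 * Real.exp 2)⁻¹ * E *
          (64 * ((n : ℝ) * (2160 * n + 74) + 1) * W) := by gcongr
      _ = (64 * 2235 * 61 ^ 2 * Real.exp 2)⁻¹ * E *
          (64 * ((n : ℝ) * (2160 * n + 74) + 1)) * W := by ring
      _ ≤ 1 * W := by gcongr
      _ = W := one_mul W
  · exact SymplecticBuilding.isCoboundary_of_isCocycle h₀ (by omega) h₂ h₃ hg hf
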